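/- \textbf{Theorem (Cut-independent conditioning of $K_{\rm red}$).} \emph{Geometry.} Let $\Omega\subset\mathbb R^2$ be a bounded domain whose boundary $\Gamma$ is a simple closed regular $C^3$ curve, let $\Gamma=\{\psi=0\}$ and $\Omega=\{\psi<0\}$, where in a tubular neighbourhood of $\Gamma$ the function $\psi$ is $C^3$ with $|\nabla\psi|$ bounded away from $0$. Place $\Gamma$ by an arbitrary rigid motion relative to the uniform Cartesian mesh $\mathcal T_h$ of closed squares of side $h$ with vertex set $(h\mathbb Z)^2$ (and move $\psi$ along with it). A cell is active if it meets $\Gamma$; let $\gamma$ be the set of vertices of active cells, $\gamma_1=\{x\in\gamma:\psi(x)\le 0\}$, $\gamma_2$ the set of $x\in\gamma$ with $\psi(x)>0$ that have one of their four lattice neighbours in $\gamma_1$, and $\gamma_3$ the set of all other $x\in\gamma$ with $\psi(x)>0$. Assume the nondegenerate cut convention: $\Gamma$ crosses mesh edges transversally, and $\Gamma\cap T$ is connected for every cell $T$. No lower bound on the cut ratio is assumed. In each active cell $T$ let $\Gamma^h_T$ be the straight segment connecting the points of $\Gamma\cap\partial T$, let $\Gamma^h=\bigcup_T\Gamma^h_T$,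 and let $P$ be the orthogonal projection onto the tangent direction of $\Gamma^h$. \emph{Matrices.} Let $\varphi_i$ $(i\in\gamma)$ be the bilinear ($\mathcal Q_1$) nodal basis functions and $K_{ij}=\int_{\Gamma^h}(P\nabla\varphi_i)\cdot(P\nabla\varphi_j)\,ds_h$. Let $G_h$ be the lattice Green's function of the five-point Laplacian $L_h$, $-L_hG_h=\delta_0$ on $(h\mathbb Z)^2$, with logarithmic growth and with an arbitrary fixed choice of the additive constant. Let either $P(x,y)=G_h(x-y)$ (single layer) or $P(x,y)=\sum_{z\sim y,\,z\notin\gamma}[G_h(x-z)-G_h(x-y)]$ (double layer), and let $P_1$, $P_2$ be the matrices of $P(x,y)$ with sources $y\in\gamma_2$ and targets $x\in\gamma_1$, respectively $x\in\gamma_2$. Assume that $P_2$ is invertible and put $H=P_1P_2^{-1}$. Call $e\in\{\pm e_1,\pm e_2\}$ admissible at $\eta\in\gamma_3$ if $\eta-he,\ \eta-2he\in\gamma_1\cup\gamma_2$; assume that every $\eta\in\gamma_3$ has an admissible direction. Let $R_1u_1+R_2u_2+u_3=0$ be the relations $u(\eta)=\tfrac12[2u(\eta-he)-u(\eta-2he)]+\tfrac12[2u(\eta-he')-u(\eta-2he')]$,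 $\eta\in\gamma_3$, with a chosen pair of orthogonal admissible directions $e,e'$ at $\eta$ if there is one, and with $e=e'$ a chosen admissible direction otherwise. Put $J=R_1H+R_2$, $E=\begin{pmatrix}H\\ I\\ -J\end{pmatrix}:\mathbb R^{\gamma_2}\to\mathbb R^{\gamma}$ and $K_{\rm red}=E^TKE$. Identify a nodal vector with its $\mathcal Q_1$ function and let $W=\{v_2\in\mathbb R^{\gamma_2}:\int_{\Gamma^h}Ev_2\,ds_h=0\}$ (the discrete mean-zero reduced space). \emph{Claim.} There are constants $C>0$ and $h_0>0$, depending only on $\Gamma$ and $\psi$, such that for all $0<h\le h_0$, all positions of $\Gamma$ relative to the mesh and all choices as above, $K_{\rm red}$ is positive definite on $W$ and \[ \kappa(K_{\rm red}):=\frac{\max_{0\ne v\in W} v^TK_{\rm red}v/v^Tv}{\min_{0\ne v\in W} v^TK_{\rm red}v/v^Tv}\le C\,h^{-2}. \] In particular, $C$ is independent of $h$ and of the cut configuration. -/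

import Mathlib

open MeasureTheory Matrix

noncomputable section

/-- The Euclidean plane. -/
abbrev Plane : Type := EuclideanSpace ℝ (Fin 2)

/-! ### The curve -/

/-- A simple closed regular `C³` curve `Γ = {ψ = 0}` which bounds the bounded domain
`Ω = {ψ < 0}`; the level-set function is `C³` with gradient bounded away from zero
in a tubular neighbourhood of `Γ`. -/
structure LevelSetCurve where
  /-- the level-set function -/
  ψ : Plane → ℝ
  isOpen_interior : IsOpen {x | ψ x < 0}
  isConnected_interior : IsConnected {x | ψ x < 0}
  isBounded_interior : Bornology.IsBounded {x | ψ x < 0}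
  frontier_interior : frontier {x | ψ x < 0} = {x | ψ x = 0}
  simple_closed : ∃ c : ℝ → Plane, ContDiff ℝ 3 c ∧ Function.Periodic c 1 ∧
    Set.InjOn c (Set.Ico 0 1) ∧ (∀ t, deriv c t ≠ 0) ∧ Set.range c = {x | ψ x = 0}
  regular : ∃ r > 0, ContDiffOn ℝ 3 ψ (Metric.thickening r {x | ψ x = 0}) ∧
    ∃ m > 0, ∀ x ∈ Metric.thickening r {x | ψ x = 0}, m ≤ ‖gradient ψ x‖

/-- A position of the curve relative to the Cartesian mesh with vertex set `(hℤ)²`: the mesh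
size `h` and a rigid motion `pos`.  The curve seen by the mesh is `{x | ψ (pos x) = 0}`. -/
structure CutMesh (Γ : LevelSetCurve) where
  /-- the mesh size -/
  h : ℝ
  h_pos : 0 < h
  /-- the rigid motion -/
  pos : Plane ≃ᵃⁱ[ℝ] Plane

/-! ### The Cartesian mesh, with vertices and cells indexed by `ℤ × ℤ` -/

/-- The mesh vertex with index `p`. -/
def vertex (h : ℝ) (p : ℤ × ℤ) : Plane := !₂[h * p.1, h * p.2]

/-- The closed mesh cell whose lower left vertex has index `k`. -/
def cell (h : ℝ) (k : ℤ × ℤ) : Set Plane :=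
  {x | (h * k.1 ≤ x 0 ∧ x 0 ≤ h * (k.1 + 1)) ∧ (h * k.2 ≤ x 1 ∧ x 1 ≤ h * (k.2 + 1))}

/-- The closed horizontal mesh edge that starts at the vertex `p`. -/
def edgeH (h : ℝ) (p : ℤ × ℤ) : Set Plane := segment ℝ (vertex h p) (vertex h (p + (1, 0)))

/-- The closed vertical mesh edge that starts at the vertex `p`. -/
def edgeV (h : ℝ) (p : ℤ × ℤ) : Set Plane := segment ℝ (vertex h p) (vertex h (p + (0, 1)))

/-- The boundary of a cell, as the union of its four edges. -/
def cellBoundary (h : ℝ) (k : ℤ × ℤ) : Set Plane :=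
  edgeH h k ∪ edgeH h (k + (0, 1)) ∪ edgeV h k ∪ edgeV h (k + (1, 0))

/-- The indices of the four vertices of a cell. -/
def corners (k : ℤ × ℤ) : Finset (ℤ × ℤ) := {k, k + (1, 0), k + (0, 1), k + (1, 1)}

/-- The four coordinate directions `±e₁, ±e₂`. -/
def directions : Finset (ℤ × ℤ) := {(1, 0), (-1, 0), (0, 1), (0, -1)}

/-- The lattice neighbours of `p`. -/
def neighbors (p : ℤ × ℤ) : Finset (ℤ × ℤ) := directions.image (fun e => p + e)

/-- The conforming bilinear (`Q₁`) nodal basis function of the vertex `p`. -/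
def hat (h : ℝ) (p : ℤ × ℤ) (x : Plane) : ℝ :=
  max 0 (1 - |x 0 - h * p.1| / h) * max 0 (1 - |x 1 - h * p.2| / h)

/-! ### The lattice Green's function -/

/-- The Green's function of the five-point Laplacian
`L_h v (x) = h⁻² (∑ v (neighbours of x) - 4 v (x))` on `(hℤ)²`, with `-L_h G = δ₀`, as a function
of the lattice index.  In the plane it is determined up to the additive constant `h² κ`
by its logarithmic growth. -/
def latticeGreen (h κ : ℝ) (p : ℤ × ℤ) : ℝ :=
  h ^ 2 * (κ + ((2 * Real.pi) ^ 2)⁻¹ *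
    ∫ θ in Set.Icc (-Real.pi) Real.pi ×ˢ Set.Icc (-Real.pi) Real.pi,
      (Real.cos (p.1 * θ.1 + p.2 * θ.2) - 1) / (4 - 2 * Real.cos θ.1 - 2 * Real.cos θ.2))

/-- The choice between single- and double-layer potentials. -/
inductive LayerKind
  | single
  | double

namespace CutMesh

variable {Γ : LevelSetCurve} (M : CutMesh Γ)

/-- The level-set function of the positioned curve. -/
def φ (x : Plane) : ℝ := Γ.ψ (M.pos x)

/-- The positioned curve. -/
def curve : Set Plane := {x | M.φ x = 0}

/-- The cells that meet the curve. -/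
def activeCells : Set (ℤ × ℤ) := {k | (M.curve ∩ cell M.h k).Nonempty}

/-- The vertices of the active cells. -/
def activeVertices : Set (ℤ × ℤ) := {p | ∃ k ∈ M.activeCells, p ∈ corners k}

/-- The interior active vertices. -/
def γ₁ : Set (ℤ × ℤ) := {p | p ∈ M.activeVertices ∧ M.φ (vertex M.h p) ≤ 0}

/-- The exterior active vertices with a lattice neighbour in `γ₁`. -/
def γ₂ : Set (ℤ × ℤ) :=
  {p | p ∈ M.activeVertices ∧ 0 < M.φ (vertex M.h p) ∧ ∃ q ∈ neighbors p, q ∈ M.γ₁}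

/-- The remaining exterior active vertices. -/
def γ₃ : Set (ℤ × ℤ) :=
  {p | p ∈ M.activeVertices ∧ 0 < M.φ (vertex M.h p) ∧ p ∉ M.γ₂}

lemma finite_activeCells : M.activeCells.Finite := by
  have hb : Bornology.IsBounded {x | Γ.ψ x = 0} := by
    rw [← Γ.frontier_interior]
    exact Γ.isBounded_interior.closure.subset frontier_subset_closure
  have hb' : Bornology.IsBounded M.curve := by
    have : M.curve = M.pos ⁻¹' {x | Γ.ψ x = 0} := rfl
    rw [this]
    exact M.pos.isometry.antilipschitz.isBounded_preimage hb
  obtain ⟨R, hR⟩ := hb'.exists_norm_le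
  have hh := M.h_pos
  have key : ∀ (x : Plane) (i : Fin 2), x ∈ M.curve → |x i| ≤ R := fun x i hx =>
    (Real.norm_eq_abs (x i) ▸ PiLp.norm_apply_le x i).trans (hR x hx)
  have key2 : ∀ (a : ℤ) (t : ℝ), |t| ≤ R → M.h * a ≤ t → t ≤ M.h * (a + 1) →
      a ∈ Set.Icc (-⌈R / M.h + 1⌉) ⌈R / M.h + 1⌉ := by
    intro a t ht h1 h2
    obtain ⟨h3, h4⟩ := abs_le.mp ht
    have hc := Int.le_ceil (R / M.h + 1)
    have e : M.h * (R / M.h) = R := by field_simp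
    have h5 : (a : ℝ) ≤ R / M.h + 1 := by
      by_contra hcon
      push Not at hcon
      nlinarith
    have h6 : -(R / M.h + 1) ≤ (a : ℝ) := by
      by_contra hcon
      push Not at hcon
      nlinarith
    constructor
    · have : ((-⌈R / M.h + 1⌉ : ℤ) : ℝ) ≤ (a : ℝ) := by push_cast; linarith
      exact_mod_cast this
    · exact_mod_cast h5.trans hc
  refine ((Set.finite_Icc (-⌈R / M.h + 1⌉) ⌈R / M.h + 1⌉).prod
    (Set.finite_Icc (-⌈R / M.h + 1⌉) ⌈R / M.h + 1⌉)).subset ?_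
  rintro ⟨a, b⟩ ⟨x, hx, hxa, hxb⟩
  exact ⟨key2 a (x 0) (key x 0 hx) hxa.1 hxa.2, key2 b (x 1) (key x 1 hx) hxb.1 hxb.2⟩

lemma finite_activeVertices : M.activeVertices.Finite := by
  have : M.activeVertices = ⋃ k ∈ M.activeCells, (corners k : Set (ℤ × ℤ)) := by
    ext p
    simp [activeVertices]
  rw [this]
  exact M.finite_activeCells.biUnion fun k _ => (corners k).finite_toSet

instance : Fintype M.activeCells := M.finite_activeCells.fintype

instance : Fintype M.γ₁ := (M.finite_activeVertices.subset fun _ hp => hp.1).fintype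

instance : Fintype M.γ₂ := (M.finite_activeVertices.subset fun _ hp => hp.1).fintype

instance : Fintype M.γ₃ := (M.finite_activeVertices.subset fun _ hp => hp.1).fintype

/-- The active vertices, ordered as `(γ₁, γ₂, γ₃)`. -/
abbrev Idx : Type := M.γ₁ ⊕ M.γ₂ ⊕ M.γ₃

/-- The lattice index of an active vertex. -/
def site : M.Idx → ℤ × ℤ
  | Sum.inl p => p
  | Sum.inr (Sum.inl p) => p
  | Sum.inr (Sum.inr p) => p

/-! ### The discrete curve and the surface stiffness matrix -/

/-- The zero crossings of the level-set function on the boundary of a cell. -/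
def crossings (k : ℤ × ℤ) : Set Plane := {x | x ∈ cellBoundary M.h k ∧ M.φ x = 0}

/-- The straight segment of the discrete curve `Γ^h` in a cell. -/
def cutSegment (k : ℤ × ℤ) : Set Plane := convexHull ℝ (M.crossings k)

/-- The tangential projection `I - n nᵀ` on the segment in a cell: the orthogonal projection
onto its direction. -/
def tangentProj (k : ℤ × ℤ) : Plane →L[ℝ] Plane :=
  (vectorSpan ℝ (M.crossings k)).starProjection

/-- The integral over the discrete curve, with respect to arc length,
of a function given cell by cell. -/
def curveIntegral (f : ℤ × ℤ → Plane → ℝ) : ℝ :=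
  ∑ k : M.activeCells, ∫ x in M.cutSegment k, f k x ∂(Measure.hausdorffMeasure 1)

/-- The assembled surface stiffness matrix
`K i j = ∫_{Γ^h} (P ∇φᵢ) · (P ∇φⱼ) ds_h` of the plain `Q₁` Galerkin discretization. -/
def stiffness : Matrix M.Idx M.Idx ℝ := Matrix.of fun i j =>
  M.curveIntegral fun k x =>
    inner ℝ (M.tangentProj k (gradient (hat M.h (M.site i)) x))
      (M.tangentProj k (gradient (hat M.h (M.site j)) x))

/-- The nondegenerate cut convention: all intersections of the curve with mesh edges are
transverse, and each cell is cut by at most one connected piece of the curve. -/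
def NondegenerateCut : Prop :=
  (∀ p, ∀ x ∈ edgeH M.h p, M.φ x = 0 → fderiv ℝ M.φ x (EuclideanSpace.single 0 1) ≠ 0) ∧
  (∀ p, ∀ x ∈ edgeV M.h p, M.φ x = 0 → fderiv ℝ M.φ x (EuclideanSpace.single 1 1) ≠ 0) ∧
  ∀ k, IsPreconnected (M.curve ∩ cell M.h k)

/-! ### The discrete harmonic extension -/

open Classical in
/-- The single- or double-layer potential kernel with target `x` and source `y`:
`S = G_h(x - y)`, and `D = ∑ (G_h(x - z) - G_h(x - y))` over the inactive neighbours `z` of `y`. -/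
def layerKernel (κ : ℝ) : LayerKind → ℤ × ℤ → ℤ × ℤ → ℝ
  | .single, x, y => latticeGreen M.h κ (x - y)
  | .double, x, y => ∑ z ∈ (neighbors y).filter (fun z => z ∉ M.activeVertices),
      (latticeGreen M.h κ (x - z) - latticeGreen M.h κ (x - y))

/-- The layer block with sources in `γ₂` and targets in `γ₁`. -/
def P₁ (κ : ℝ) (l : LayerKind) : Matrix M.γ₁ M.γ₂ ℝ :=
  Matrix.of fun x y => M.layerKernel κ l x y

/-- The layer block with sources and targets in `γ₂`. -/
def P₂ (κ : ℝ) (l : LayerKind) : Matrix M.γ₂ M.γ₂ ℝ :=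
  Matrix.of fun x y => M.layerKernel κ l x y

/-- The discrete harmonic extension `H = P₁ P₂⁻¹` from `γ₂` to `γ₁`
(meaningful if `P₂` is invertible). -/
def harmExt (κ : ℝ) (l : LayerKind) : Matrix M.γ₁ M.γ₂ ℝ := M.P₁ κ l * (M.P₂ κ l)⁻¹

/-! ### The extrapolation to `γ₃` -/

/-- The coordinate direction `e` is admissible at `η`: both `η - e` and `η - 2e`
are in `γ₁ ∪ γ₂`. -/
def Admissible (η e : ℤ × ℤ) : Prop :=
  e ∈ directions ∧ η - e ∈ M.γ₁ ∪ M.γ₂ ∧ η - 2 • e ∈ M.γ₁ ∪ M.γ₂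

/-- A choice of extrapolation directions: a pair of orthogonal admissible directions where there
is one, otherwise a single admissible direction (repeated).  In particular, every vertex in `γ₃`
has an admissible direction. -/
def IsExtrapolation (d : M.γ₃ → (ℤ × ℤ) × (ℤ × ℤ)) : Prop :=
  ∀ η : M.γ₃, M.Admissible η (d η).1 ∧ M.Admissible η (d η).2 ∧
    ((d η).1.1 * (d η).2.1 + (d η).1.2 * (d η).2.2 = 0 ∨
      ((d η).1 = (d η).2 ∧ ∀ e e', M.Admissible η e → M.Admissible η e' →
        e.1 * e'.1 + e.2 * e'.2 ≠ 0))

/-- The coefficient of `v(ξ)` in the relation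
`v(η) - ½ (2 v(η - e) - v(η - 2e)) - ½ (2 v(η - e') - v(η - 2e')) = 0`, for `ξ ≠ η`. -/
def extrapCoeff (η : ℤ × ℤ) (d : (ℤ × ℤ) × (ℤ × ℤ)) (ξ : ℤ × ℤ) : ℝ :=
  -(1 / 2) * ((if ξ = η - d.1 then 2 else 0) - (if ξ = η - 2 • d.1 then 1 else 0)) -
    (1 / 2) * ((if ξ = η - d.2 then 2 else 0) - (if ξ = η - 2 • d.2 then 1 else 0))

/-- The matrix `R₁` of the extrapolation relation `R₁ u₁ + R₂ u₂ + u₃ = 0`. -/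
def R₁ (d : M.γ₃ → (ℤ × ℤ) × (ℤ × ℤ)) : Matrix M.γ₃ M.γ₁ ℝ :=
  Matrix.of fun η ξ => extrapCoeff η (d η) ξ

/-- The matrix `R₂` of the extrapolation relation `R₁ u₁ + R₂ u₂ + u₃ = 0`. -/
def R₂ (d : M.γ₃ → (ℤ × ℤ) × (ℤ × ℤ)) : Matrix M.γ₃ M.γ₂ ℝ :=
  Matrix.of fun η ξ => extrapCoeff η (d η) ξ

/-! ### The reduced operator -/

/-- `J = R₁ H + R₂`. -/
def J (κ : ℝ) (l : LayerKind) (d : M.γ₃ → (ℤ × ℤ) × (ℤ × ℤ)) : Matrix M.γ₃ M.γ₂ ℝ :=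
  M.R₁ d * M.harmExt κ l + M.R₂ d

/-- The reconstruction `E = (H, I, -J)ᵀ`, whose range consists of the nodal vectors of the
reduced trial space. -/
def E (κ : ℝ) (l : LayerKind) (d : M.γ₃ → (ℤ × ℤ) × (ℤ × ℤ)) : Matrix M.Idx M.γ₂ ℝ :=
  Matrix.fromRows (M.harmExt κ l) (Matrix.fromRows 1 (-(M.J κ l d)))

/-- The direct reduced operator `K_red = Eᵀ K E`. -/
def Kred (κ : ℝ) (l : LayerKind) (d : M.γ₃ → (ℤ × ℤ) × (ℤ × ℤ)) : Matrix M.γ₂ M.γ₂ ℝ :=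
  (M.E κ l d)ᵀ * M.stiffness * M.E κ l d

/-- The finite element function with the given nodal values at the active vertices. -/
def feFun (u : M.Idx → ℝ) (x : Plane) : ℝ := ∑ i, u i * hat M.h (M.site i) x

/-- The coefficient vectors on `γ₂` of the discrete mean-zero reduced space:
`∫_{Γ^h} E v₂ ds_h = 0`. -/
def meanZero (κ : ℝ) (l : LayerKind) (d : M.γ₃ → (ℤ × ℤ) × (ℤ × ℤ)) : Set (M.γ₂ → ℝ) :=
  {v | M.curveIntegral (fun _ x => M.feFun (M.E κ l d *ᵥ v) x) = 0}

end CutMesh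

/-! ### The condition number -/

/-- The Rayleigh quotients, in the Euclidean coefficient norm, of `A` at the nonzero vectors
of `W`. -/
def rayleighValues {n : Type*} [Fintype n] (A : Matrix n n ℝ) (W : Set (n → ℝ)) : Set ℝ :=
  {r | ∃ v ∈ W, v ≠ 0 ∧ r = (v ⬝ᵥ A *ᵥ v) / (v ⬝ᵥ v)}

/-- The condition number `λ_max / λ_min` on the subspace `W` of a symmetric matrix that is
positive definite there: the ratio of the largest to the smallest Rayleigh quotient. -/
def condNumberOn {n : Type*} [Fintype n] (A : Matrix n n ℝ) (W : Set (n → ℝ)) : ℝ :=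
  sSup (rayleighValues A W) / sInf (rayleighValues A W)

end

/-! ### Discrete harmonic functions on the square lattice -/

/-! For `v` on `γ₂`, the vector `E v` consists of the active values of a lattice function `U` that
is discrete harmonic at every inner vertex (`φ ≤ 0`), equals `v` on `γ₂` and is extrapolated on `γ₃`
(`exists_harmonic_representative`). The claim thus reduces to two bounds for the tangential energy
of the trace of `U` on the discrete curve: at most `C h⁻¹ |v|²`, and at least `c h |v|²` if the
trace has mean zero (`Kred_bounds`). Their quotient is `C h⁻²`.

Upper bound. Along the chord of a cell a bilinear function is quadratic, with parameter derivative
of order (chord length)/`h` times the nodal values. Hence the cell energy is at most `C h⁻¹` times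
the nodal squares, however short the chord. Values on `γ₃` are local combinations of those on `γ₁ ∪
γ₂`. Values on `γ₁` are controlled because `U²` is subharmonic and every active vertex is within
three steps of the exterior, so that a random walk visits `γ₁` only boundedly often before it leaves
(`DiscreteHarmonicOn.sum_sq_le`).

Lower bound. The discrete curve is connected and has `O(1/h)` segments, so the maximum `m` of a
mean-zero trace satisfies `m² ≤ C · energy` (`NondegenerateCut.sq_feFun_le`). It remains to show
`|v|² ≤ C n m²` with `n = #γ₁` (`sum_γ₂_le_trace`). Here small cuts are the danger: on an edge from
an inner `x` to an outer `x + a`, crossed at parameter `θ`, the trace only bounds `w = U(x) + θ δ`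
with `δ = U(x+a) - U(x)`. Green's identity gives A := ∑ (interior differences)² + ∑ θ δ² = ∑ (2 w δ
- θ δ²) ≤ ε ∑ δ² + C ε⁻¹ n m². The weights `θ` may be tiny, yet `LocalBounds.abs_sub_le` bounds
every unweighted `δ²` by nearby terms of `A` plus `C m²`, so `ε ∑ δ²` can be absorbed. The
mechanism: at an edge transverse to the curve with small `θ`, harmonicity expresses `δ` by the other
three differences at `x`; a difference along the curve is obtained from the mixed second difference
of a cell, which can be read off the trace on the chord.

Geometry. At mesh scale the level-set function is nearly affine (`exists_chart`), uniformly in the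
position of the curve; all case distinctions on how a cell is cut rest on this and never on a cut
ratio. -/

lemma sum_directions (f : ℤ × ℤ → ℝ) :
    ∑ e ∈ directions, f e = f (1, 0) + f (-1, 0) + f (0, 1) + f (0, -1) := by
  rw [directions, Finset.sum_insert (by decide), Finset.sum_insert (by decide),
    Finset.sum_insert (by decide), Finset.sum_singleton]
  ring

lemma neg_mem_directions {e : ℤ × ℤ} (he : e ∈ directions) : -e ∈ directions := by
  simp only [directions, Finset.mem_insert, Finset.mem_singleton] at he
  rcases he with rfl | rfl | rfl | rfl <;> decide

/-- Reversal `(x, e) ↦ (x + e, -e)` permutes the directed edges inside `S`; this is the summation by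
parts behind both Green identities below. -/
lemma sum_interior_edges_swap (S : Finset (ℤ × ℤ)) (a : ℤ × ℤ → ℤ × ℤ → ℝ) :
    ∑ x ∈ S, ∑ e ∈ directions, (if x + e ∈ S then a x (x + e) else 0) =
      ∑ x ∈ S, ∑ e ∈ directions, (if x + e ∈ S then a (x + e) x else 0) := by
  rw [← Finset.sum_product', ← Finset.sum_product', ← Finset.sum_filter, ← Finset.sum_filter]
  refine Finset.sum_nbij' (fun p => (p.1 + p.2, -p.2)) (fun p => (p.1 + p.2, -p.2)) ?_ ?_ ?_ ?_ ?_
  · rintro ⟨x, e⟩ h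
    simp only [Finset.mem_filter, Finset.mem_product] at h ⊢
    exact ⟨⟨h.2, neg_mem_directions h.1.2⟩, by simpa using h.1.1⟩
  · rintro ⟨x, e⟩ h
    simp only [Finset.mem_filter, Finset.mem_product] at h ⊢
    exact ⟨⟨h.2, neg_mem_directions h.1.2⟩, by simpa using h.1.1⟩
  · rintro ⟨x, e⟩ _; simp
  · rintro ⟨x, e⟩ _; simp
  · rintro ⟨x, e⟩ _; simp

/-- Minimum principle. At a negative minimum all four neighbours are minimizers too, so the
rightmost minimizer would have a minimizer to its right. -/
lemma nonneg_of_superharmonic (S : Finset (ℤ × ℤ)) (g : ℤ × ℤ → ℝ) (h0 : ∀ x ∉ S, 0 ≤ g x)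
    (hs : ∀ x ∈ S, ∑ e ∈ directions, g (x + e) ≤ 4 * g x) (x : ℤ × ℤ) : 0 ≤ g x := by
  by_contra hx
  push Not at hx
  have hxS : x ∈ S := by
    by_contra h
    exact absurd (h0 x h) (not_le.mpr hx)
  obtain ⟨y, hyS, hy⟩ := S.exists_min_image g ⟨x, hxS⟩
  have hyneg : g y < 0 := (hy x hxS).trans_lt hx
  obtain ⟨p, hp, hpmax⟩ := (S.filter (fun z => g z = g y)).exists_max_image Prod.fst
    ⟨y, by simp [hyS]⟩
  rw [Finset.mem_filter] at hp
  have hge : ∀ z, g y ≤ g z := fun z => by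
    by_cases hz : z ∈ S
    · exact hy z hz
    · exact hyneg.le.trans (h0 z hz)
  have hsp := hs p hp.1
  rw [sum_directions] at hsp
  have e2 := hge (p + (-1, 0))
  have e3 := hge (p + (0, 1))
  have e4 := hge (p + (0, -1))
  have e1 : g (p + (1, 0)) = g y := le_antisymm (by linarith [hp.2]) (hge _)
  have hmem : p + (1, 0) ∈ S := by
    by_contra h
    exact absurd (h0 _ h) (by rw [e1]; exact not_le.mpr hyneg)
  have := hpmax (p + (1, 0)) (by simp [hmem, e1])
  simp at this

/-- The Dirichlet problem on `S` is a square linear system, injective by the minimum principle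
applied to `v` and `-v`. -/
lemma exists_poisson_solution (S : Finset (ℤ × ℤ)) (f : ℤ × ℤ → ℝ) :
    ∃ g : ℤ × ℤ → ℝ, (∀ x ∉ S, g x = 0) ∧
      ∀ x ∈ S, ∑ e ∈ directions, g (x + e) = 4 * g x - f x := by
  classical
  let ext : (S → ℝ) → ℤ × ℤ → ℝ := fun v p => if h : p ∈ S then v ⟨p, h⟩ else 0
  have ext_add : ∀ v w p, ext (v + w) p = ext v p + ext w p := by
    intro v w p; simp only [ext]; split_ifs <;> simp
  have ext_smul : ∀ (c : ℝ) v p, ext (c • v) p = c * ext v p := by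
    intro c v p; simp only [ext]; split_ifs <;> simp
  let L : (S → ℝ) →ₗ[ℝ] (S → ℝ) :=
    { toFun := fun v x => 4 * v x - ∑ e ∈ directions, ext v (x + e)
      map_add' := by
        intro v w; funext x
        simp only [ext_add, Finset.sum_add_distrib, Pi.add_apply]; ring
      map_smul' := by
        intro c v; funext x
        simp only [ext_smul, ← Finset.mul_sum, Pi.smul_apply, smul_eq_mul, RingHom.id_apply]
        ring }
  have hker : ∀ v : S → ℝ, L v = 0 → ∀ x, 0 ≤ ext v x := by
    intro v hv
    refine nonneg_of_superharmonic S _ (fun x hx => by simp [ext, hx]) fun x hx => ?_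
    have := congrFun hv ⟨x, hx⟩
    simp only [L, LinearMap.coe_mk, AddHom.coe_mk, Pi.zero_apply] at this
    have hx' : ext v x = v ⟨x, hx⟩ := by simp [ext, hx]
    rw [hx']; linarith
  have hinj : Function.Injective L := by
    rw [injective_iff_map_eq_zero]
    intro v hv
    funext x
    have h1 := hker v hv x
    have h2 := hker (-v) (by rw [map_neg, hv, neg_zero]) x
    simp only [ext, x.2, dif_pos, Subtype.coe_eta, Pi.neg_apply] at h1 h2
    simp only [Pi.zero_apply]
    linarith
  obtain ⟨v, hv⟩ := (LinearMap.injective_iff_surjective.mp hinj) (fun x => f x)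
  refine ⟨ext v, fun x hx => by simp [ext, hx], fun x hx => ?_⟩
  have := congrFun hv ⟨x, hx⟩
  simp only [L, LinearMap.coe_mk, AddHom.coe_mk] at this
  have hx' : ext v x = v ⟨x, hx⟩ := by simp [ext, hx]
  rw [hx']; linarith

lemma sum_directions_ge_of_le {g : ℤ × ℤ → ℝ} {m : ℝ} (hm : ∀ x, g x ≤ m) (x : ℤ × ℤ)
    {d : ℤ × ℤ} (hd : d ∈ directions) : ∑ e ∈ directions, g (x + e) ≤ g (x + d) + 3 * m := by
  rw [sum_directions]
  simp only [directions, Finset.mem_insert, Finset.mem_singleton] at hd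
  have h1 := hm (x + (1, 0))
  have h2 := hm (x + (-1, 0))
  have h3 := hm (x + (0, 1))
  have h4 := hm (x + (0, -1))
  rcases hd with rfl | rfl | rfl | rfl <;> linarith

/-- If every point of `T ∩ S` sees the complement of `S` within three steps, then a simple random
walk visits `T` a bounded number of times before it leaves `S`. -/
lemma exists_bounded_potential (S T : Finset (ℤ × ℤ))
    (hT : ∀ x ∈ T, ∃ d ∈ directions, x + d + d + d ∉ S) :
    ∃ g : ℤ × ℤ → ℝ, (∀ x ∉ S, g x = 0) ∧ (∀ x, 0 ≤ g x) ∧ (∀ x, g x ≤ 21) ∧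
      ∀ x ∈ S, ∑ e ∈ directions, g (x + e) = 4 * g x - if x ∈ T then 1 else 0 := by
  obtain ⟨g, g0, hg⟩ := exists_poisson_solution S (fun x => if x ∈ T then 1 else 0)
  have gnn : ∀ x, 0 ≤ g x := nonneg_of_superharmonic S g (fun x hx => (g0 x hx).ge) fun x hx => by
    rw [hg x hx]; split_ifs <;> linarith
  refine ⟨g, g0, gnn, ?_, hg⟩
  by_contra hcon
  push Not at hcon
  obtain ⟨x, hx⟩ := hcon
  have hxS : x ∈ S := by
    by_contra h
    rw [g0 x h] at hx; linarith
  obtain ⟨y, hyS, hy⟩ := S.exists_max_image g ⟨x, hxS⟩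
  have hypos : 21 < g y := hx.trans_le (hy x hxS)
  obtain ⟨p, hp, hpmax⟩ := (S.filter (fun z => g z = g y)).exists_max_image Prod.fst
    ⟨y, by simp [hyS]⟩
  rw [Finset.mem_filter] at hp
  have hle : ∀ z, g z ≤ g y := fun z => by
    by_cases hz : z ∈ S
    · exact hy z hz
    · rw [g0 z hz]; linarith
  -- Off `T` the potential is harmonic, so a rightmost maximizer must lie in `T`.
  have hpT : p ∈ T := by
    by_contra hpT
    have h1 := hg p hp.1
    rw [if_neg hpT] at h1
    have h2 := sum_directions_ge_of_le hle p (d := (1, 0)) (by decide)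
    have e1 : g (p + (1, 0)) = g y := le_antisymm (hle _) (by linarith [hp.2])
    have hmem : p + (1, 0) ∈ S := by
      by_contra h
      rw [g0 _ h] at e1; linarith
    have := hpmax (p + (1, 0)) (by simp [hmem, e1])
    simp at this
  obtain ⟨d, hd, hdS⟩ := hT p hpT
  -- With `μ` the maximum, the walk in direction `d` finds values at least `μ - 1`, `μ - 5`, `μ -
  -- 21`. The third point is outside `S`, where `g = 0`; hence `μ ≤ 21 = 1 + 4 + 16`.
  have step : ∀ z ∈ S, 4 * g z - 1 - 3 * g y ≤ g (z + d) := fun z hz => by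
    have h1 := hg z hz
    have h2 := sum_directions_ge_of_le hle z hd
    have h3 : (if z ∈ T then (1 : ℝ) else 0) ≤ 1 := by split_ifs <;> norm_num
    linarith
  have s1 := step p hp.1
  rw [hp.2] at s1
  have m1 : p + d ∈ S := by
    by_contra h
    rw [g0 _ h] at s1; linarith
  have s2 := step _ m1
  have m2 : p + d + d ∈ S := by
    by_contra h
    rw [g0 _ h] at s2; linarith
  have s3 := step _ m2
  rw [g0 _ hdS] at s3
  linarith

/-- Discrete harmonicity at every point of `S`. -/
def DiscreteHarmonicOn (S : Finset (ℤ × ℤ)) (U : ℤ × ℤ → ℝ) : Prop :=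
  ∀ x ∈ S, ∑ e ∈ directions, U (x + e) = 4 * U x

lemma sum_boundary_split (S : Finset (ℤ × ℤ)) (f : ℤ × ℤ → ℤ × ℤ → ℝ) :
    ∑ x ∈ S, ∑ e ∈ directions, f x e =
      ∑ x ∈ S, ∑ e ∈ directions, (if x + e ∈ S then f x e else 0) +
      ∑ x ∈ S, ∑ e ∈ directions, (if x + e ∈ S then 0 else f x e) := by
  simp only [← Finset.sum_add_distrib]
  refine Finset.sum_congr rfl fun x _ => Finset.sum_congr rfl fun e _ => ?_
  split_ifs <;> simp

/-- The values of a discrete harmonic function at points close to the boundary are controlled,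
in `ℓ²`, by its boundary values. -/
lemma DiscreteHarmonicOn.sum_sq_le {S T : Finset (ℤ × ℤ)} {U : ℤ × ℤ → ℝ}
    (hU : DiscreteHarmonicOn S U) (hTS : T ⊆ S)
    (hT : ∀ x ∈ T, ∃ d ∈ directions, x + d + d + d ∉ S) :
    ∑ x ∈ T, U x ^ 2 ≤
      21 * ∑ x ∈ S, ∑ e ∈ directions, (if x + e ∈ S then 0 else U (x + e) ^ 2) := by
  obtain ⟨g, g0, gnn, gle, hg⟩ := exists_bounded_potential S T hT
  have h1 : ∀ x ∈ S, ∑ e ∈ directions, (g x * U (x + e) ^ 2 - U x ^ 2 * g (x + e)) ≥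
      U x ^ 2 * if x ∈ T then 1 else 0 := by
    intro x hx
    rw [Finset.sum_sub_distrib, ← Finset.mul_sum, ← Finset.mul_sum, hg x hx]
    -- The square of a harmonic function is subharmonic. Pairing it with the superharmonic `g`
    -- leaves, after cancellation on interior edges, only boundary terms.
    have h2 : 4 * U x ^ 2 ≤ ∑ e ∈ directions, U (x + e) ^ 2 := by
      have h3 : 0 ≤ ∑ e ∈ directions, (U (x + e) - U x) ^ 2 :=
        Finset.sum_nonneg fun _ _ => sq_nonneg _
      have h4 : ∑ e ∈ directions, (U (x + e) - U x) ^ 2 =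
          ∑ e ∈ directions, U (x + e) ^ 2 - 2 * U x * ∑ e ∈ directions, U (x + e)
            + 4 * U x ^ 2 := by
        simp only [sum_directions]; ring
      rw [h4, hU x hx] at h3
      linarith
    have := mul_le_mul_of_nonneg_left h2 (gnn x)
    linarith
  have h2 := Finset.sum_le_sum h1
  rw [sum_boundary_split] at h2
  have h3 := sum_interior_edges_swap S (fun x y => g x * U y ^ 2)
  have h4 : ∑ x ∈ S, ∑ e ∈ directions,
      (if x + e ∈ S then g x * U (x + e) ^ 2 - U x ^ 2 * g (x + e) else 0) = 0 := by
    refine Eq.trans ?_ (sub_eq_zero.mpr h3)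
    rw [← Finset.sum_sub_distrib]
    refine Finset.sum_congr rfl fun x _ => ?_
    rw [← Finset.sum_sub_distrib]
    refine Finset.sum_congr rfl fun e _ => ?_
    split_ifs
    · ring
    · ring
  rw [h4, zero_add] at h2
  have h5 : ∑ x ∈ S, U x ^ 2 * (if x ∈ T then (1 : ℝ) else 0) = ∑ x ∈ T, U x ^ 2 := by
    simp only [mul_ite, mul_one, mul_zero]
    rw [← Finset.sum_filter, Finset.filter_mem_eq_inter, Finset.inter_eq_right.mpr hTS]
  rw [h5] at h2
  refine h2.trans ?_
  rw [Finset.mul_sum]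
  refine Finset.sum_le_sum fun x _ => ?_
  rw [Finset.mul_sum]
  refine Finset.sum_le_sum fun e _ => ?_
  split_ifs with h
  · simp
  · rw [g0 _ h]
    have := mul_le_mul_of_nonneg_right (gle x) (sq_nonneg (U (x + e)))
    linarith

/-- Discrete Green's identity. -/
lemma DiscreteHarmonicOn.energy {S : Finset (ℤ × ℤ)} {U : ℤ × ℤ → ℝ}
    (hU : DiscreteHarmonicOn S U) :
    ∑ x ∈ S, ∑ e ∈ directions, (if x + e ∈ S then (U (x + e) - U x) ^ 2 else 0) =
      2 * ∑ x ∈ S, ∑ e ∈ directions, (if x + e ∈ S then 0 else U x * (U (x + e) - U x)) := by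
  have h1 : ∑ x ∈ S, ∑ e ∈ directions, U x * (U (x + e) - U x) = 0 := by
    refine Finset.sum_eq_zero fun x hx => ?_
    have := hU x hx
    simp only [sum_directions] at this ⊢
    linear_combination U x * this
  rw [sum_boundary_split] at h1
  have h2 := sum_interior_edges_swap S (fun x y => U x * (U y - U x))
  have h3 : ∑ x ∈ S, ∑ e ∈ directions, (if x + e ∈ S then (U (x + e) - U x) ^ 2 else 0) =
      -(∑ x ∈ S, ∑ e ∈ directions, (if x + e ∈ S then U x * (U (x + e) - U x) else 0) +
      ∑ x ∈ S, ∑ e ∈ directions,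
        (if x + e ∈ S then U (x + e) * (U x - U (x + e)) else 0)) := by
    rw [← Finset.sum_add_distrib, ← Finset.sum_neg_distrib]
    refine Finset.sum_congr rfl fun x _ => ?_
    rw [← Finset.sum_add_distrib, ← Finset.sum_neg_distrib]
    refine Finset.sum_congr rfl fun e _ => ?_
    split_ifs
    · ring
    · ring
  rw [h3]
  linarith

/-! ### The lattice Green's function is discrete harmonic away from the origin -/

/-- The Fourier integrand of the lattice Green's function. -/
noncomputable def greenIntegrand (p : ℤ × ℤ) (θ : ℝ × ℝ) : ℝ :=
  (Real.cos (p.1 * θ.1 + p.2 * θ.2) - 1) / (4 - 2 * Real.cos θ.1 - 2 * Real.cos θ.2)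

/-- The period cell of the Fourier variable. -/
def fourierBox : Set (ℝ × ℝ) :=
  Set.Icc (-Real.pi) Real.pi ×ˢ Set.Icc (-Real.pi) Real.pi

lemma green_denominator_ge {θ : ℝ × ℝ} (hθ : θ ∈ fourierBox) :
    4 / Real.pi ^ 2 * (θ.1 ^ 2 + θ.2 ^ 2) ≤ 4 - 2 * Real.cos θ.1 - 2 * Real.cos θ.2 := by
  have h1 := Real.cos_le_one_sub_mul_cos_sq (x := θ.1) (abs_le.mpr hθ.1)
  have h2 := Real.cos_le_one_sub_mul_cos_sq (x := θ.2) (abs_le.mpr hθ.2)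
  have : 4 / Real.pi ^ 2 * (θ.1 ^ 2 + θ.2 ^ 2) =
      2 * (2 / Real.pi ^ 2 * θ.1 ^ 2) + 2 * (2 / Real.pi ^ 2 * θ.2 ^ 2) := by ring
  rw [this]; linarith

/-- Numerator and denominator both vanish to second order at the origin, so the integrand stays
bounded and is integrable. -/
lemma abs_greenIntegrand_le (p : ℤ × ℤ) {θ : ℝ × ℝ} (hθ : θ ∈ fourierBox) :
    ‖greenIntegrand p θ‖ ≤ ((p.1 : ℝ) ^ 2 + (p.2 : ℝ) ^ 2) * Real.pi ^ 2 / 4 := by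
  have hd := green_denominator_ge hθ
  have hpi := Real.pi_pos
  rw [greenIntegrand, norm_div, Real.norm_eq_abs, Real.norm_eq_abs]
  refine div_le_of_le_mul₀ (abs_nonneg _) (by positivity) ?_
  set s := θ.1 ^ 2 + θ.2 ^ 2
  set Q := (p.1 : ℝ) ^ 2 + (p.2 : ℝ) ^ 2
  have hs : 0 ≤ s := by positivity
  have hQ : 0 ≤ Q := by positivity
  have h1 : |Real.cos (p.1 * θ.1 + p.2 * θ.2) - 1| ≤ Q * s := by
    rw [abs_sub_comm, abs_of_nonneg (by linarith [Real.cos_le_one (p.1 * θ.1 + p.2 * θ.2)])]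
    have := Real.one_sub_sq_div_two_le_cos (x := p.1 * θ.1 + p.2 * θ.2)
    nlinarith [sq_nonneg ((p.1 : ℝ) * θ.2 - p.2 * θ.1),
      sq_nonneg ((p.1 : ℝ) * θ.1 + p.2 * θ.2)]
  refine h1.trans ?_
  have h2 : Q * s = Q * Real.pi ^ 2 / 4 * (4 / Real.pi ^ 2 * s) := by field_simp
  rw [h2]
  exact mul_le_mul_of_nonneg_left (hd.trans (le_abs_self _)) (by positivity)

lemma integrableOn_greenIntegrand (p : ℤ × ℤ) : IntegrableOn (greenIntegrand p) fourierBox := by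
  refine Measure.integrableOn_of_bounded (M := ((p.1 : ℝ) ^ 2 + (p.2 : ℝ) ^ 2) * Real.pi ^ 2 / 4)
    ?_ ?_ ?_
  · exact ((isCompact_Icc.prod isCompact_Icc).measure_lt_top).ne
  · refine Measurable.aestronglyMeasurable ?_
    unfold greenIntegrand
    fun_prop
  · exact (ae_restrict_iff' (measurableSet_Icc.prod measurableSet_Icc)).mpr
      (ae_of_all _ fun θ hθ => abs_greenIntegrand_le p hθ)

lemma integral_sin_int (n : ℤ) : ∫ t in Set.Icc (-Real.pi) Real.pi, Real.sin (n * t) = 0 := by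
  rw [integral_Icc_eq_integral_Ioc, ← intervalIntegral.integral_of_le (by linarith [Real.pi_pos])]
  rcases eq_or_ne (n : ℝ) 0 with hn | hn
  · simp [hn]
  · rw [intervalIntegral.integral_comp_mul_left (fun x => Real.sin x) hn, integral_sin]
    simp

lemma integral_cos_int {n : ℤ} (hn : n ≠ 0) :
    ∫ t in Set.Icc (-Real.pi) Real.pi, Real.cos (n * t) = 0 := by
  rw [integral_Icc_eq_integral_Ioc, ← intervalIntegral.integral_of_le (by linarith [Real.pi_pos])]
  have hn' : (n : ℝ) ≠ 0 := by exact_mod_cast hn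
  rw [intervalIntegral.integral_comp_mul_left (fun x => Real.cos x) hn', integral_cos]
  have : (n : ℝ) * -Real.pi = -(n * Real.pi) := by ring
  rw [this, Real.sin_neg, Real.sin_int_mul_pi]
  simp

lemma integral_cos_lattice {p : ℤ × ℤ} (hp : p ≠ 0) :
    ∫ θ in fourierBox, Real.cos (p.1 * θ.1 + p.2 * θ.2) = 0 := by
  have hI : ∀ f : ℝ × ℝ → ℝ, Continuous f → IntegrableOn f fourierBox := fun f hf =>
    hf.continuousOn.integrableOn_compact (isCompact_Icc.prod isCompact_Icc)
  simp only [Real.cos_add]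
  rw [integral_sub (hI _ (by fun_prop)) (hI _ (by fun_prop)), fourierBox, Measure.volume_eq_prod,
    setIntegral_prod_mul (fun t => Real.cos (p.1 * t)) (fun t => Real.cos (p.2 * t)),
    setIntegral_prod_mul (fun t => Real.sin (p.1 * t)) (fun t => Real.sin (p.2 * t)),
    integral_sin_int, zero_mul, sub_zero]
  by_cases h1 : p.1 = 0
  · have h2 : p.2 ≠ 0 := fun h2 => hp (Prod.ext h1 h2)
    rw [integral_cos_int h2, mul_zero]
  · rw [integral_cos_int h1, zero_mul]

/-- The denominator is the Fourier symbol of the negative five-point Laplacian and cancels against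
it; what remains integrates to zero unless `p = 0`. -/
lemma sum_greenIntegrand (p : ℤ × ℤ) {θ : ℝ × ℝ} (hθ : θ ∈ fourierBox) (h0 : θ ≠ 0) :
    ∑ e ∈ directions, greenIntegrand (p + e) θ - 4 * greenIntegrand p θ =
      -Real.cos (p.1 * θ.1 + p.2 * θ.2) := by
  have hd := green_denominator_ge hθ
  have hs : 0 < θ.1 ^ 2 + θ.2 ^ 2 := by
    by_contra h
    have h1 : θ.1 = 0 := by nlinarith [sq_nonneg θ.1, sq_nonneg θ.2]
    have h2 : θ.2 = 0 := by nlinarith [sq_nonneg θ.1, sq_nonneg θ.2]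
    exact h0 (Prod.ext h1 h2)
  have hpos : 4 - 2 * Real.cos θ.1 - 2 * Real.cos θ.2 ≠ 0 := by
    have : 0 < 4 / Real.pi ^ 2 * (θ.1 ^ 2 + θ.2 ^ 2) := by positivity
    linarith
  rw [sum_directions]
  simp only [greenIntegrand, Prod.fst_add, Prod.snd_add]
  push_cast
  have e1 : (p.1 + 1) * θ.1 + (p.2 + 0) * θ.2 = (p.1 * θ.1 + p.2 * θ.2) + θ.1 := by ring
  have e2 : (p.1 + -1) * θ.1 + (p.2 + 0) * θ.2 = (p.1 * θ.1 + p.2 * θ.2) - θ.1 := by ring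
  have e3 : (p.1 + 0) * θ.1 + (p.2 + 1) * θ.2 = (p.1 * θ.1 + p.2 * θ.2) + θ.2 := by ring
  have e4 : (p.1 + 0) * θ.1 + (p.2 + -1) * θ.2 = (p.1 * θ.1 + p.2 * θ.2) - θ.2 := by ring
  rw [e1, e2, e3, e4]
  generalize p.1 * θ.1 + p.2 * θ.2 = a
  rw [Real.cos_add a, Real.cos_sub a, Real.cos_add a, Real.cos_sub a, ← add_div, ← add_div,
    ← add_div, mul_div_assoc', ← sub_div, div_eq_iff hpos]
  ring

lemma sum_integral_greenIntegrand {p : ℤ × ℤ} (hp : p ≠ 0) :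
    ∑ e ∈ directions, ∫ θ in fourierBox, greenIntegrand (p + e) θ =
      4 * ∫ θ in fourierBox, greenIntegrand p θ := by
  -- At `θ = 0` the quotient takes the default value `0` and the cancellation fails, but a single
  -- point is negligible.
  have hae : ∀ᵐ θ : ℝ × ℝ, θ ≠ 0 := by
    rw [ae_iff]
    simp
  have h1 : ∫ θ in fourierBox, (∑ e ∈ directions, greenIntegrand (p + e) θ -
      4 * greenIntegrand p θ) = ∫ θ in fourierBox, -Real.cos (p.1 * θ.1 + p.2 * θ.2) :=
    setIntegral_congr_ae (measurableSet_Icc.prod measurableSet_Icc)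
      (hae.mono fun θ h0 hθ => sum_greenIntegrand p hθ h0)
  have h2 : ∫ θ in fourierBox, ∑ e ∈ directions, greenIntegrand (p + e) θ =
      ∑ e ∈ directions, ∫ θ in fourierBox, greenIntegrand (p + e) θ :=
    integral_finsetSum _ fun e _ => integrableOn_greenIntegrand (p + e)
  have h3 : IntegrableOn (fun θ => ∑ e ∈ directions, greenIntegrand (p + e) θ) fourierBox :=
    integrable_finsetSum _ fun e _ => integrableOn_greenIntegrand (p + e)
  rw [integral_sub h3 ((integrableOn_greenIntegrand p).const_mul 4), integral_const_mul,
    integral_neg, integral_cos_lattice hp, neg_zero, h2] at h1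
  linarith

lemma sum_latticeGreen (h κ : ℝ) {p : ℤ × ℤ} (hp : p ≠ 0) :
    ∑ e ∈ directions, latticeGreen h κ (p + e) = 4 * latticeGreen h κ p := by
  have key := sum_integral_greenIntegrand hp
  have hG : ∀ q, latticeGreen h κ q = h ^ 2 * (κ + ((2 * Real.pi) ^ 2)⁻¹ *
    ∫ θ in fourierBox, greenIntegrand q θ) := fun q => rfl
  simp only [hG]
  rw [sum_directions] at key ⊢
  linear_combination h ^ 2 * ((2 * Real.pi) ^ 2)⁻¹ * key

/-! ### Discrete harmonicity of the layer potentials -/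

namespace CutMesh

variable {Γ : LevelSetCurve} (M : CutMesh Γ)

open Classical in
/-- The layer potentials are discrete harmonic at every target which is neither the source nor an
inactive lattice neighbour of the source. -/
lemma sum_layerKernel (κ : ℝ) (l : LayerKind) {x y : ℤ × ℤ} (hxy : x ≠ y)
    (hz : ∀ z ∈ neighbors y, z ∉ M.activeVertices → x ≠ z) :
    ∑ e ∈ directions, M.layerKernel κ l (x + e) y = 4 * M.layerKernel κ l x y := by
  have h1 : ∑ e ∈ directions, latticeGreen M.h κ (x + e - y) = 4 * latticeGreen M.h κ (x - y) := by
    rw [← sum_latticeGreen M.h κ (sub_ne_zero.mpr hxy)]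
    exact Finset.sum_congr rfl fun e _ => by rw [sub_add_eq_add_sub]
  cases l with
  | single => exact h1
  | double =>
    simp only [layerKernel]
    rw [Finset.sum_comm, Finset.mul_sum]
    refine Finset.sum_congr rfl fun z hzm => ?_
    rw [Finset.mem_filter] at hzm
    have h2 : ∑ e ∈ directions, latticeGreen M.h κ (x + e - z) =
        4 * latticeGreen M.h κ (x - z) := by
      rw [← sum_latticeGreen M.h κ (sub_ne_zero.mpr (hz z hzm.1 hzm.2))]
      exact Finset.sum_congr rfl fun e _ => by rw [sub_add_eq_add_sub]
    rw [Finset.sum_sub_distrib, h1, h2]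
    ring

end CutMesh

/-! ### Cells and edges in coordinates -/

lemma mem_edgeH {h : ℝ} (hh : 0 < h) {p : ℤ × ℤ} {x : Plane} :
    x ∈ edgeH h p ↔ (h * p.1 ≤ x 0 ∧ x 0 ≤ h * (p.1 + 1)) ∧ x 1 = h * p.2 := by
  rw [edgeH, segment_eq_image']
  constructor
  · rintro ⟨t, ⟨h0, h1⟩, rfl⟩
    simp only [vertex, PiLp.add_apply, PiLp.smul_apply, PiLp.sub_apply, Prod.fst_add,
      Prod.snd_add, smul_eq_mul, Matrix.cons_val_zero, Matrix.cons_val_one]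
    push_cast
    refine ⟨⟨by nlinarith [mul_nonneg hh.le h0], by nlinarith [mul_le_mul_of_nonneg_left h1 hh.le]⟩,
      by simp⟩
  · rintro ⟨⟨h0, h1⟩, h2⟩
    refine ⟨x 0 / h - p.1, ⟨?_, ?_⟩, ?_⟩
    · rw [sub_nonneg, le_div_iff₀ hh]; linarith
    · rw [sub_le_iff_le_add, div_le_iff₀ hh]; linarith
    · ext i
      fin_cases i
      · simp [vertex]
        field_simp
        ring
      · simp [vertex, h2]

lemma mem_edgeV {h : ℝ} (hh : 0 < h) {p : ℤ × ℤ} {x : Plane} :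
    x ∈ edgeV h p ↔ x 0 = h * p.1 ∧ h * p.2 ≤ x 1 ∧ x 1 ≤ h * (p.2 + 1) := by
  rw [edgeV, segment_eq_image']
  constructor
  · rintro ⟨t, ⟨h0, h1⟩, rfl⟩
    simp only [vertex, PiLp.add_apply, PiLp.smul_apply, PiLp.sub_apply, Prod.fst_add,
      Prod.snd_add, smul_eq_mul, Matrix.cons_val_zero, Matrix.cons_val_one]
    push_cast
    refine ⟨by simp, by nlinarith [mul_nonneg hh.le h0],
      by nlinarith [mul_le_mul_of_nonneg_left h1 hh.le]⟩
  · rintro ⟨h2, h0, h1⟩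
    refine ⟨x 1 / h - p.2, ⟨?_, ?_⟩, ?_⟩
    · rw [sub_nonneg, le_div_iff₀ hh]; linarith
    · rw [sub_le_iff_le_add, div_le_iff₀ hh]; linarith
    · ext i
      fin_cases i
      · simp [vertex, h2]
      · simp [vertex]
        field_simp
        ring

lemma mem_cellBoundary {h : ℝ} (hh : 0 < h) {k : ℤ × ℤ} {x : Plane} :
    x ∈ cellBoundary h k ↔ x ∈ cell h k ∧
      (x 0 = h * k.1 ∨ x 0 = h * (k.1 + 1) ∨ x 1 = h * k.2 ∨ x 1 = h * (k.2 + 1)) := by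
  simp only [cellBoundary, Set.mem_union, mem_edgeH hh, mem_edgeV hh, cell, Set.mem_ofPred_eq,
    Prod.fst_add, Prod.snd_add]
  push_cast
  simp only [add_zero]
  constructor
  · rintro (((h1 | h1) | h1) | h1) <;>
      refine ⟨⟨⟨?_, ?_⟩, ?_, ?_⟩, ?_⟩ <;> first | tauto | nlinarith [h1.1, h1.2]
  · tauto

lemma isClosed_cell (h : ℝ) (k : ℤ × ℤ) : IsClosed (cell h k) := by
  have h0 : Continuous fun x : Plane => x 0 := by fun_prop
  have h1 : Continuous fun x : Plane => x 1 := by fun_prop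
  exact ((isClosed_le continuous_const h0).inter (isClosed_le h0 continuous_const)).inter
    ((isClosed_le continuous_const h1).inter (isClosed_le h1 continuous_const))

lemma convex_cell (h : ℝ) (k : ℤ × ℤ) : Convex ℝ (cell h k) := by
  rintro x ⟨⟨h1, h2⟩, h3, h4⟩ y ⟨⟨h5, h6⟩, h7, h8⟩ a b ha hb hab
  have e : ∀ c : ℝ, c = a * c + b * c := fun c => by rw [← add_mul, hab, one_mul]
  refine ⟨⟨?_, ?_⟩, ?_, ?_⟩ <;>
    simp only [PiLp.add_apply, PiLp.smul_apply, smul_eq_mul] <;>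
    [rw [e (h * k.1)]; rw [e (h * (k.1 + 1))]; rw [e (h * k.2)]; rw [e (h * (k.2 + 1))]] <;>
    gcongr

lemma exists_mem_cell {h : ℝ} (hh : 0 < h) (x : Plane) : ∃ k, x ∈ cell h k := by
  refine ⟨(⌊x 0 / h⌋, ⌊x 1 / h⌋), ?_⟩
  have key : ∀ t : ℝ, h * (⌊t / h⌋ : ℤ) ≤ t ∧ t ≤ h * ((⌊t / h⌋ : ℤ) + 1) := fun t => by
    have h1 := Int.floor_le (t / h)
    have h2 := (Int.lt_floor_add_one (t / h)).le
    rw [le_div_iff₀ hh] at h1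
    rw [div_le_iff₀ hh] at h2
    exact ⟨by linarith, by linarith⟩
  exact ⟨key _, key _⟩

/-- Distinct mesh cells only share boundary points. -/
lemma mem_cellBoundary_of_mem_two_cells {h : ℝ} (hh : 0 < h) {k k' : ℤ × ℤ} (hk : k ≠ k')
    {x : Plane} (hx : x ∈ cell h k) (hx' : x ∈ cell h k') : x ∈ cellBoundary h k := by
  rw [mem_cellBoundary hh]
  refine ⟨hx, ?_⟩
  have key : ∀ (t : ℝ) (a b : ℤ), h * a ≤ t → t ≤ h * (a + 1) → h * b ≤ t → t ≤ h * (b + 1) →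
      a ≠ b → t = h * a ∨ t = h * (a + 1) := by
    intro t a b h1 h2 h3 h4 hab
    rcases lt_or_gt_of_ne hab with hlt | hlt
    · have : (a : ℝ) + 1 ≤ b := by exact_mod_cast hlt
      have := mul_le_mul_of_nonneg_left this hh.le
      right; linarith
    · have : (b : ℝ) + 1 ≤ a := by exact_mod_cast hlt
      have := mul_le_mul_of_nonneg_left this hh.le
      left; linarith
  by_cases h0 : k.1 = k'.1
  · have h1 : k.2 ≠ k'.2 := fun h1 => hk (Prod.ext h0 h1)
    have := key _ _ _ hx.2.1 hx.2.2 hx'.2.1 hx'.2.2 h1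
    tauto
  · have := key _ _ _ hx.1.1 hx.1.2 hx'.1.1 hx'.1.2 h0
    tauto

/-! ### Lattice frames -/

/-- An orthogonal pair of lattice directions. -/
def IsFrame (e d : ℤ × ℤ) : Prop :=
  e ∈ directions ∧ d ∈ directions ∧ e.1 * d.1 + e.2 * d.2 = 0

lemma IsFrame.cases {e d : ℤ × ℤ} (h : IsFrame e d) :
    ((e = (1, 0) ∨ e = (-1, 0)) ∧ (d = (0, 1) ∨ d = (0, -1))) ∨
      ((e = (0, 1) ∨ e = (0, -1)) ∧ (d = (1, 0) ∨ d = (-1, 0))) := by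
  obtain ⟨he, hd, ho⟩ := h
  simp only [directions, Finset.mem_insert, Finset.mem_singleton] at he hd
  rcases he with rfl | rfl | rfl | rfl <;> rcases hd with rfl | rfl | rfl | rfl <;> simp_all

lemma IsFrame.neg_left {e d : ℤ × ℤ} (h : IsFrame e d) : IsFrame (-e) d :=
  ⟨neg_mem_directions h.1, h.2.1, by simpa using by linarith [h.2.2]⟩

lemma IsFrame.sum_eq {e d : ℤ × ℤ} (h : IsFrame e d) (f : ℤ × ℤ → ℝ) :
    ∑ a ∈ directions, f a = f e + f (-e) + f d + f (-d) := by
  rw [sum_directions]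
  rcases h.cases with ⟨rfl | rfl, rfl | rfl⟩ | ⟨rfl | rfl, rfl | rfl⟩ <;> simp <;> ring

lemma IsFrame.mem_directions_iff {e d : ℤ × ℤ} (h : IsFrame e d) (a : ℤ × ℤ) :
    a ∈ directions ↔ a = e ∨ a = -e ∨ a = d ∨ a = -d := by
  simp only [directions, Finset.mem_insert, Finset.mem_singleton]
  rcases h.cases with ⟨rfl | rfl, rfl | rfl⟩ | ⟨rfl | rfl, rfl | rfl⟩ <;> simp <;> tauto

/-- The point with lattice coordinates `(x, y)` in the frame `(q; e, d)`. -/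
def framePt (h : ℝ) (q e d : ℤ × ℤ) (x y : ℝ) : Plane :=
  !₂[h * (q.1 + x * e.1 + y * d.1), h * (q.2 + x * e.2 + y * d.2)]

lemma framePt_zero_apply (h : ℝ) (q e d : ℤ × ℤ) (x y : ℝ) :
    framePt h q e d x y 0 = h * (q.1 + x * e.1 + y * d.1) := rfl

lemma framePt_one_apply (h : ℝ) (q e d : ℤ × ℤ) (x y : ℝ) :
    framePt h q e d x y 1 = h * (q.2 + x * e.2 + y * d.2) := rfl

lemma framePt_int (h : ℝ) (q e d : ℤ × ℤ) (a b : ℤ) :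
    framePt h q e d a b = vertex h (q + a • e + b • d) := by
  ext i
  fin_cases i <;> simp [framePt, vertex]

lemma framePt_shift (h : ℝ) (q e d : ℤ × ℤ) (a b : ℤ) (x y : ℝ) :
    framePt h (q + a • e + b • d) e d x y = framePt h q e d (x + a) (y + b) := by
  ext i
  fin_cases i <;> simp [framePt] <;> ring_nf <;> simp

lemma framePt_neg_left (h : ℝ) (q e d : ℤ × ℤ) (x y : ℝ) :
    framePt h q (-e) d x y = framePt h q e d (-x) y := by
  ext i
  fin_cases i <;> simp [framePt]

lemma IsFrame.exists_framePt {e d : ℤ × ℤ} (hf : IsFrame e d) {h : ℝ} (hh : 0 < h) (q : ℤ × ℤ)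
    (z : Plane) : ∃ x y, z = framePt h q e d x y := by
  refine ⟨(z 0 / h - q.1) * e.1 + (z 1 / h - q.2) * e.2,
    (z 0 / h - q.1) * d.1 + (z 1 / h - q.2) * d.2, ?_⟩
  ext i
  rcases hf.cases with ⟨rfl | rfl, rfl | rfl⟩ | ⟨rfl | rfl, rfl | rfl⟩ <;> fin_cases i <;>
    simp [framePt] <;> field_simp

lemma IsFrame.fst_framePt {e d : ℤ × ℤ} (hf : IsFrame e d) {h : ℝ} (hh : 0 < h) (q : ℤ × ℤ)
    (x y : ℝ) : (framePt h q e d x y 0 / h - q.1) * e.1 +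
      (framePt h q e d x y 1 / h - q.2) * e.2 = x := by
  simp only [framePt_zero_apply, framePt_one_apply, mul_div_cancel_left₀ _ hh.ne']
  rcases hf.cases with ⟨rfl | rfl, rfl | rfl⟩ | ⟨rfl | rfl, rfl | rfl⟩ <;> simp

lemma IsFrame.snd_framePt {e d : ℤ × ℤ} (hf : IsFrame e d) {h : ℝ} (hh : 0 < h) (q : ℤ × ℤ)
    (x y : ℝ) : (framePt h q e d x y 0 / h - q.1) * d.1 +
      (framePt h q e d x y 1 / h - q.2) * d.2 = y := by
  simp only [framePt_zero_apply, framePt_one_apply, mul_div_cancel_left₀ _ hh.ne']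
  rcases hf.cases with ⟨rfl | rfl, rfl | rfl⟩ | ⟨rfl | rfl, rfl | rfl⟩ <;> simp

lemma IsFrame.framePt_inj {e d : ℤ × ℤ} (hf : IsFrame e d) {h : ℝ} (hh : 0 < h) {q : ℤ × ℤ}
    {x y x' y' : ℝ} (heq : framePt h q e d x y = framePt h q e d x' y') : x = x' ∧ y = y' := by
  constructor
  · rw [← hf.fst_framePt hh q x y, heq, hf.fst_framePt hh]
  · rw [← hf.snd_framePt hh q x y, heq, hf.snd_framePt hh]

lemma framePt_lineMap (h : ℝ) (q e d : ℤ × ℤ) (x y x' y' t : ℝ) :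
    framePt h q e d x y + t • (framePt h q e d x' y' - framePt h q e d x y) =
      framePt h q e d (x + t * (x' - x)) (y + t * (y' - y)) := by
  ext i
  fin_cases i <;> simp [framePt] <;> ring

/-- The index of the mesh cell spanned by `q`, `q + e` and `q + d`. -/
def frameCell (q e d : ℤ × ℤ) : ℤ × ℤ :=
  (q.1 + min 0 (e.1 + d.1), q.2 + min 0 (e.2 + d.2))

lemma exists_frameCell (e d k : ℤ × ℤ) :
    ∃ q, frameCell q e d = k :=
  ⟨(k.1 - min 0 (e.1 + d.1), k.2 - min 0 (e.2 + d.2)), by simp [frameCell]⟩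

lemma IsFrame.framePt_mem_cell {e d : ℤ × ℤ} (hf : IsFrame e d) {h : ℝ} (hh : 0 < h) (q : ℤ × ℤ)
    (x y : ℝ) : framePt h q e d x y ∈ cell h (frameCell q e d) ↔
      (0 ≤ x ∧ x ≤ 1) ∧ (0 ≤ y ∧ y ≤ 1) := by
  simp only [cell, Set.mem_ofPred_eq, framePt_zero_apply, framePt_one_apply,
    mul_le_mul_iff_right₀ hh]
  rcases hf.cases with ⟨rfl | rfl, rfl | rfl⟩ | ⟨rfl | rfl, rfl | rfl⟩ <;>
    constructor <;> rintro ⟨⟨h1, h2⟩, h3, h4⟩ <;>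
    refine ⟨⟨?_, ?_⟩, ?_, ?_⟩ <;> (try simp [frameCell] at h1) <;> (try simp [frameCell] at h2) <;>
    (try simp [frameCell] at h3) <;> (try simp [frameCell] at h4) <;> (try simp [frameCell]) <;>
    linarith

/-- The open mesh cell. -/
def openCell (h : ℝ) (k : ℤ × ℤ) : Set Plane :=
  {x | (h * k.1 < x 0 ∧ x 0 < h * (k.1 + 1)) ∧ (h * k.2 < x 1 ∧ x 1 < h * (k.2 + 1))}

lemma IsFrame.framePt_mem_openCell {e d : ℤ × ℤ} (hf : IsFrame e d) {h : ℝ} (hh : 0 < h)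
    {q : ℤ × ℤ} {x y : ℝ} (hx : 0 < x ∧ x < 1) (hy : 0 < y ∧ y < 1) :
    framePt h q e d x y ∈ openCell h (frameCell q e d) := by
  obtain ⟨h1, h2⟩ := hx
  obtain ⟨h3, h4⟩ := hy
  simp only [openCell, Set.mem_ofPred_eq, framePt_zero_apply, framePt_one_apply,
    mul_lt_mul_iff_right₀ hh]
  rcases hf.cases with ⟨rfl | rfl, rfl | rfl⟩ | ⟨rfl | rfl, rfl | rfl⟩ <;>
    refine ⟨⟨?_, ?_⟩, ?_, ?_⟩ <;> (try simp [frameCell]) <;> linarith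

lemma IsFrame.framePt_mem_cellBoundary {e d : ℤ × ℤ} (hf : IsFrame e d) {h : ℝ} (hh : 0 < h)
    (q : ℤ × ℤ) (x y : ℝ) : framePt h q e d x y ∈ cellBoundary h (frameCell q e d) ↔
      ((0 ≤ x ∧ x ≤ 1) ∧ (0 ≤ y ∧ y ≤ 1)) ∧ (x = 0 ∨ x = 1 ∨ y = 0 ∨ y = 1) := by
  rw [mem_cellBoundary hh, hf.framePt_mem_cell hh]
  refine and_congr_right fun _ => ?_
  simp only [framePt_zero_apply, framePt_one_apply, mul_right_inj' hh.ne']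
  rcases hf.cases with ⟨rfl | rfl, rfl | rfl⟩ | ⟨rfl | rfl, rfl | rfl⟩ <;>
    simp [frameCell] <;> constructor <;> rintro (h1 | h1 | h1 | h1) <;>
    first
    | (left; linarith)
    | (right; left; linarith)
    | (right; right; left; linarith)
    | (right; right; right; linarith)

lemma IsFrame.corners_frameCell {e d : ℤ × ℤ} (hf : IsFrame e d) (q : ℤ × ℤ) :
    corners (frameCell q e d) = {q, q + e, q + d, q + e + d} := by
  obtain ⟨a, b⟩ := q
  ext ⟨x, y⟩
  simp only [corners, Finset.mem_insert, Finset.mem_singleton]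
  rcases hf.cases with ⟨rfl | rfl, rfl | rfl⟩ | ⟨rfl | rfl, rfl | rfl⟩ <;>
    simp [frameCell, Prod.ext_iff] <;> omega

/-! ### The level-set function is almost affine at the scale of the mesh -/

namespace LevelSetCurve

variable (Γ : LevelSetCurve)

lemma isCompact_zeroSet : IsCompact {x | Γ.ψ x = 0} := by
  rw [← Γ.frontier_interior]
  exact Metric.isCompact_of_isClosed_isBounded isClosed_frontier
    (Γ.isBounded_interior.closure.subset frontier_subset_closure)

/-- The gradient is uniformly continuous on a compact tube around the curve and bounded below there.
The mean value inequality on balls then gives a relative error `ε`, with one radius for all points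
of the curve. -/
lemma exists_affine_approx {ε : ℝ} (hε : 0 < ε) : ∃ ρ > 0, ∀ z, Γ.ψ z = 0 → ∃ N : Plane,
    N ≠ 0 ∧ ∀ x ∈ Metric.ball z ρ, ∀ y ∈ Metric.ball z ρ,
      |Γ.ψ x - Γ.ψ y - inner ℝ N (x - y)| ≤ ε * ‖N‖ * ‖x - y‖ := by
  obtain ⟨r, hr, hC, m, hm, hgrad⟩ := Γ.regular
  set Z := {x | Γ.ψ x = 0} with hZ
  set T := Metric.thickening r Z with hT
  have hTo : IsOpen T := Metric.isOpen_thickening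
  have hK : IsCompact (Metric.cthickening (r / 2) Z) := Γ.isCompact_zeroSet.cthickening
  have hKT : Metric.cthickening (r / 2) Z ⊆ T :=
    Metric.cthickening_subset_thickening' hr (by linarith) _
  have hcont : ContinuousOn (fderiv ℝ Γ.ψ) T := hC.continuousOn_fderiv_of_isOpen hTo (by norm_num)
  have hunif := hK.uniformContinuousOn_of_continuous (hcont.mono hKT)
  rw [Metric.uniformContinuousOn_iff] at hunif
  obtain ⟨δ, hδ, hδ'⟩ := hunif (ε * m) (by positivity)
  refine ⟨min δ (r / 2), by positivity, fun z hz => ?_⟩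
  have hzT : ∀ x ∈ Metric.ball z (min δ (r / 2)), x ∈ Metric.cthickening (r / 2) Z := fun x hx =>
    Metric.mem_cthickening_of_dist_le x z _ _ hz
      ((Metric.mem_ball.mp hx).le.trans (min_le_right _ _))
  have hz0 : z ∈ Metric.ball z (min δ (r / 2)) := Metric.mem_ball_self (by positivity)
  have hmz := hgrad z (hKT (hzT z hz0))
  refine ⟨gradient Γ.ψ z, fun h0 => ?_, fun x hx y hy => ?_⟩
  · rw [h0, norm_zero] at hmz; linarith
  have hmvt := (convex_ball z (min δ (r / 2))).norm_image_sub_le_of_norm_hasFDerivWithin_le'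
    (f := Γ.ψ) (f' := fderiv ℝ Γ.ψ) (φ := fderiv ℝ Γ.ψ z) (C := ε * m)
    (fun w hw => ((hC.differentiableOn (by norm_num)).differentiableAt
      (hTo.mem_nhds (hKT (hzT w hw)))).hasFDerivAt.hasFDerivWithinAt)
    (fun w hw => by
      rw [← dist_eq_norm]
      exact (hδ' w (hzT w hw) z (hzT z hz0)
        ((Metric.mem_ball.mp hw).trans_le (min_le_left _ _))).le) hy hx
  have hin : inner ℝ (gradient Γ.ψ z) (x - y) = fderiv ℝ Γ.ψ z (x - y) := by
    rw [gradient, InnerProductSpace.toDual_symm_apply]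
  rw [hin, ← Real.norm_eq_abs]
  refine hmvt.trans ?_
  gcongr

end LevelSetCurve

/-- Up to one percent, `G` is the affine function `σ x + y` with slope `|σ| ≤ 1` in the box of
half-width `6`. -/
structure IsChart (G : ℝ → ℝ → ℝ) (σ : ℝ) : Prop where
  slope : |σ| ≤ 1
  approx : ∀ x y x' y', |x| ≤ 6 → |y| ≤ 6 → |x'| ≤ 6 → |y'| ≤ 6 →
    |G x y - G x' y' - (σ * (x - x') + (y - y'))| ≤ (|x - x'| + |y - y'|) / 100

lemma IsChart.neg_left {G : ℝ → ℝ → ℝ} {σ : ℝ} (h : IsChart G σ) :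
    IsChart (fun x y => G (-x) y) (-σ) where
  slope := by rw [abs_neg]; exact h.slope
  approx x y x' y' hx hy hx' hy' := by
    have := h.approx (-x) y (-x') y' (by rwa [abs_neg]) hy (by rwa [abs_neg]) hy'
    have e : -x - -x' = -(x - x') := by ring
    rw [e, abs_neg] at this
    rwa [neg_mul_comm]

lemma norm_plane_le (x : Plane) : ‖x‖ ≤ |x 0| + |x 1| := by
  rw [EuclideanSpace.norm_eq, Fin.sum_univ_two]
  refine Real.sqrt_le_iff.mpr ⟨by positivity, ?_⟩
  simp only [Real.norm_eq_abs]
  nlinarith [abs_nonneg (x 0), abs_nonneg (x 1), mul_nonneg (abs_nonneg (x 0)) (abs_nonneg (x 1))]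

lemma inner_plane (x y : Plane) : inner ℝ x y = x 0 * y 0 + x 1 * y 1 := by
  simp [PiLp.inner_apply, Fin.sum_univ_two, mul_comm]

lemma framePt_sub (h : ℝ) (q e d : ℤ × ℤ) (x y x' y' : ℝ) :
    framePt h q e d x y - framePt h q e d x' y' =
      !₂[h * ((x - x') * e.1 + (y - y') * d.1), h * ((x - x') * e.2 + (y - y') * d.2)] := by
  ext i
  fin_cases i <;> simp [framePt] <;> ring

lemma IsFrame.norm_framePt_sub_le {e d : ℤ × ℤ} (hf : IsFrame e d) {h : ℝ} (hh : 0 < h)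
    (q : ℤ × ℤ) (x y x' y' : ℝ) :
    ‖framePt h q e d x y - framePt h q e d x' y'‖ ≤ h * (|x - x'| + |y - y'|) := by
  refine (norm_plane_le _).trans (le_of_eq ?_)
  rw [framePt_sub]
  simp only [Matrix.cons_val_zero, Matrix.cons_val_one, abs_mul, abs_of_pos hh]
  rcases hf.cases with ⟨rfl | rfl, rfl | rfl⟩ | ⟨rfl | rfl, rfl | rfl⟩ <;> simp [abs_sub_comm] <;>
    ring

/-- Every nonzero vector has a dominant lattice direction. -/
lemma exists_dominant_frame (N : Plane) (hN : N ≠ 0) : ∃ e d, IsFrame e d ∧ ∃ α β : ℝ, 0 < β ∧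
    |α| ≤ β ∧ ‖N‖ ≤ 2 * β ∧ N 0 = α * e.1 + β * d.1 ∧ N 1 = α * e.2 + β * d.2 := by
  have hn := norm_plane_le N
  have h0 : 0 < ‖N‖ := norm_pos_iff.mpr hN
  rcases le_total |N 0| |N 1| with h | h
  · have hpos : 0 < |N 1| := by linarith
    rcases le_total 0 (N 1) with hs | hs
    · rw [abs_of_nonneg hs] at hpos h hn
      exact ⟨(1, 0), (0, 1), by unfold IsFrame; decide, N 0, N 1, hpos, h, by linarith, by simp, by simp⟩
    · rw [abs_of_nonpos hs] at hpos h hn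
      exact ⟨(1, 0), (0, -1), by unfold IsFrame; decide, N 0, -N 1, hpos, h, by linarith, by simp, by simp⟩
  · have hpos : 0 < |N 0| := by linarith
    rcases le_total 0 (N 0) with hs | hs
    · rw [abs_of_nonneg hs] at hpos h hn
      exact ⟨(0, 1), (1, 0), by unfold IsFrame; decide, N 1, N 0, hpos, h, by linarith, by simp, by simp⟩
    · rw [abs_of_nonpos hs] at hpos h hn
      exact ⟨(0, 1), (-1, 0), by unfold IsFrame; decide, N 1, -N 0, hpos, h, by linarith, by simp, by simp⟩

/-- In lattice units, with `d` the dominant direction of the gradient and the function scaled to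
have derivative about `1` along `d`, the curve is a graph over `e` with slope at most about one. The
threshold `h₀` depends on `Γ` alone since rigid motions preserve distances. -/
lemma exists_chart (Γ : LevelSetCurve) : ∃ h₀ > (0 : ℝ), ∀ M : CutMesh Γ, M.h ≤ h₀ →
    ∀ z ∈ M.curve, ∃ e d, IsFrame e d ∧ ∃ c > (0 : ℝ), ∃ σ, ∀ q, ‖vertex M.h q - z‖ ≤ 4 * M.h →
      IsChart (fun x y => c * M.φ (framePt M.h q e d x y)) σ := by
  obtain ⟨ρ, hρ, hap⟩ := Γ.exists_affine_approx (ε := 1 / 200) (by norm_num)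
  -- Points of the box lie within `12 h` of the vertex, which lies within `4 h` of `z`, and `16 h <
  -- ρ`.
  refine ⟨ρ / 17, by positivity, fun M hM z hz => ?_⟩
  have hh := M.h_pos
  obtain ⟨N', hN', hN⟩ := hap (M.pos z) hz
  set L := M.pos.linearIsometryEquiv with hL
  set N := L.symm N' with hNdef
  have hN0 : N ≠ 0 := by
    rw [hNdef]
    simpa using hN'
  have hnorm : ‖N‖ = ‖N'‖ := L.symm.norm_map _
  obtain ⟨e, d, hf, α, β, hβ, hαβ, hNβ, hN1, hN2⟩ := exists_dominant_frame N hN0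
  -- The factor `(h β)⁻¹` normalizes the derivative along `d` to one. The accuracy `1/200` becomes
  -- `1/100` because `‖N‖ ≤ 2 β`.
  refine ⟨e, d, hf, (M.h * β)⁻¹, by positivity, α / β, fun q hq => ⟨?_, ?_⟩⟩
  · rw [abs_div, abs_of_pos hβ]
    exact div_le_one_of_le₀ hαβ hβ.le
  intro x y x' y' hx hy hx' hy'
  have hball : ∀ s t : ℝ, |s| ≤ 6 → |t| ≤ 6 →
      M.pos (framePt M.h q e d s t) ∈ Metric.ball (M.pos z) ρ := by
    intro s t hs ht
    rw [Metric.mem_ball, M.pos.dist_map, dist_eq_norm]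
    have h1 := hf.norm_framePt_sub_le hh q s t 0 0
    have h2 : framePt M.h q e d 0 0 = vertex M.h q := by
      have := framePt_int M.h q e d 0 0
      simpa using this
    rw [h2, sub_zero, sub_zero] at h1
    have h3 : framePt M.h q e d s t - z =
      (framePt M.h q e d s t - vertex M.h q) + (vertex M.h q - z) := by abel
    have h4 : M.h * (|s| + |t|) ≤ M.h * 12 := by gcongr; linarith
    rw [h3]
    have := norm_add_le (framePt M.h q e d s t - vertex M.h q) (vertex M.h q - z)
    linarith
  have key := hN _ (hball x y hx hy) _ (hball x' y' hx' hy')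
  set P := framePt M.h q e d x y
  set P' := framePt M.h q e d x' y'
  have hsub : M.pos P - M.pos P' = L (P - P') := by
    rw [hL, ← vsub_eq_sub, ← vsub_eq_sub, M.pos.map_vsub]
  have hin : inner ℝ N' (M.pos P - M.pos P') =
      M.h * β * (α / β * (x - x') + (y - y')) := by
    rw [hsub, ← L.symm.inner_map_map, L.symm_apply_apply, ← hNdef, inner_plane, framePt_sub]
    simp only [Matrix.cons_val_zero, Matrix.cons_val_one, hN1, hN2]
    have h1 : M.h * β * (α / β * (x - x') + (y - y')) =
      M.h * (α * (x - x') + β * (y - y')) := by field_simp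
    rw [h1]
    rcases hf.cases with ⟨rfl | rfl, rfl | rfl⟩ | ⟨rfl | rfl, rfl | rfl⟩ <;> simp <;> ring
  have hnm : ‖M.pos P - M.pos P'‖ ≤ M.h * (|x - x'| + |y - y'|) := by
    rw [hsub, L.norm_map]
    exact hf.norm_framePt_sub_le hh q x y x' y'
  rw [hin, ← hnorm] at key
  have e1 : (M.h * β)⁻¹ * M.φ P - (M.h * β)⁻¹ * M.φ P' - (α / β * (x - x') + (y - y')) =
      (M.h * β)⁻¹ * (Γ.ψ (M.pos P) - Γ.ψ (M.pos P') -
        M.h * β * (α / β * (x - x') + (y - y'))) := by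
    simp only [CutMesh.φ]
    field_simp
  rw [e1, abs_mul, abs_of_pos (by positivity), inv_mul_le_iff₀ (by positivity)]
  refine key.trans ?_
  calc 1 / 200 * ‖N‖ * ‖M.pos P - M.pos P'‖
      ≤ 1 / 200 * (2 * β) * (M.h * (|x - x'| + |y - y'|)) := by gcongr
    _ = _ := by ring

/-! ### Zeros of charts -/

namespace IsChart

variable {G : ℝ → ℝ → ℝ} {σ : ℝ}

lemma bounds (h : IsChart G σ) {x y x' y' : ℝ} (hx : |x| ≤ 6) (hy : |y| ≤ 6) (hx' : |x'| ≤ 6)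
    (hy' : |y'| ≤ 6) :
    σ * (x - x') + (y - y') - (|x - x'| + |y - y'|) / 100 ≤ G x y - G x' y' ∧
      G x y - G x' y' ≤ σ * (x - x') + (y - y') + (|x - x'| + |y - y'|) / 100 := by
  have := abs_le.mp (h.approx x y x' y' hx hy hx' hy')
  constructor <;> linarith [this.1, this.2]

lemma strictMono (h : IsChart G σ) {x y y' : ℝ} (hx : |x| ≤ 6) (hy : |y| ≤ 6) (hy' : |y'| ≤ 6)
    (hlt : y < y') : G x y < G x y' := by
  have h1 := (h.bounds hx hy hx hy').2
  have : |y - y'| = y' - y := by rw [abs_sub_comm, abs_of_pos (by linarith)]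
  rw [this, sub_self, mul_zero, abs_zero] at h1
  linarith

lemma zero_unique (h : IsChart G σ) {x y y' : ℝ} (hx : |x| ≤ 6) (hy : |y| ≤ 6) (hy' : |y'| ≤ 6)
    (h0 : G x y = 0) (h0' : G x y' = 0) : y = y' := by
  rcases lt_trichotomy y y' with hlt | heq | hlt
  · linarith [h.strictMono hx hy hy' hlt]
  · exact heq
  · linarith [h.strictMono hx hy' hy hlt]

lemma mono (h : IsChart G σ) {x y y' : ℝ} (hx : |x| ≤ 6) (hy : |y| ≤ 6) (hy' : |y'| ≤ 6)
    (hle : y ≤ y') : G x y ≤ G x y' := by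
  rcases hle.eq_or_lt with rfl | hlt
  · exact le_rfl
  · exact (h.strictMono hx hy hy' hlt).le

/-- A horizontal shift by at most `η/4` changes `G` by much less than a vertical move by `η`, so the
sign change between `y - η` and `y + η` survives the shift. -/
lemma exists_zero_near (h : IsChart G σ)
    (hivt : ∀ x y₁ y₂, y₁ ≤ y₂ → G x y₁ ≤ 0 → 0 < G x y₂ → ∃ y, y₁ ≤ y ∧ y ≤ y₂ ∧ G x y = 0)
    {x y η : ℝ} (hx : 0 ≤ x ∧ x ≤ 1) (hη : 0 < η) (hy0 : 0 ≤ y - η) (hy1 : y + η ≤ 1)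
    (h0 : G x y = 0) {s : ℝ} (hs : |s| ≤ η / 4) : ∃ y', 0 ≤ y' ∧ y' ≤ 1 ∧ G (x + s) y' = 0 := by
  have hσ := abs_le.mp h.slope
  have hs' := abs_le.mp hs
  have hx6 : |x| ≤ 6 := abs_le.mpr ⟨by linarith, by linarith⟩
  have hy6 : |y| ≤ 6 := abs_le.mpr ⟨by linarith, by linarith⟩
  have hσs : |σ * s| ≤ η / 4 := by
    rw [abs_mul]
    calc |σ| * |s| ≤ 1 * (η / 4) := mul_le_mul h.slope hs (abs_nonneg _) zero_le_one
      _ = _ := one_mul _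
  have hσs' := abs_le.mp hσs
  have h1 := (h.bounds (x := x + s) (y := y - η) (x' := x) (y' := y)
    (abs_le.mpr ⟨by linarith, by linarith⟩) (abs_le.mpr ⟨by linarith, by linarith⟩) hx6 hy6).2
  have h2 := (h.bounds (x := x + s) (y := y + η) (x' := x) (y' := y)
    (abs_le.mpr ⟨by linarith, by linarith⟩) (abs_le.mpr ⟨by linarith, by linarith⟩) hx6 hy6).1
  have e1 : x + s - x = s := by ring
  have e2 : y - η - y = -η := by ring
  have e3 : y + η - y = η := by ring
  rw [e1, e2, abs_neg, abs_of_pos hη, h0] at h1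
  rw [e1, e3, abs_of_pos hη, h0] at h2
  obtain ⟨y', hy', hy'', h3⟩ := hivt (x + s) (y - η) (y + η) (by linarith) (by linarith)
    (by linarith)
  exact ⟨y', by linarith, by linarith, h3⟩

/-- The part of the zero set of a chart in the unit square is an arc over an interval `[a, b]`;
the arc meets the boundary of the square exactly at its two end points. -/
lemma arc_structure (h : IsChart G σ)
    (hivt : ∀ x y₁ y₂, y₁ ≤ y₂ → G x y₁ ≤ 0 → 0 < G x y₂ → ∃ y, y₁ ≤ y ∧ y ≤ y₂ ∧ G x y = 0)
    (htr : ∀ x, 0 ≤ x ∧ x ≤ 1 → ∀ j, (j = 0 ∨ j = 1) → G x j = 0 →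
      ¬ IsLocalExtr (fun t => G t j) x)
    (hlow : Set.OrdConnected {x | (0 ≤ x ∧ x ≤ 1) ∧ ∃ y, -1 ≤ y ∧ y ≤ 0 ∧ G x y = 0})
    (hupp : Set.OrdConnected {x | (0 ≤ x ∧ x ≤ 1) ∧ ∃ y, 1 ≤ y ∧ y ≤ 2 ∧ G x y = 0})
    {a b : ℝ} (hab : a ≤ b)
    (hX : ∀ x, ((0 ≤ x ∧ x ≤ 1) ∧ ∃ y, 0 ≤ y ∧ y ≤ 1 ∧ G x y = 0) ↔ a ≤ x ∧ x ≤ b) :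
    ∃ ya yb, (0 ≤ a ∧ b ≤ 1) ∧ (0 ≤ ya ∧ ya ≤ 1) ∧ (0 ≤ yb ∧ yb ≤ 1) ∧ G a ya = 0 ∧ G b yb = 0 ∧
      (a = 0 ∨ a = 1 ∨ ya = 0 ∨ ya = 1) ∧ (b = 0 ∨ b = 1 ∨ yb = 0 ∨ yb = 1) ∧
      (∀ x y, 0 ≤ x ∧ x ≤ 1 → 0 ≤ y ∧ y ≤ 1 → G x y = 0 → (x = 0 ∨ x = 1 ∨ y = 0 ∨ y = 1) →
        (x = a ∧ y = ya) ∨ (x = b ∧ y = yb)) ∧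
      (a < b → (0 < ya ∨ 0 < yb) ∧ (ya < 1 ∨ yb < 1)) := by
  obtain ⟨⟨ha0, ha1⟩, ya, hya0, hya1, hGa⟩ := (hX a).mpr ⟨le_rfl, hab⟩
  obtain ⟨⟨hb0, hb1⟩, yb, hyb0, hyb1, hGb⟩ := (hX b).mpr ⟨hab, le_rfl⟩
  have six : ∀ {t : ℝ}, -1 ≤ t → t ≤ 2 → |t| ≤ 6 := fun h1 h2 =>
    abs_le.mpr ⟨by linarith, by linarith⟩
  -- Over the open interval the arc stays off the lower and upper sides: touching one would, by
  -- monotonicity in `y`, make the point a local extremum of `G` along that side, against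
  -- transversality.
  have hinner : ∀ x y, a < x → x < b → 0 ≤ y → y ≤ 1 → G x y = 0 → 0 < y ∧ y < 1 := by
    intro x y hax hxb hy0 hy1 hG
    constructor
    · refine lt_of_le_of_ne hy0 fun hy => htr x ⟨by linarith, by linarith⟩ 0 (Or.inl rfl)
        (by rw [← hy] at hG; exact hG) (Or.inr ?_)
      filter_upwards [Ioo_mem_nhds hax hxb] with t ht
      obtain ⟨-, y', hy'0, hy'1, hG'⟩ := (hX t).mpr ⟨ht.1.le, ht.2.le⟩
      have := h.mono (x := t) (six (by linarith [ht.1]) (by linarith [ht.2]))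
        (six (by norm_num) (by norm_num)) (six (by linarith) (by linarith)) hy'0
      rw [← hy] at hG
      simp only [hG]
      linarith
    · refine lt_of_le_of_ne hy1 fun hy => htr x ⟨by linarith, by linarith⟩ 1 (Or.inr rfl)
        (by rw [← hy]; exact hG) (Or.inl ?_)
      filter_upwards [Ioo_mem_nhds hax hxb] with t ht
      obtain ⟨-, y', hy'0, hy'1, hG'⟩ := (hX t).mpr ⟨ht.1.le, ht.2.le⟩
      have := h.mono (x := t) (six (by linarith [ht.1]) (by linarith [ht.2]))
        (six (by linarith) (by linarith)) (six (by norm_num) (by norm_num)) hy'1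
      rw [hy] at hG
      simp only [hG]
      linarith
  refine ⟨ya, yb, ⟨ha0, hb1⟩, ⟨hya0, hya1⟩, ⟨hyb0, hyb1⟩, hGa, hGb, ?_, ?_, ?_, ?_⟩
  -- An end point in the open square could be continued past `a`, contradicting the choice of the
  -- interval.
  · by_contra! hcon
    obtain ⟨n1, n2, n3, n4⟩ := hcon
    have p1 : 0 < a := lt_of_le_of_ne ha0 (Ne.symm n1)
    have p3 : 0 < ya := lt_of_le_of_ne hya0 (Ne.symm n3)
    have p4 : ya < 1 := lt_of_le_of_ne hya1 n4
    set η := min ya (1 - ya) with hη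
    have hηpos : 0 < η := lt_min p3 (by linarith)
    set s := min a (η / 4) with hs
    have hspos : 0 < s := lt_min p1 (by linarith)
    have hη1 : η ≤ ya := min_le_left _ _
    have hη2 : η ≤ 1 - ya := min_le_right _ _
    have hs1 : s ≤ a := min_le_left _ _
    obtain ⟨y', h1, h2, h3⟩ := h.exists_zero_near hivt ⟨ha0, ha1⟩ hηpos (by linarith)
      (by linarith) hGa (s := -s) (by rw [abs_neg, abs_of_pos hspos]; exact min_le_right _ _)
    have := (hX (a + -s)).mp ⟨⟨by linarith, by linarith⟩, y', h1, h2, h3⟩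
    linarith [this.1]
  · by_contra! hcon
    obtain ⟨n1, n2, n3, n4⟩ := hcon
    have p1 : b < 1 := lt_of_le_of_ne hb1 n2
    have p3 : 0 < yb := lt_of_le_of_ne hyb0 (Ne.symm n3)
    have p4 : yb < 1 := lt_of_le_of_ne hyb1 n4
    set η := min yb (1 - yb) with hη
    have hηpos : 0 < η := lt_min p3 (by linarith)
    set s := min (1 - b) (η / 4) with hs
    have hspos : 0 < s := lt_min (by linarith) (by linarith)
    have hη1 : η ≤ yb := min_le_left _ _
    have hη2 : η ≤ 1 - yb := min_le_right _ _
    have hs1 : s ≤ 1 - b := min_le_left _ _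
    obtain ⟨y', h1, h2, h3⟩ := h.exists_zero_near hivt ⟨hb0, hb1⟩ hηpos (by linarith)
      (by linarith) hGb (s := s) (by rw [abs_of_pos hspos]; exact min_le_right _ _)
    have := (hX (b + s)).mp ⟨⟨by linarith, by linarith⟩, y', h1, h2, h3⟩
    linarith [this.2]
  · intro x y hx hy hG hbd
    obtain ⟨hax, hxb⟩ := (hX x).mp ⟨hx, y, hy.1, hy.2, hG⟩
    rcases hax.eq_or_lt with rfl | hax
    · exact Or.inl ⟨rfl, h.zero_unique (six (by linarith) (by linarith))
        (six (by linarith) (by linarith)) (six (by linarith) (by linarith)) hG hGa⟩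
    rcases hxb.eq_or_lt with rfl | hxb
    · exact Or.inr ⟨rfl, h.zero_unique (six (by linarith) (by linarith))
        (six (by linarith) (by linarith)) (six (by linarith) (by linarith)) hG hGb⟩
    obtain ⟨h1, h2⟩ := hinner x y hax hxb hy.1 hy.2 hG
    rcases hbd with h3 | h3 | h3 | h3 <;> linarith
  -- If both end points lay on the lower side, they would also belong to the cell below.
  -- Connectedness there gives a zero with `y ≤ 0` over the midpoint, a second zero on the same
  -- vertical line. The upper side is symmetric.
  · intro hlt
    have hm1 : a < (a + b) / 2 := by linarith
    have hm2 : (a + b) / 2 < b := by linarith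
    obtain ⟨hmx, y, hy0, hy1, hG⟩ := (hX ((a + b) / 2)).mpr ⟨hm1.le, hm2.le⟩
    obtain ⟨h1, h2⟩ := hinner _ y hm1 hm2 hy0 hy1 hG
    constructor
    · by_contra! hcon
      obtain ⟨-, y', hy'0, hy'1, hG'⟩ := hlow.out
        (show a ∈ _ from ⟨⟨ha0, ha1⟩, ya, by linarith, hcon.1, hGa⟩)
        (show b ∈ _ from ⟨⟨hb0, hb1⟩, yb, by linarith, hcon.2, hGb⟩) ⟨hm1.le, hm2.le⟩
      have := h.zero_unique (six (by linarith [hmx.1]) (by linarith [hmx.2]))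
        (six (by linarith) (by linarith)) (six (by linarith) (by linarith)) hG hG'
      linarith
    · by_contra! hcon
      obtain ⟨-, y', hy'0, hy'1, hG'⟩ := hupp.out
        (show a ∈ _ from ⟨⟨ha0, ha1⟩, ya, hcon.1, by linarith, hGa⟩)
        (show b ∈ _ from ⟨⟨hb0, hb1⟩, yb, hcon.2, by linarith, hGb⟩) ⟨hm1.le, hm2.le⟩
      have := h.zero_unique (six (by linarith [hmx.1]) (by linarith [hmx.2]))
        (six (by linarith) (by linarith)) (six (by linarith) (by linarith)) hG hG'
      linarith

end IsChart

/-! ### The curve in the mesh -/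

namespace LevelSetCurve

variable (Γ : LevelSetCurve)

lemma isPreconnected_zeroSet : IsPreconnected {x | Γ.ψ x = 0} := by
  obtain ⟨c, hc, -, -, -, hr⟩ := Γ.simple_closed
  rw [← hr]
  exact isPreconnected_range hc.continuous

lemma infinite_zeroSet : {x | Γ.ψ x = 0}.Infinite := by
  obtain ⟨c, -, -, hinj, -, hr⟩ := Γ.simple_closed
  rw [← hr]
  exact ((Set.Ico_infinite zero_lt_one).image hinj).mono (Set.image_subset_range _ _)

lemma closure_interior : closure {x | Γ.ψ x < 0} = {x | Γ.ψ x ≤ 0} := by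
  rw [closure_eq_self_union_frontier, Γ.frontier_interior]
  ext x
  simp [le_iff_lt_or_eq]

/-- Continuity of `ψ` away from the curve is not available. Instead `{ψ > 0}` is open as the
complement of the closure of `{ψ < 0}`, so the two signs would disconnect `s`. -/
lemma exists_zero_of_isPreconnected {s : Set Plane} (hs : IsPreconnected s) {a b : Plane}
    (ha : a ∈ s) (hb : b ∈ s) (hψa : Γ.ψ a ≤ 0) (hψb : 0 < Γ.ψ b) : ∃ z ∈ s, Γ.ψ z = 0 := by
  by_contra! hcon
  have hopen : IsOpen {x | 0 < Γ.ψ x} := by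
    have : {x | 0 < Γ.ψ x} = (closure {x | Γ.ψ x < 0})ᶜ := by
      rw [Γ.closure_interior]
      ext x
      simp
    rw [this]
    exact isClosed_closure.isOpen_compl
  obtain ⟨z, -, hz1, hz2⟩ := hs _ _ Γ.isOpen_interior hopen
    (fun x hx => lt_or_gt_of_ne (hcon x hx)) ⟨a, ha, lt_of_le_of_ne hψa (hcon a ha)⟩ ⟨b, hb, hψb⟩
  exact lt_asymm (show Γ.ψ z < 0 from hz1) hz2

end LevelSetCurve

namespace CutMesh

variable {Γ : LevelSetCurve} (M : CutMesh Γ)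

lemma curve_eq_image : M.curve = M.pos.symm '' {x | Γ.ψ x = 0} := by
  ext x
  constructor
  · intro hx
    exact ⟨M.pos x, hx, M.pos.symm_apply_apply x⟩
  · rintro ⟨y, hy, rfl⟩
    simpa [curve, φ] using hy

lemma isCompact_curve : IsCompact M.curve := by
  rw [curve_eq_image]
  exact Γ.isCompact_zeroSet.image M.pos.symm.continuous

lemma isPreconnected_curve : IsPreconnected M.curve := by
  rw [curve_eq_image]
  exact Γ.isPreconnected_zeroSet.image _ M.pos.symm.continuous.continuousOn

lemma infinite_curve : M.curve.Infinite := by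
  rw [curve_eq_image]
  exact Γ.infinite_zeroSet.image M.pos.symm.injective.injOn

lemma exists_zero_segment {a b : Plane} (ha : M.φ a ≤ 0) (hb : 0 < M.φ b) :
    ∃ z ∈ segment ℝ a b, M.φ z = 0 := by
  obtain ⟨w, ⟨z, hz, rfl⟩, hw⟩ := Γ.exists_zero_of_isPreconnected
    (s := M.pos '' segment ℝ a b)
    ((convex_segment a b).isPreconnected.image _ M.pos.continuous.continuousOn)
    (Set.mem_image_of_mem _ (left_mem_segment ℝ a b))
    (Set.mem_image_of_mem _ (right_mem_segment ℝ a b)) ha hb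
  exact ⟨z, hz, hw⟩

lemma exists_zero_framePt_snd (q e d : ℤ × ℤ) {x y₁ y₂ : ℝ} (h12 : y₁ ≤ y₂)
    (h1 : M.φ (framePt M.h q e d x y₁) ≤ 0) (h2 : 0 < M.φ (framePt M.h q e d x y₂)) :
    ∃ y, y₁ ≤ y ∧ y ≤ y₂ ∧ M.φ (framePt M.h q e d x y) = 0 := by
  obtain ⟨z, hz, hz0⟩ := M.exists_zero_segment h1 h2
  rw [segment_eq_image'] at hz
  obtain ⟨t, ⟨ht0, ht1⟩, rfl⟩ := hz
  refine ⟨y₁ + t * (y₂ - y₁), by nlinarith, by nlinarith, ?_⟩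
  rw [← hz0]
  congr 1
  ext i
  fin_cases i <;> simp [framePt] <;> ring

lemma exists_zero_framePt_fst (q e d : ℤ × ℤ) {x₁ x₂ y : ℝ} (h12 : x₁ ≤ x₂)
    (h1 : M.φ (framePt M.h q e d x₁ y) ≤ 0) (h2 : 0 < M.φ (framePt M.h q e d x₂ y)) :
    ∃ x, x₁ ≤ x ∧ x ≤ x₂ ∧ M.φ (framePt M.h q e d x y) = 0 := by
  obtain ⟨z, hz, hz0⟩ := M.exists_zero_segment h1 h2
  rw [segment_eq_image'] at hz
  obtain ⟨t, ⟨ht0, ht1⟩, rfl⟩ := hz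
  refine ⟨x₁ + t * (x₂ - x₁), by nlinarith, by nlinarith, ?_⟩
  rw [← hz0]
  congr 1
  ext i
  fin_cases i <;> simp [framePt] <;> ring

variable {M}

/-- On a mesh edge, the level-set function has no local extremum at a zero. -/
lemma NondegenerateCut.not_isLocalExtr (hM : M.NondegenerateCut) {q e d : ℤ × ℤ}
    (hf : IsFrame e d) {x : ℝ} (hx : 0 ≤ x ∧ x ≤ 1) (h0 : M.φ (framePt M.h q e d x 0) = 0) :
    ¬ IsLocalExtr (fun t => M.φ (framePt M.h q e d t 0)) x := by
  intro hext
  have hh := M.h_pos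
  set z := framePt M.h q e d x 0 with hz
  obtain ⟨i, hi, hne⟩ : ∃ i : Fin 2, ((i = 0 ∧ (e = (1, 0) ∨ e = (-1, 0))) ∨
      (i = 1 ∧ (e = (0, 1) ∨ e = (0, -1)))) ∧
      fderiv ℝ M.φ z (EuclideanSpace.single i 1) ≠ 0 := by
    rcases hf.cases with ⟨rfl | rfl, -⟩ | ⟨rfl | rfl, -⟩
    · exact ⟨0, by simp, hM.1 q z ((mem_edgeH hh).mpr (by
        simp only [hz, framePt_zero_apply, framePt_one_apply]
        push_cast
        refine ⟨⟨?_, ?_⟩, ?_⟩ <;> nlinarith)) h0⟩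
    · exact ⟨0, by simp, hM.1 (q + (-1, 0)) z ((mem_edgeH hh).mpr (by
        simp only [hz, framePt_zero_apply, framePt_one_apply, Prod.fst_add, Prod.snd_add]
        push_cast
        refine ⟨⟨?_, ?_⟩, ?_⟩ <;> nlinarith)) h0⟩
    · exact ⟨1, by simp, hM.2.1 q z ((mem_edgeV hh).mpr (by
        simp only [hz, framePt_zero_apply, framePt_one_apply]
        push_cast
        refine ⟨?_, ?_, ?_⟩ <;> nlinarith)) h0⟩
    · exact ⟨1, by simp, hM.2.1 (q + (0, -1)) z ((mem_edgeV hh).mpr (by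
        simp only [hz, framePt_zero_apply, framePt_one_apply, Prod.fst_add, Prod.snd_add]
        push_cast
        refine ⟨?_, ?_, ?_⟩ <;> nlinarith)) h0⟩
  -- The convention `fderiv = 0` at points of nondifferentiability lets a nonzero derivative carry
  -- differentiability with it.
  have hdiff : DifferentiableAt ℝ M.φ z := by
    by_contra h
    rw [fderiv_zero_of_not_differentiableAt h] at hne
    simp at hne
  set w : Plane := !₂[M.h * e.1, M.h * e.2] with hw
  have hline : HasDerivAt (fun t => framePt M.h q e d t 0) w x := by
    have h1 : (fun t => framePt M.h q e d t 0) = fun t => vertex M.h q + t • w := by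
      funext t
      ext j
      fin_cases j <;> simp [framePt, vertex, hw] <;> ring
    rw [h1]
    simpa using ((hasDerivAt_id x).smul_const w).const_add (vertex M.h q)
  have hcomp := hdiff.hasFDerivAt.comp_hasDerivAt x hline
  have hzero : fderiv ℝ M.φ z w = 0 := hext.hasDerivAt_eq_zero hcomp
  refine hne ?_
  have hsingle : ∃ s : ℝ, EuclideanSpace.single i (1 : ℝ) = s • w := by
    rcases hi with ⟨rfl, rfl | rfl⟩ | ⟨rfl, rfl | rfl⟩
    · refine ⟨M.h⁻¹, ?_⟩
      ext j; fin_cases j <;> simp [hw, hh.ne']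
    · refine ⟨-M.h⁻¹, ?_⟩
      ext j; fin_cases j <;> simp [hw, hh.ne']
    · refine ⟨M.h⁻¹, ?_⟩
      ext j; fin_cases j <;> simp [hw, hh.ne']
    · refine ⟨-M.h⁻¹, ?_⟩
      ext j; fin_cases j <;> simp [hw, hh.ne']
  obtain ⟨s, hs⟩ := hsingle
  rw [hs, map_smul, hzero, smul_zero]

/-- As a continuous image of the curve inside a cell, this coordinate set inherits connectedness and
compactness, and hence is a closed interval. -/
lemma fst_curve_inter_cell {q e d : ℤ × ℤ} (hf : IsFrame e d) :
    {x | (0 ≤ x ∧ x ≤ 1) ∧ ∃ y, 0 ≤ y ∧ y ≤ 1 ∧ M.φ (framePt M.h q e d x y) = 0} =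
      (fun z : Plane => (z 0 / M.h - q.1) * e.1 + (z 1 / M.h - q.2) * e.2) ''
        (M.curve ∩ cell M.h (frameCell q e d)) := by
  have hh := M.h_pos
  ext x
  constructor
  · rintro ⟨hx, y, hy0, hy1, hφ⟩
    exact ⟨framePt M.h q e d x y, ⟨hφ, (hf.framePt_mem_cell hh q x y).mpr ⟨hx, hy0, hy1⟩⟩,
      hf.fst_framePt hh q x y⟩
  · rintro ⟨z, ⟨hφ, hz⟩, hzx⟩
    obtain ⟨x', y', rfl⟩ := hf.exists_framePt hh q z
    simp only [hf.fst_framePt hh] at hzx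
    subst hzx
    obtain ⟨hx, hy⟩ := (hf.framePt_mem_cell hh q x' y').mp hz
    exact ⟨hx, y', hy.1, hy.2, hφ⟩

/-- The first lattice coordinates, in a frame, of the points of the curve in a cell form an order
connected set. -/
lemma NondegenerateCut.ordConnected_fst (hM : M.NondegenerateCut) {q e d : ℤ × ℤ}
    (hf : IsFrame e d) :
    Set.OrdConnected {x | (0 ≤ x ∧ x ≤ 1) ∧
      ∃ y, 0 ≤ y ∧ y ≤ 1 ∧ M.φ (framePt M.h q e d x y) = 0} := by
  rw [fst_curve_inter_cell hf]
  refine ((hM.2.2 _).image _ ?_).ordConnected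
  fun_prop

lemma isCompact_fst {q e d : ℤ × ℤ} (hf : IsFrame e d) :
    IsCompact {x | (0 ≤ x ∧ x ≤ 1) ∧
      ∃ y, 0 ≤ y ∧ y ≤ 1 ∧ M.φ (framePt M.h q e d x y) = 0} := by
  rw [fst_curve_inter_cell hf]
  refine (M.isCompact_curve.inter_right (isClosed_cell _ _)).image ?_
  fun_prop

end CutMesh

/-! ### The arc of the curve in one active cell -/

namespace CutMesh

variable {Γ : LevelSetCurve} {M : CutMesh Γ}

/-- Near every point of the curve, the level-set function has a chart at the scale of the mesh. -/
def HasCharts (M : CutMesh Γ) : Prop :=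
  ∀ z ∈ M.curve, ∃ e d, IsFrame e d ∧ ∃ c > (0 : ℝ), ∃ σ, ∀ q, ‖vertex M.h q - z‖ ≤ 4 * M.h →
    IsChart (fun x y => c * M.φ (framePt M.h q e d x y)) σ

lemma framePt_zero_zero (h : ℝ) (q e d : ℤ × ℤ) : framePt h q e d 0 0 = vertex h q := by
  simpa using framePt_int h q e d 0 0

lemma framePt_shift_snd (h : ℝ) (q e d : ℤ × ℤ) (x y : ℝ) :
    framePt h (q + d) e d x y = framePt h q e d x (y + 1) := by
  simpa using framePt_shift h q e d 0 1 x y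

lemma framePt_shift_snd_neg (h : ℝ) (q e d : ℤ × ℤ) (x y : ℝ) :
    framePt h (q - d) e d x y = framePt h q e d x (y - 1) := by
  simpa [sub_eq_add_neg] using framePt_shift h q e d 0 (-1) x y

/-- In an active cell, the curve is an arc (possibly a single corner of the cell) that meets the
cell boundary only in its end points, and the chord of a nondegenerate arc runs through the
interior of the cell. -/
lemma NondegenerateCut.exists_crossings (hM : M.NondegenerateCut) (hch : M.HasCharts)
    {k : ℤ × ℤ} (hk : k ∈ M.activeCells) : ∃ a b, M.crossings k = {a, b} ∧
      (a = b → M.curve ∩ cell M.h k = {a}) ∧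
      (a ≠ b → ∀ t : ℝ, 0 < t → t < 1 → a + t • (b - a) ∈ openCell M.h k) := by
  have hh := M.h_pos
  obtain ⟨z, hz, hzk⟩ := hk
  obtain ⟨e, d, hf, c, hc, σ, hchart⟩ := hch z hz
  obtain ⟨q, rfl⟩ := exists_frameCell e d k
  obtain ⟨x₀, y₀, rfl⟩ := hf.exists_framePt hh q z
  obtain ⟨hx₀, hy₀⟩ := (hf.framePt_mem_cell hh q x₀ y₀).mp hzk
  have hG := hchart q (by
    rw [← framePt_zero_zero M.h q e d]
    refine (hf.norm_framePt_sub_le hh q 0 0 x₀ y₀).trans ?_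
    rw [zero_sub, zero_sub, abs_neg, abs_neg, abs_of_nonneg hx₀.1, abs_of_nonneg hy₀.1]
    nlinarith)
  set G : ℝ → ℝ → ℝ := fun x y => c * M.φ (framePt M.h q e d x y) with hGdef
  have hG0 : ∀ x y, G x y = 0 ↔ M.φ (framePt M.h q e d x y) = 0 := fun x y => by
    simp [hGdef, hc.ne']
  set X := {x | (0 ≤ x ∧ x ≤ 1) ∧ ∃ y, 0 ≤ y ∧ y ≤ 1 ∧ M.φ (framePt M.h q e d x y) = 0} with hXdef
  have hXne : X.Nonempty := ⟨x₀, hx₀, y₀, hy₀.1, hy₀.2, hz⟩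
  have hXcpt : IsCompact X := isCompact_fst hf
  have hXpre : IsPreconnected X := (hM.ordConnected_fst hf).isPreconnected
  have hXeq := eq_Icc_csInf_csSup_of_connected_bdd_closed ⟨hXne, hXpre⟩ hXcpt.bddBelow
    hXcpt.bddAbove hXcpt.isClosed
  set a := sInf X
  set b := sSup X
  have hab : a ≤ b := by
    have : (Set.Icc a b).Nonempty := hXeq ▸ hXne
    exact Set.nonempty_Icc.mp this
  have hX : ∀ x, ((0 ≤ x ∧ x ≤ 1) ∧ ∃ y, 0 ≤ y ∧ y ≤ 1 ∧ G x y = 0) ↔ a ≤ x ∧ x ≤ b := by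
    intro x
    simp only [hG0]
    exact Set.ext_iff.mp hXeq x
  -- The convention for the neighbouring cells `s = -1` and `s = 1`, rewritten in the coordinates of
  -- the present cell.
  have hshift : ∀ (q' : ℤ × ℤ) (s : ℝ), (∀ x y, framePt M.h q' e d x y =
      framePt M.h q e d x (y + s)) → Set.OrdConnected {x | (0 ≤ x ∧ x ≤ 1) ∧
        ∃ y, s ≤ y ∧ y ≤ s + 1 ∧ G x y = 0} := by
    intro q' s hs
    have := hM.ordConnected_fst (q := q') hf
    simp only [hs] at this
    convert this using 4 with x
    constructor
    · rintro ⟨y, h1, h2, h3⟩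
      exact ⟨y - s, by linarith, by linarith, by rwa [sub_add_cancel, ← hG0]⟩
    · rintro ⟨y, h1, h2, h3⟩
      exact ⟨y + s, by linarith, by linarith, (hG0 _ _).mpr h3⟩
  have hlow := hshift (q - d) (-1) (fun x y => by
    rw [framePt_shift_snd_neg, sub_eq_add_neg])
  have hupp := hshift (q + d) 1 (fun x y => framePt_shift_snd _ _ _ _ _ _)
  rw [neg_add_cancel] at hlow
  rw [one_add_one_eq_two] at hupp
  have hscale : ∀ (f : ℝ → ℝ) x, IsLocalExtr (fun t => c * f t) x → IsLocalExtr f x := by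
    intro f x hx
    rcases hx with hx | hx
    · left; filter_upwards [hx] with t ht using le_of_mul_le_mul_left ht hc
    · right; filter_upwards [hx] with t ht using le_of_mul_le_mul_left ht hc
  obtain ⟨ya, yb, hab01, hya, hyb, hGa, hGb, hbda, hbdb, huniq, hint⟩ := hG.arc_structure
    (by
      intro x y₁ y₂ h12 h1 h2
      obtain ⟨y, h3, h4, h5⟩ := M.exists_zero_framePt_snd q e d h12
        (nonpos_of_mul_nonpos_right h1 hc) (pos_of_mul_pos_right h2 hc.le)
      exact ⟨y, h3, h4, (hG0 _ _).mpr h5⟩)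
    (by
      rintro x hx j (rfl | rfl) h0 hext
      · exact hM.not_isLocalExtr hf hx ((hG0 _ _).mp h0) (hscale _ _ hext)
      · have h1 : ∀ t, framePt M.h q e d t 1 = framePt M.h (q + d) e d t 0 := fun t => by
          rw [framePt_shift_snd, zero_add]
        have h0' := (hG0 _ _).mp h0
        have hext' := hscale _ _ hext
        simp only [h1] at h0' hext'
        exact hM.not_isLocalExtr hf hx h0' hext')
    hlow hupp hab hX
  have ha01 : 0 ≤ a ∧ a ≤ 1 := ⟨hab01.1, hab.trans hab01.2⟩
  have hb01 : 0 ≤ b ∧ b ≤ 1 := ⟨hab01.1.trans hab, hab01.2⟩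
  have six : ∀ {t : ℝ}, 0 ≤ t ∧ t ≤ 1 → |t| ≤ 6 := fun h1 =>
    abs_le.mpr ⟨by linarith [h1.1], by linarith [h1.2]⟩
  refine ⟨framePt M.h q e d a ya, framePt M.h q e d b yb, ?_, ?_, ?_⟩
  · ext w
    simp only [crossings, Set.mem_ofPred_eq, Set.mem_insert_iff, Set.mem_singleton_iff]
    constructor
    · rintro ⟨hw, hw0⟩
      obtain ⟨x, y, rfl⟩ := hf.exists_framePt hh q w
      obtain ⟨⟨hx, hy⟩, hbd⟩ := (hf.framePt_mem_cellBoundary hh q x y).mp hw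
      rcases huniq x y hx hy ((hG0 _ _).mpr hw0) hbd with ⟨rfl, rfl⟩ | ⟨rfl, rfl⟩
      · exact Or.inl rfl
      · exact Or.inr rfl
    · rintro (rfl | rfl)
      · exact ⟨(hf.framePt_mem_cellBoundary hh q _ _).mpr ⟨⟨ha01, hya⟩, hbda⟩, (hG0 _ _).mp hGa⟩
      · exact ⟨(hf.framePt_mem_cellBoundary hh q _ _).mpr ⟨⟨hb01, hyb⟩, hbdb⟩, (hG0 _ _).mp hGb⟩
  · intro heq
    obtain ⟨hab', -⟩ := hf.framePt_inj hh heq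
    ext w
    simp only [Set.mem_inter_iff, Set.mem_singleton_iff]
    constructor
    · rintro ⟨hw0, hw⟩
      obtain ⟨x, y, rfl⟩ := hf.exists_framePt hh q w
      obtain ⟨hx, hy⟩ := (hf.framePt_mem_cell hh q x y).mp hw
      have hwG := (hG0 _ _).mpr hw0
      obtain ⟨h1, h2⟩ := (hX x).mp ⟨hx, y, hy.1, hy.2, hwG⟩
      have hxa : x = a := le_antisymm (h2.trans hab'.ge) h1
      subst hxa
      rw [hG.zero_unique (six hx) (six hy) (six hya) hwG hGa]
    · rintro rfl
      exact ⟨(hG0 _ _).mp hGa, (hf.framePt_mem_cell hh q _ _).mpr ⟨ha01, hya⟩⟩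
  -- The first coordinate increases strictly along the chord, and the end points do not both lie on
  -- the lower or both on the upper side, so convex combinations are strictly interior.
  · intro hne t ht0 ht1
    have hlt : a < b := by
      refine lt_of_le_of_ne hab fun heq => hne ?_
      rw [← heq] at hGb ⊢
      rw [hG.zero_unique (six ha01) (six hya) (six hyb) hGa hGb]
    obtain ⟨h1, h2⟩ := hint hlt
    rw [framePt_lineMap]
    refine hf.framePt_mem_openCell hh ⟨?_, ?_⟩ ⟨?_, ?_⟩
    · nlinarith
    · nlinarith
    · rcases h1 with h1 | h1
      · have := mul_pos (sub_pos.mpr ht1) h1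
        have := mul_nonneg ht0.le hyb.1
        linarith
      · have := mul_nonneg (sub_pos.mpr ht1).le hya.1
        have := mul_pos ht0 h1
        linarith
    · rcases h2 with h2 | h2
      · have := mul_pos (sub_pos.mpr ht1) (sub_pos.mpr h2)
        have := mul_nonneg ht0.le (sub_nonneg.mpr hyb.2)
        linarith
      · have := mul_nonneg (sub_pos.mpr ht1).le (sub_nonneg.mpr hya.2)
        have := mul_pos ht0 (sub_pos.mpr h2)
        linarith

end CutMesh

/-! ### Integration along segments -/

/-- The arc-length parametrization is an isometric embedding of the line, under which the
one-dimensional Hausdorff measure pulls back to Lebesgue measure. -/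
lemma integral_hausdorff_segment {a b : Plane} (hab : a ≠ b) (f : Plane → ℝ) :
    ∫ x in segment ℝ a b, f x ∂(Measure.hausdorffMeasure 1) =
      ‖b - a‖ * ∫ t in (0 : ℝ)..1, f (a + t • (b - a)) := by
  set ℓ := ‖b - a‖ with hℓ
  have hℓpos : 0 < ℓ := norm_pos_iff.mpr (sub_ne_zero.mpr hab.symm)
  set g : ℝ → Plane := fun s => a + s • (ℓ⁻¹ • (b - a)) with hg
  have hgiso : Isometry g := by
    refine Isometry.of_dist_eq fun s t => ?_
    rw [dist_eq_norm, hg]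
    have : a + s • (ℓ⁻¹ • (b - a)) - (a + t • (ℓ⁻¹ • (b - a))) = (s - t) • (ℓ⁻¹ • (b - a)) := by
      rw [sub_smul]; abel
    simp only [this]
    rw [norm_smul, norm_smul, norm_inv, ← hℓ, Real.norm_of_nonneg hℓpos.le,
      inv_mul_cancel₀ hℓpos.ne', mul_one, Real.dist_eq, Real.norm_eq_abs]
  have himg : g ⁻¹' segment ℝ a b = Set.Icc 0 ℓ := by
    ext s
    rw [segment_eq_image', Set.mem_preimage, Set.mem_image]
    constructor
    · rintro ⟨t, ⟨ht0, ht1⟩, hts⟩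
      have : g (t * ℓ) = g s := by
        rw [← hts, hg]
        simp only [smul_smul]
        rw [mul_assoc, mul_inv_cancel₀ hℓpos.ne', mul_one]
      rw [← hgiso.injective this]
      exact ⟨by positivity, by nlinarith⟩
    · rintro ⟨h0, h1⟩
      refine ⟨s / ℓ, ⟨by positivity, (div_le_one hℓpos).mpr h1⟩, ?_⟩
      rw [hg]
      simp only [smul_smul]
      rw [div_eq_mul_inv]
  have hsub : segment ℝ a b ⊆ Set.range g := by
    rw [segment_eq_image']
    rintro _ ⟨t, -, rfl⟩
    refine ⟨t * ℓ, ?_⟩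
    rw [hg]
    simp only [smul_smul]
    rw [mul_assoc, mul_inv_cancel₀ hℓpos.ne', mul_one]
  have hme : MeasurableEmbedding g := hgiso.isClosedEmbedding.measurableEmbedding
  have hmap := hgiso.map_hausdorffMeasure (d := 1) (Or.inl zero_le_one)
  have h1 : ∫ x in segment ℝ a b, f x ∂(Measure.hausdorffMeasure 1) =
      ∫ x in segment ℝ a b, f x ∂(Measure.map g (Measure.hausdorffMeasure 1)) := by
    rw [hmap, Measure.restrict_restrict_of_subset hsub]
  rw [h1, hme.setIntegral_map, himg, hausdorffMeasure_real, integral_Icc_eq_integral_Ioc,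
    ← intervalIntegral.integral_of_le hℓpos.le]
  have h2 := intervalIntegral.smul_integral_comp_mul_left (a := 0) (b := 1)
    (fun s => f (g s)) ℓ
  rw [mul_zero, mul_one] at h2
  rw [← h2, smul_eq_mul]
  congr 1
  refine intervalIntegral.integral_congr fun t _ => ?_
  simp only [hg, smul_smul]
  rw [mul_comm ℓ t, mul_assoc, mul_inv_cancel₀ hℓpos.ne', mul_one]

/-! ### The bilinear basis functions in a cell -/

/-- The value at `ξ ∈ [0, 1]` of the one-dimensional hat function of the integer node `n`. -/
noncomputable def hatCoord (n : ℤ) (ξ : ℝ) : ℝ := if n = 0 then 1 - ξ else if n = 1 then ξ else 0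

/-- The slope of the one-dimensional hat function of the integer node `n` in `[0, 1]`. -/
noncomputable def hatSlope (n : ℤ) : ℝ := if n = 0 then -1 else if n = 1 then 1 else 0

lemma hatCoord_add (n : ℤ) (ξ s : ℝ) : hatCoord n (ξ + s) = hatCoord n ξ + hatSlope n * s := by
  unfold hatCoord hatSlope
  split_ifs <;> ring

lemma abs_hatCoord_le (n : ℤ) {ξ : ℝ} (h : 0 ≤ ξ ∧ ξ ≤ 1) : |hatCoord n ξ| ≤ 1 := by
  unfold hatCoord
  split_ifs <;> rw [abs_le] <;> constructor <;> linarith [h.1, h.2]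

lemma abs_hatSlope_le (n : ℤ) : |hatSlope n| ≤ 1 := by
  unfold hatSlope
  split_ifs <;> simp

lemma max_zero_one_sub_abs (n : ℤ) {ξ : ℝ} (h : 0 ≤ ξ ∧ ξ ≤ 1) :
    max 0 (1 - |ξ - n|) = hatCoord n ξ := by
  obtain ⟨h0, h1⟩ := h
  unfold hatCoord
  split_ifs with hn0 hn1
  · subst hn0
    rw [Int.cast_zero, sub_zero, abs_of_nonneg h0, max_eq_right (by linarith)]
  · subst hn1
    rw [Int.cast_one, abs_of_nonpos (by linarith), max_eq_right (by linarith)]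
    ring
  · refine max_eq_left ?_
    rw [sub_nonpos]
    rcases lt_or_gt_of_ne hn0 with hlt | hgt
    · have : (n : ℝ) ≤ -1 := by exact_mod_cast Int.le_sub_one_of_lt hlt
      exact le_trans (by linarith) (le_abs_self _)
    · have : (2 : ℝ) ≤ n := by exact_mod_cast (by omega : 2 ≤ n)
      exact le_trans (by linarith) (neg_le_abs _)

/-- The local coordinates in the cell `k`. -/
noncomputable def cellCoord (h : ℝ) (k : ℤ × ℤ) (x : Plane) (i : Fin 2) : ℝ :=
  x i / h - if i = 0 then (k.1 : ℝ) else k.2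

lemma cellCoord_mem {h : ℝ} (hh : 0 < h) {k : ℤ × ℤ} {x : Plane} (hx : x ∈ cell h k) (i : Fin 2) :
    0 ≤ cellCoord h k x i ∧ cellCoord h k x i ≤ 1 := by
  obtain ⟨⟨h1, h2⟩, h3, h4⟩ := hx
  unfold cellCoord
  rw [sub_nonneg, sub_le_iff_le_add, le_div_iff₀ hh, div_le_iff₀ hh]
  fin_cases i
  · simp; constructor <;> linarith
  · simp; constructor <;> linarith

lemma cellCoord_add_smul (h : ℝ) (k : ℤ × ℤ) (x v : Plane) (t : ℝ) (i : Fin 2) :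
    cellCoord h k (x + t • v) i = cellCoord h k x i + v i / h * t := by
  simp only [cellCoord, PiLp.add_apply, PiLp.smul_apply, smul_eq_mul]
  ring

lemma hat_eq_of_mem_cell {h : ℝ} (hh : 0 < h) {k : ℤ × ℤ} {x : Plane} (hx : x ∈ cell h k)
    (p : ℤ × ℤ) : hat h p x =
      hatCoord (p.1 - k.1) (cellCoord h k x 0) * hatCoord (p.2 - k.2) (cellCoord h k x 1) := by
  rw [← max_zero_one_sub_abs _ (cellCoord_mem hh hx 0),
    ← max_zero_one_sub_abs _ (cellCoord_mem hh hx 1), hat]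
  have key : ∀ (s : ℝ) (a b : ℤ), |s - h * a| / h = |s / h - b - ((a - b : ℤ) : ℝ)| := by
    intro s a b
    rw [← abs_of_pos hh, ← abs_div, abs_of_pos hh]
    congr 1
    push_cast
    field_simp
    ring
  rw [key _ _ k.1, key _ _ k.2]
  simp [cellCoord]

lemma hat_eq_zero_of_notMem_corners {h : ℝ} (hh : 0 < h) {k : ℤ × ℤ} {x : Plane}
    (hx : x ∈ cell h k) {p : ℤ × ℤ} (hp : p ∉ corners k) : hat h p x = 0 := by
  rw [hat_eq_of_mem_cell hh hx]
  by_contra hne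
  obtain ⟨h1, h2⟩ := mul_ne_zero_iff.mp hne
  refine hp ?_
  have key : ∀ (n : ℤ) ξ, hatCoord n ξ ≠ 0 → n = 0 ∨ n = 1 := by
    intro n ξ hn
    by_contra! hcon
    simp [hatCoord, hcon.1, hcon.2] at hn
  obtain ⟨a, b⟩ := p
  obtain ⟨c, d⟩ := k
  simp only [corners, Finset.mem_insert, Finset.mem_singleton, Prod.mk_add_mk, Prod.mk.injEq]
  have := key _ _ h1
  have := key _ _ h2
  simp only at *
  omega

/-- The derivative at the point `x` of a cell, in the direction `v`, of the bilinear function that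
coincides with the basis function of the vertex `p` in the cell. -/
noncomputable def hatDeriv (h : ℝ) (k p : ℤ × ℤ) (x v : Plane) : ℝ :=
  hatSlope (p.1 - k.1) * (v 0 / h) * hatCoord (p.2 - k.2) (cellCoord h k x 1) +
    hatCoord (p.1 - k.1) (cellCoord h k x 0) * (hatSlope (p.2 - k.2) * (v 1 / h))

lemma hatDeriv_eq_zero_of_notMem_corners (h : ℝ) {k p : ℤ × ℤ} (hp : p ∉ corners k)
    (x v : Plane) : hatDeriv h k p x v = 0 := by
  have hcase : (hatSlope (p.1 - k.1) = 0 ∧ ∀ ξ, hatCoord (p.1 - k.1) ξ = 0) ∨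
      (hatSlope (p.2 - k.2) = 0 ∧ ∀ ξ, hatCoord (p.2 - k.2) ξ = 0) := by
    have key : ∀ n : ℤ, (n = 0 ∨ n = 1) ∨ (hatSlope n = 0 ∧ ∀ ξ, hatCoord n ξ = 0) := by
      intro n
      by_cases h0 : n = 0
      · exact Or.inl (Or.inl h0)
      by_cases h1 : n = 1
      · exact Or.inl (Or.inr h1)
      · right; simp [hatSlope, hatCoord, h0, h1]
    rcases key (p.1 - k.1) with h1 | h1
    · rcases key (p.2 - k.2) with h2 | h2
      · exfalso
        refine hp ?_
        obtain ⟨a, b⟩ := p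
        obtain ⟨c, d⟩ := k
        simp only [corners, Finset.mem_insert, Finset.mem_singleton, Prod.mk_add_mk,
          Prod.mk.injEq]
        simp only at *
        omega
      · exact Or.inr h2
    · exact Or.inl h1
  unfold hatDeriv
  rcases hcase with ⟨h1, h2⟩ | ⟨h1, h2⟩ <;> simp [h1, h2]

/-- A bilinear function restricted to a line is quadratic, so its derivative along the line is
affine in the parameter. -/
lemma hatDeriv_affine (h : ℝ) (k p : ℤ × ℤ) (x v : Plane) (t : ℝ) :
    hatDeriv h k p (x + t • v) v =
      hatDeriv h k p x v + t * (hatDeriv h k p (x + v) v - hatDeriv h k p x v) := by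
  have h1 := cellCoord_add_smul h k x v 1
  rw [one_smul] at h1
  simp only [hatDeriv, cellCoord_add_smul, h1, hatCoord_add]
  ring

/-- Integral of the affine derivative: the increment is determined exactly by the derivatives at the
two end points. -/
lemma hat_along_segment {h : ℝ} (hh : 0 < h) {k : ℤ × ℤ} (p : ℤ × ℤ) {x v : Plane} {t : ℝ}
    (hx : x ∈ cell h k) (hxt : x + t • v ∈ cell h k) : hat h p (x + t • v) = hat h p x +
      (hatDeriv h k p x v * (t - t ^ 2 / 2) + hatDeriv h k p (x + v) v * (t ^ 2 / 2)) := by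
  have h1 := cellCoord_add_smul h k x v 1
  rw [one_smul] at h1
  rw [hat_eq_of_mem_cell hh hx, hat_eq_of_mem_cell hh hxt]
  simp only [hatDeriv, cellCoord_add_smul, h1, hatCoord_add]
  ring

lemma abs_hatDeriv_le {h : ℝ} (hh : 0 < h) {k : ℤ × ℤ} (p : ℤ × ℤ) {x : Plane}
    (hx : x ∈ cell h k) (v : Plane) : |hatDeriv h k p x v| ≤ 2 * ‖v‖ / h := by
  have key : ∀ i : Fin 2, |v i / h| ≤ ‖v‖ / h := fun i => by
    rw [abs_div, abs_of_pos hh]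
    exact div_le_div_of_nonneg_right (PiLp.norm_apply_le v i) hh.le
  have h1 := abs_hatSlope_le (p.1 - k.1)
  have h2 := abs_hatSlope_le (p.2 - k.2)
  have h3 := abs_hatCoord_le (p.1 - k.1) (cellCoord_mem hh hx 0)
  have h4 := abs_hatCoord_le (p.2 - k.2) (cellCoord_mem hh hx 1)
  have hn : 0 ≤ ‖v‖ / h := by positivity
  unfold hatDeriv
  refine (abs_add_le _ _).trans ?_
  simp only [abs_mul]
  calc _ ≤ 1 * (‖v‖ / h) * 1 + 1 * (1 * (‖v‖ / h)) := by
        gcongr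
        · exact key 0
        · exact key 1
    _ = _ := by ring

lemma isOpen_openCell (h : ℝ) (k : ℤ × ℤ) : IsOpen (openCell h k) := by
  have h0 : Continuous fun x : Plane => x 0 := by fun_prop
  have h1 : Continuous fun x : Plane => x 1 := by fun_prop
  exact ((isOpen_lt continuous_const h0).inter (isOpen_lt h0 continuous_const)).inter
    ((isOpen_lt continuous_const h1).inter (isOpen_lt h1 continuous_const))

lemma openCell_subset_cell (h : ℝ) (k : ℤ × ℤ) : openCell h k ⊆ cell h k :=
  fun _ hx => ⟨⟨hx.1.1.le, hx.1.2.le⟩, hx.2.1.le, hx.2.2.le⟩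

/-- Near a point of the open cell the basis function is a bilinear polynomial. On mesh edges it may
fail to be differentiable, which is why chords have to run through open cells. -/
lemma inner_gradient_hat {h : ℝ} (hh : 0 < h) {k : ℤ × ℤ} (p : ℤ × ℤ) {x : Plane}
    (hx : x ∈ openCell h k) (v : Plane) : inner ℝ v (gradient (hat h p) x) =
      hatDeriv h k p x v := by
  have hcell : ∀ᶠ y in nhds x, y ∈ cell h k :=
    ((isOpen_openCell h k).mem_nhds hx |> Filter.mem_of_superset) (openCell_subset_cell h k)
  have hev : hat h p =ᶠ[nhds x] fun y => hatCoord (p.1 - k.1) (cellCoord h k y 0) *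
      hatCoord (p.2 - k.2) (cellCoord h k y 1) := by
    filter_upwards [hcell] with y hy using hat_eq_of_mem_cell hh hy p
  have hcd : ∀ n : ℤ, Differentiable ℝ (hatCoord n) := by
    intro n
    unfold hatCoord
    split_ifs <;> fun_prop
  have hcc : ∀ i, Differentiable ℝ fun y => cellCoord h k y i := by
    intro i
    unfold cellCoord
    fun_prop
  have hdiff : DifferentiableAt ℝ (hat h p) x := by
    refine DifferentiableAt.congr_of_eventuallyEq ?_ hev
    exact ((hcd _).comp (hcc 0)).differentiableAt.mul ((hcd _).comp (hcc 1)).differentiableAt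
  have hline : HasDerivAt (fun t : ℝ => x + t • v) v 0 := by
    simpa using ((hasDerivAt_id (0 : ℝ)).smul_const v).const_add x
  have hcomp : HasDerivAt (fun t : ℝ => hat h p (x + t • v)) (fderiv ℝ (hat h p) x v) 0 := by
    have hd : HasFDerivAt (hat h p) (fderiv ℝ (hat h p) x) (x + (0 : ℝ) • v) := by
      simpa using hdiff.hasFDerivAt
    exact hd.comp_hasDerivAt 0 hline
  have hpoly : HasDerivAt (fun t : ℝ => hat h p x + (hatDeriv h k p x v * (t - t ^ 2 / 2) +
      hatDeriv h k p (x + v) v * (t ^ 2 / 2))) (hatDeriv h k p x v) 0 := by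
    have h1 : HasDerivAt (fun t : ℝ => t ^ 2 / 2) 0 0 := by
      simpa using (hasDerivAt_pow 2 (0 : ℝ)).div_const 2
    have h2 := (((hasDerivAt_id (0 : ℝ)).sub h1).const_mul (hatDeriv h k p x v)).add
      (h1.const_mul (hatDeriv h k p (x + v) v)) |>.const_add (hat h p x)
    simpa using h2
  have hev2 : (fun t : ℝ => hat h p (x + t • v)) =ᶠ[nhds 0] fun t => hat h p x +
      (hatDeriv h k p x v * (t - t ^ 2 / 2) + hatDeriv h k p (x + v) v * (t ^ 2 / 2)) := by
    have hc : Filter.Tendsto (fun t : ℝ => x + t • v) (nhds 0) (nhds x) := by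
      have : ContinuousAt (fun t : ℝ => x + t • v) 0 := by fun_prop
      simpa [ContinuousAt] using this
    filter_upwards [hc.eventually hcell] with t ht
    exact hat_along_segment hh p (openCell_subset_cell h k hx) ht
  rw [real_inner_comm, gradient, InnerProductSpace.toDual_symm_apply]
  exact hcomp.unique (hpoly.congr_of_eventuallyEq hev2)

lemma inner_starProjection_vectorSpan_pair {a b : Plane} (hab : a ≠ b) (v w : Plane) :
    inner ℝ ((vectorSpan ℝ {a, b}).starProjection v) ((vectorSpan ℝ {a, b}).starProjection w) =
      (‖b - a‖ ^ 2)⁻¹ * (inner ℝ (b - a) v * inner ℝ (b - a) w) := by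
  have hn : ‖b - a‖ ≠ 0 := norm_ne_zero_iff.mpr (sub_ne_zero.mpr hab.symm)
  have hspan : vectorSpan ℝ {a, b} = ℝ ∙ (b - a) := by
    rw [vectorSpan_pair_rev, vsub_eq_sub]
  have hP : ∀ u, (vectorSpan ℝ {a, b}).starProjection u =
      ((inner ℝ (b - a) u) / (‖b - a‖ ^ 2 : ℝ)) • (b - a) := by
    intro u
    simp only [hspan]
    have := Submodule.starProjection_singleton ℝ (v := b - a) u
    simpa using this
  rw [hP, hP, inner_smul_left, inner_smul_right, real_inner_self_eq_norm_sq]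
  simp only [conj_trivial]
  field_simp

/-! ### The stiffness form, cell by cell -/

namespace CutMesh

variable {Γ : LevelSetCurve} {M : CutMesh Γ}

lemma site_injective : Function.Injective M.site := by
  rintro (⟨a, ha⟩ | ⟨a, ha⟩ | ⟨a, ha⟩) (⟨b, hb⟩ | ⟨b, hb⟩ | ⟨b, hb⟩) hab <;>
    simp only [site] at hab <;> subst hab
  · rfl
  · exact absurd ha.2 (not_le.mpr hb.2.1)
  · exact absurd ha.2 (not_le.mpr hb.2.1)
  · exact absurd hb.2 (not_le.mpr ha.2.1)
  · rfl
  · exact absurd ha hb.2.2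
  · exact absurd hb.2 (not_le.mpr ha.2.1)
  · exact absurd hb ha.2.2
  · rfl

lemma exists_site_eq {p : ℤ × ℤ} (hp : p ∈ M.activeVertices) : ∃ i, M.site i = p := by
  by_cases h1 : M.φ (vertex M.h p) ≤ 0
  · exact ⟨Sum.inl ⟨p, hp, h1⟩, rfl⟩
  by_cases h2 : p ∈ M.γ₂
  · exact ⟨Sum.inr (Sum.inl ⟨p, h2⟩), rfl⟩
  · exact ⟨Sum.inr (Sum.inr ⟨p, hp, not_le.mp h1, h2⟩), rfl⟩

lemma sum_site_eq_sum_corners {k : ℤ × ℤ} (hk : k ∈ M.activeCells) {f : ℤ × ℤ → ℝ}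
    (hf : ∀ p ∉ corners k, f p = 0) : ∑ i, f (M.site i) = ∑ p ∈ corners k, f p := by
  classical
  rw [← Finset.sum_image (s := Finset.univ) (g := M.site) (f := f)
    (fun x _ y _ hxy => site_injective hxy)]
  symm
  refine Finset.sum_subset (fun p hp => ?_) (fun p _ hp => hf p hp)
  obtain ⟨i, hi⟩ := exists_site_eq (M := M) (p := p) ⟨k, hk, hp⟩
  exact Finset.mem_image.mpr ⟨i, Finset.mem_univ _, hi⟩

lemma feFun_eq_of_mem_cell {k : ℤ × ℤ} (hk : k ∈ M.activeCells) (U : ℤ × ℤ → ℝ) {x : Plane}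
    (hx : x ∈ cell M.h k) :
    M.feFun (U ∘ M.site) x = ∑ p ∈ corners k, U p * hat M.h p x := by
  rw [← sum_site_eq_sum_corners hk fun p hp => by
    rw [hat_eq_zero_of_notMem_corners M.h_pos hx hp, mul_zero]]
  rfl

variable (M) in
/-- The contribution of a cell to the stiffness form. -/
noncomputable def cellEnergy (u : M.Idx → ℝ) (k : ℤ × ℤ) : ℝ :=
  ∑ i, ∑ j, u i * u j * ∫ x in M.cutSegment k,
    inner ℝ (M.tangentProj k (gradient (hat M.h (M.site i)) x))
      (M.tangentProj k (gradient (hat M.h (M.site j)) x)) ∂(Measure.hausdorffMeasure 1)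

lemma dotProduct_stiffness_mulVec (u : M.Idx → ℝ) :
    u ⬝ᵥ M.stiffness *ᵥ u = ∑ k : M.activeCells, M.cellEnergy u k := by
  simp only [dotProduct, mulVec, stiffness, Matrix.of_apply, curveIntegral, cellEnergy,
    Finset.mul_sum, Finset.sum_mul]
  rw [Finset.sum_comm (s := (Finset.univ : Finset M.activeCells))]
  refine Finset.sum_congr rfl fun i _ => ?_
  rw [Finset.sum_comm (s := (Finset.univ : Finset M.activeCells))]
  refine Finset.sum_congr rfl fun j _ => Finset.sum_congr rfl fun k _ => ?_
  ring

lemma crossings_subset_cell (k : ℤ × ℤ) : M.crossings k ⊆ cell M.h k :=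
  fun _ hx => ((mem_cellBoundary M.h_pos).mp hx.1).1

lemma norm_sub_le_of_mem_cell {h : ℝ} {k : ℤ × ℤ} {a b : Plane} (ha : a ∈ cell h k)
    (hb : b ∈ cell h k) : ‖b - a‖ ≤ 2 * h := by
  refine (norm_plane_le _).trans ?_
  obtain ⟨⟨h1, h2⟩, h3, h4⟩ := ha
  obtain ⟨⟨h5, h6⟩, h7, h8⟩ := hb
  simp only [PiLp.sub_apply]
  have e1 : |b 0 - a 0| ≤ h := abs_le.mpr ⟨by linarith, by linarith⟩
  have e2 : |b 1 - a 1| ≤ h := abs_le.mpr ⟨by linarith, by linarith⟩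
  linarith

lemma integral_affine_mul_affine (α β α' β' : ℝ) :
    ∫ t in (0 : ℝ)..1, (α + t * (β - α)) * (α' + t * (β' - α')) =
      (2 * α * α' + α * β' + β * α' + 2 * β * β') / 6 := by
  have h : ∀ t ∈ Set.uIcc (0 : ℝ) 1, HasDerivAt (fun t : ℝ => α * α' * t +
      (α * (β' - α') + (β - α) * α') * (t ^ 2 / 2) + (β - α) * (β' - α') * (t ^ 3 / 3))
      ((α + t * (β - α)) * (α' + t * (β' - α'))) t := by
    intro t _
    have h2 : HasDerivAt (fun t : ℝ => t ^ 2 / 2) t t := by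
      simpa using (hasDerivAt_pow 2 t).div_const 2
    have h3 : HasDerivAt (fun t : ℝ => t ^ 3 / 3) (t ^ 2) t := by
      simpa using (hasDerivAt_pow 3 t).div_const 3
    have := (((hasDerivAt_id t).const_mul (α * α')).add
      (h2.const_mul (α * (β' - α') + (β - α) * α'))).add (h3.const_mul ((β - α) * (β' - α')))
    exact this.congr_deriv (by ring)
  rw [intervalIntegral.integral_eq_sub_of_hasDerivAt h
    (Continuous.intervalIntegrable (by fun_prop) _ _)]
  ring

/-- The nodal derivative functional at a point of a cell. -/
noncomputable def nodalDeriv (h : ℝ) (k : ℤ × ℤ) (U : ℤ × ℤ → ℝ) (x v : Plane) : ℝ :=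
  ∑ p ∈ corners k, U p * hatDeriv h k p x v

variable {k : ℤ × ℤ} {a b : Plane}

/-- On the chord the tangential derivative is `‖b - a‖⁻¹` times an affine function of the parameter,
whose square integrates to the stated form in the end-point values. Length contributes a factor `‖b
- a‖`, the two projections `‖b - a‖⁻²`. -/
lemma cellEnergy_eq (hk : k ∈ M.activeCells) (hcr : M.crossings k = {a, b}) (hab : a ≠ b)
    (hint : ∀ t : ℝ, 0 < t → t < 1 → a + t • (b - a) ∈ openCell M.h k) (U : ℤ × ℤ → ℝ) :
    M.cellEnergy (U ∘ M.site) k = ‖b - a‖⁻¹ * ((nodalDeriv M.h k U a (b - a) ^ 2 +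
      nodalDeriv M.h k U a (b - a) * nodalDeriv M.h k U b (b - a) +
      nodalDeriv M.h k U b (b - a) ^ 2) / 3) := by
  have hseg : M.cutSegment k = segment ℝ a b := by rw [cutSegment, hcr, convexHull_pair]
  have hn : ‖b - a‖ ≠ 0 := norm_ne_zero_iff.mpr (sub_ne_zero.mpr hab.symm)
  have hI : ∀ p q, ∫ x in M.cutSegment k, inner ℝ (M.tangentProj k (gradient (hat M.h p) x))
      (M.tangentProj k (gradient (hat M.h q) x)) ∂(Measure.hausdorffMeasure 1) =
      ‖b - a‖⁻¹ * ((2 * hatDeriv M.h k p a (b - a) * hatDeriv M.h k q a (b - a) +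
        hatDeriv M.h k p a (b - a) * hatDeriv M.h k q b (b - a) +
        hatDeriv M.h k p b (b - a) * hatDeriv M.h k q a (b - a) +
        2 * hatDeriv M.h k p b (b - a) * hatDeriv M.h k q b (b - a)) / 6) := by
    intro p q
    rw [hseg, integral_hausdorff_segment hab, ← integral_affine_mul_affine]
    have : ∫ t in (0 : ℝ)..1, inner ℝ
        (M.tangentProj k (gradient (hat M.h p) (a + t • (b - a))))
        (M.tangentProj k (gradient (hat M.h q) (a + t • (b - a)))) =
        ∫ t in (0 : ℝ)..1, (‖b - a‖ ^ 2)⁻¹ * ((hatDeriv M.h k p a (b - a) +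
          t * (hatDeriv M.h k p b (b - a) - hatDeriv M.h k p a (b - a))) *
          (hatDeriv M.h k q a (b - a) +
          t * (hatDeriv M.h k q b (b - a) - hatDeriv M.h k q a (b - a)))) := by
      -- The end points, where the gradient of the basis functions may not exist, are discarded.
      rw [intervalIntegral.integral_of_le zero_le_one, intervalIntegral.integral_of_le zero_le_one,
        integral_Ioc_eq_integral_Ioo, integral_Ioc_eq_integral_Ioo]
      refine setIntegral_congr_fun measurableSet_Ioo fun t ht => ?_
      have hx := hint t ht.1 ht.2
      have hb : a + (b - a) = b := by abel
      have e1 := hatDeriv_affine M.h k p a (b - a) t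
      have e2 := hatDeriv_affine M.h k q a (b - a) t
      rw [hb] at e1 e2
      simp only [tangentProj, hcr]
      rw [inner_starProjection_vectorSpan_pair hab, inner_gradient_hat M.h_pos p hx,
        inner_gradient_hat M.h_pos q hx, e1, e2]
    rw [this, intervalIntegral.integral_const_mul, ← mul_assoc]
    congr 1
    field_simp
  simp only [cellEnergy, hI, Function.comp_apply]
  have hsum : ∀ x, nodalDeriv M.h k U x (b - a) =
      ∑ i, U (M.site i) * hatDeriv M.h k (M.site i) x (b - a) := fun x =>
    (sum_site_eq_sum_corners hk fun p hp => by
      rw [hatDeriv_eq_zero_of_notMem_corners _ hp, mul_zero]).symm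
  have hprod : ∀ x y, nodalDeriv M.h k U x (b - a) * nodalDeriv M.h k U y (b - a) =
      ∑ i, ∑ j, (U (M.site i) * hatDeriv M.h k (M.site i) x (b - a)) *
        (U (M.site j) * hatDeriv M.h k (M.site j) y (b - a)) := fun x y => by
    rw [hsum, hsum, Finset.sum_mul_sum]
  have e : nodalDeriv M.h k U a (b - a) ^ 2 +
      nodalDeriv M.h k U a (b - a) * nodalDeriv M.h k U b (b - a) +
      nodalDeriv M.h k U b (b - a) ^ 2 =
      (2 * (nodalDeriv M.h k U a (b - a) * nodalDeriv M.h k U a (b - a)) +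
      nodalDeriv M.h k U a (b - a) * nodalDeriv M.h k U b (b - a) +
      nodalDeriv M.h k U b (b - a) * nodalDeriv M.h k U a (b - a) +
      2 * (nodalDeriv M.h k U b (b - a) * nodalDeriv M.h k U b (b - a))) / 2 := by ring
  rw [e]
  simp only [hprod, Finset.mul_sum, ← Finset.sum_add_distrib, Finset.sum_div]
  refine Finset.sum_congr rfl fun i _ => Finset.sum_congr rfl fun j _ => ?_
  ring

lemma feFun_along_segment (hk : k ∈ M.activeCells) (hcr : M.crossings k = {a, b})
    (U : ℤ × ℤ → ℝ) {t : ℝ} (ht : 0 ≤ t ∧ t ≤ 1) :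
    M.feFun (U ∘ M.site) (a + t • (b - a)) = M.feFun (U ∘ M.site) a +
      (nodalDeriv M.h k U a (b - a) * (t - t ^ 2 / 2) +
        nodalDeriv M.h k U b (b - a) * (t ^ 2 / 2)) := by
  have ha : a ∈ cell M.h k := crossings_subset_cell k (by simp [hcr])
  have hb : b ∈ cell M.h k := crossings_subset_cell k (by simp [hcr])
  have hx : a + t • (b - a) ∈ cell M.h k :=
    (convex_cell _ _).add_smul_sub_mem ha hb ht
  rw [feFun_eq_of_mem_cell hk U hx, feFun_eq_of_mem_cell hk U ha, nodalDeriv, nodalDeriv,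
    Finset.sum_mul, Finset.sum_mul, ← Finset.sum_add_distrib, ← Finset.sum_add_distrib]
  refine Finset.sum_congr rfl fun p _ => ?_
  have := hat_along_segment M.h_pos p ha hx
  rw [add_sub_cancel] at this
  rw [this]
  ring

lemma nodalDeriv_sq_le {x : Plane} (hx : x ∈ cell M.h k) (U : ℤ × ℤ → ℝ) (v : Plane) :
    nodalDeriv M.h k U x v ^ 2 ≤ 16 * (‖v‖ / M.h) ^ 2 * ∑ p ∈ corners k, U p ^ 2 := by
  have hcard : ((corners k).card : ℝ) ≤ 4 := by exact_mod_cast Finset.card_le_four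
  calc nodalDeriv M.h k U x v ^ 2
      ≤ (corners k).card * ∑ p ∈ corners k, (U p * hatDeriv M.h k p x v) ^ 2 :=
        sq_sum_le_card_mul_sum_sq
    _ ≤ 4 * ∑ p ∈ corners k, (2 * ‖v‖ / M.h) ^ 2 * U p ^ 2 := by
        gcongr with p hp
        rw [mul_pow, mul_comm]
        gcongr ?_ * _
        rw [← sq_abs (hatDeriv _ _ _ _ _)]
        exact pow_le_pow_left₀ (abs_nonneg _) (abs_hatDeriv_le M.h_pos p hx v) 2
    _ = _ := by
        rw [← Finset.mul_sum]
        ring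

/-- In each active cell, the cell energy controls the oscillation and is controlled by the nodal
values. -/
lemma NondegenerateCut.cellEnergy_estimates (hM : M.NondegenerateCut) (hch : M.HasCharts)
    (hk : k ∈ M.activeCells) (U : ℤ × ℤ → ℝ) :
    (∀ x ∈ M.cutSegment k, ∀ y ∈ M.cutSegment k,
      (M.feFun (U ∘ M.site) x - M.feFun (U ∘ M.site) y) ^ 2 ≤
        24 * M.h * M.cellEnergy (U ∘ M.site) k) ∧
    M.cellEnergy (U ∘ M.site) k ≤ 32 / M.h * ∑ p ∈ corners k, U p ^ 2 := by
  have hh := M.h_pos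
  obtain ⟨a, b, hcr, -, hint⟩ := hM.exists_crossings hch hk
  by_cases hab : a = b
  · subst hab
    have hseg : M.cutSegment k = {a} := by
      rw [cutSegment, hcr, Set.pair_eq_singleton, convexHull_singleton]
    have hE : M.cellEnergy (U ∘ M.site) k = 0 := by
      have := Measure.nullSingletonClass_hausdorff Plane one_pos
      have h0 : (Measure.hausdorffMeasure 1 : Measure Plane).restrict {a} = 0 :=
        Measure.restrict_eq_zero.mpr (measure_singleton a)
      simp [cellEnergy, hseg, h0]
    rw [hE, hseg]
    refine ⟨?_, by positivity⟩
    rintro x rfl y rfl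
    simp
  have ha : a ∈ cell M.h k := crossings_subset_cell k (by simp [hcr])
  have hb : b ∈ cell M.h k := crossings_subset_cell k (by simp [hcr])
  have hv := norm_sub_le_of_mem_cell ha hb
  have hvpos : 0 < ‖b - a‖ := norm_pos_iff.mpr (sub_ne_zero.mpr (Ne.symm hab))
  rw [cellEnergy_eq hk hcr hab (hint hab)]
  have hA := nodalDeriv_sq_le ha U (b - a)
  have hB := nodalDeriv_sq_le hb U (b - a)
  have hpar := fun t ht => feFun_along_segment hk hcr U (t := t) ht
  set A := nodalDeriv M.h k U a (b - a)
  set B := nodalDeriv M.h k U b (b - a)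
  set S := ∑ p ∈ corners k, U p ^ 2
  set ℓ := ‖b - a‖
  constructor
  · have hseg : M.cutSegment k = segment ℝ a b := by rw [cutSegment, hcr, convexHull_pair]
    rw [hseg, segment_eq_image']
    rintro _ ⟨s, hs, rfl⟩ _ ⟨t, ht, rfl⟩
    simp only [hpar s hs, hpar t ht]
    have h1 : ∀ r : ℝ, 0 ≤ r ∧ r ≤ 1 → |A * (r - r ^ 2 / 2) + B * (r ^ 2 / 2)| ≤
        (|A| + |B|) / 2 := by
      intro r hr
      refine (abs_add_le _ _).trans ?_
      rw [abs_mul, abs_mul, abs_of_nonneg (by nlinarith [hr.1, hr.2] : 0 ≤ r - r ^ 2 / 2),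
        abs_of_nonneg (by positivity : 0 ≤ r ^ 2 / 2)]
      have e1 : |A| * (r - r ^ 2 / 2) ≤ |A| * (1 / 2) :=
        mul_le_mul_of_nonneg_left (by nlinarith [sq_nonneg (r - 1)]) (abs_nonneg _)
      have e2 : |B| * (r ^ 2 / 2) ≤ |B| * (1 / 2) :=
        mul_le_mul_of_nonneg_left (by nlinarith [hr.1, hr.2]) (abs_nonneg _)
      linarith
    have h2 := h1 s hs
    have h3 := h1 t ht
    set X := A * (s - s ^ 2 / 2) + B * (s ^ 2 / 2)
    set Y := A * (t - t ^ 2 / 2) + B * (t ^ 2 / 2)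
    have h4 : |X - Y| ≤ |A| + |B| := (abs_sub _ _).trans (by linarith)
    have h5 : (X - Y) ^ 2 ≤ (|A| + |B|) ^ 2 := by
      rw [← sq_abs]
      exact pow_le_pow_left₀ (abs_nonneg _) h4 2
    have h6 : (|A| + |B|) ^ 2 ≤ 2 * (A ^ 2 + B ^ 2) := by
      have := sq_nonneg (|A| - |B|)
      rw [← sq_abs A, ← sq_abs B]
      linarith
    -- The form `A² + AB + B²` is uniformly definite, so the energy controls both end-point
    -- derivatives. With `ℓ ≤ 2 h` this gives `24 = 12 · 2`.
    have h7 : 2 * (A ^ 2 + B ^ 2) ≤ 12 * ((A ^ 2 + A * B + B ^ 2) / 3) := by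
      nlinarith [sq_nonneg (A + B)]
    have h8 : 0 ≤ (A ^ 2 + A * B + B ^ 2) / 3 := by nlinarith [sq_nonneg (A + B)]
    have h9 : 1 ≤ 2 * M.h * ℓ⁻¹ := by
      rw [← div_eq_mul_inv, le_div_iff₀ hvpos]; linarith
    have h10 := mul_le_mul_of_nonneg_right h9 h8
    have e : M.feFun (U ∘ M.site) a + X - (M.feFun (U ∘ M.site) a + Y) = X - Y := by ring
    rw [e]
    linarith
  -- The squared derivatives carry `(ℓ/h)²` against the single `ℓ⁻¹` of the energy, so short chords
  -- do no harm.
  · have h1 : (A ^ 2 + A * B + B ^ 2) / 3 ≤ 16 * (ℓ / M.h) ^ 2 * S := by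
      nlinarith [sq_nonneg (A - B)]
    have hS : 0 ≤ S := by positivity
    calc ℓ⁻¹ * ((A ^ 2 + A * B + B ^ 2) / 3) ≤ ℓ⁻¹ * (16 * (ℓ / M.h) ^ 2 * S) := by gcongr
      _ = 16 / M.h * (ℓ / M.h) * S := by field_simp
      _ ≤ 16 / M.h * 2 * S := by
          gcongr
          rw [div_le_iff₀ hh]; exact hv
      _ = _ := by ring

end CutMesh

namespace CutMesh

variable {Γ : LevelSetCurve} {M : CutMesh Γ}

/-! ### Oscillation along the discrete curve -/

variable (M) in
/-- Two active cells are linked if their discrete curve segments share an end point. -/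
def cellGraph : SimpleGraph M.activeCells where
  Adj k k' := k ≠ k' ∧ (M.crossings k ∩ M.crossings k').Nonempty
  symm := ⟨fun _ _ h => ⟨h.1.symm, by rw [Set.inter_comm]; exact h.2⟩⟩
  loopless := ⟨fun _ h => h.1 rfl⟩

/-- Otherwise the reachable and the unreachable active cells form two closed sets covering the
connected curve. They share a point of the curve, which lies on the boundary of a cell of each kind
and so links them. -/
lemma cellGraph_reachable (k k' : M.activeCells) : M.cellGraph.Reachable k k' := by
  classical
  by_contra hcon
  have hh := M.h_pos
  have hclosed : ∀ p : M.activeCells → Prop,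
      IsClosed (⋃ j ∈ {j | p j}, cell M.h (j : M.activeCells)) := fun p =>
    (Set.toFinite _).isClosed_biUnion fun j _ => isClosed_cell _ _
  have hcover : M.curve ⊆ (⋃ j ∈ {j | M.cellGraph.Reachable k j}, cell M.h (j : M.activeCells)) ∪
      ⋃ j ∈ {j | ¬ M.cellGraph.Reachable k j}, cell M.h (j : M.activeCells) := by
    intro z hz
    obtain ⟨j, hj⟩ := exists_mem_cell hh z
    have hja : j ∈ M.activeCells := ⟨z, hz, hj⟩
    by_cases hr : M.cellGraph.Reachable k ⟨j, hja⟩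
    · left
      exact Set.mem_biUnion (x := (⟨j, hja⟩ : M.activeCells)) hr hj
    · right
      exact Set.mem_biUnion (x := (⟨j, hja⟩ : M.activeCells)) hr hj
  obtain ⟨z, hz, hzk⟩ := k.2
  obtain ⟨z', hz', hzk'⟩ := k'.2
  obtain ⟨w, hw, hw1, hw2⟩ := isPreconnected_closed_iff.mp M.isPreconnected_curve _ _
    (hclosed _) (hclosed _) hcover
    ⟨z, hz, Set.mem_biUnion (x := k) (SimpleGraph.Reachable.refl k) hzk⟩
    ⟨z', hz', Set.mem_biUnion (x := k') hcon hzk'⟩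
  simp only [Set.mem_iUnion, Set.mem_ofPred_eq, exists_prop] at hw1 hw2
  obtain ⟨i, hi, hwi⟩ := hw1
  obtain ⟨j, hj, hwj⟩ := hw2
  have hij : i ≠ j := fun h => hj (h ▸ hi)
  have hij' : (i : ℤ × ℤ) ≠ j := fun h => hij (Subtype.ext h)
  have hadj : M.cellGraph.Adj i j := ⟨hij, w,
    ⟨mem_cellBoundary_of_mem_two_cells hh hij' hwi hwj, hw⟩,
    ⟨mem_cellBoundary_of_mem_two_cells hh hij'.symm hwj hwi, hw⟩⟩
  exact hj (hi.trans hadj.reachable)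

/-- A function on the discrete curve oscillates at most by the sum of its oscillations on the
segments. -/
lemma abs_sub_le_sum_of_oscillation {f : Plane → ℝ} {o : M.activeCells → ℝ}
    (ho : ∀ k : M.activeCells, ∀ x ∈ M.cutSegment k, ∀ y ∈ M.cutSegment k, |f x - f y| ≤ o k)
    (ho0 : ∀ k, 0 ≤ o k)
    {k k' : M.activeCells} {x y : Plane} (hx : x ∈ M.cutSegment k) (hy : y ∈ M.cutSegment k') :
    |f x - f y| ≤ ∑ j, o j := by
  classical
  have key : ∀ {k k' : M.activeCells} (p : M.cellGraph.Walk k k') (x y : Plane),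
      x ∈ M.cutSegment k → y ∈ M.cutSegment k' → |f x - f y| ≤ (p.support.map o).sum := by
    intro k k' p
    induction p with
    | nil =>
      intro x y hx hy
      simpa using ho _ x hx y hy
    | cons hadj p ih =>
      intro x y hx hy
      have hadj' := hadj
      obtain ⟨-, z, hz1, hz2⟩ := hadj'
      have h1 := ho _ x hx z (subset_convexHull ℝ _ hz1)
      have h2 := ih z y (subset_convexHull ℝ _ hz2) hy
      rw [SimpleGraph.Walk.support_cons, List.map_cons, List.sum_cons]
      exact (abs_sub_le _ _ _).trans (add_le_add h1 h2)
  -- A path visits each cell at most once, so the oscillations along it add up to at most the full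
  -- sum.
  obtain ⟨p, hp⟩ := (cellGraph_reachable k k').exists_isPath
  refine (key p x y hx hy).trans ?_
  rw [← List.sum_toFinset o hp.support_nodup]
  exact Finset.sum_le_univ_sum_of_nonneg ho0

lemma continuous_feFun (u : M.Idx → ℝ) : Continuous (M.feFun u) := by
  unfold feFun hat
  fun_prop

/-- Here `ℓ` is the length of the segment. A segment of length zero means that the curve meets the
cell in one point only, so the total length is positive because the curve is infinite. -/
lemma NondegenerateCut.exists_length (hM : M.NondegenerateCut) (hch : M.HasCharts)
    (k : M.activeCells) : ∃ ℓ : ℝ, 0 ≤ ℓ ∧ (ℓ = 0 → (M.curve ∩ cell M.h k).Finite) ∧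
      ∀ f : Plane → ℝ, Continuous f → ∀ lo hi : ℝ, (∀ x ∈ M.cutSegment k, lo ≤ f x ∧ f x ≤ hi) →
        lo * ℓ ≤ ∫ x in M.cutSegment k, f x ∂(Measure.hausdorffMeasure 1) ∧
        ∫ x in M.cutSegment k, f x ∂(Measure.hausdorffMeasure 1) ≤ hi * ℓ := by
  obtain ⟨a, b, hcr, heq, -⟩ := hM.exists_crossings hch k.2
  by_cases hab : a = b
  · refine ⟨0, le_rfl, fun _ => by rw [heq hab]; exact Set.finite_singleton _, ?_⟩
    subst hab
    have hseg : M.cutSegment k = {a} := by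
      rw [cutSegment, hcr, Set.pair_eq_singleton, convexHull_singleton]
    have := Measure.nullSingletonClass_hausdorff Plane one_pos
    have h0 : (Measure.hausdorffMeasure 1 : Measure Plane).restrict {a} = 0 :=
      Measure.restrict_eq_zero.mpr (measure_singleton a)
    intro f _ lo hi _
    simp [hseg, h0]
  · have hvpos : 0 < ‖b - a‖ := norm_pos_iff.mpr (sub_ne_zero.mpr (Ne.symm hab))
    refine ⟨‖b - a‖, norm_nonneg _, fun h => absurd h hvpos.ne', fun f hf lo hi hb => ?_⟩
    have hseg : M.cutSegment k = segment ℝ a b := by rw [cutSegment, hcr, convexHull_pair]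
    rw [hseg] at hb ⊢
    rw [integral_hausdorff_segment hab]
    have hmem : ∀ t ∈ Set.Icc (0 : ℝ) 1, a + t • (b - a) ∈ segment ℝ a b := fun t ht => by
      rw [segment_eq_image']
      exact Set.mem_image_of_mem _ ht
    have hfi : IntervalIntegrable (fun t : ℝ => f (a + t • (b - a))) volume 0 1 :=
      Continuous.intervalIntegrable (by fun_prop) _ _
    have h1 := intervalIntegral.integral_mono_on (μ := volume) zero_le_one
      (intervalIntegrable_const (c := lo)) hfi fun t ht => (hb _ (hmem t ht)).1
    have h2 := intervalIntegral.integral_mono_on (μ := volume) zero_le_one hfi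
      (intervalIntegrable_const (c := hi)) fun t ht => (hb _ (hmem t ht)).2
    simp only [intervalIntegral.integral_const, sub_zero, one_smul] at h1 h2
    constructor
    · rw [mul_comm]; gcongr
    · rw [mul_comm hi]; gcongr

/-- A function with vanishing mean on the discrete curve is bounded by its oscillation. -/
lemma NondegenerateCut.abs_le_of_mean_zero (hM : M.NondegenerateCut) (hch : M.HasCharts)
    {f : Plane → ℝ} (hf : Continuous f) (hmean : M.curveIntegral (fun _ x => f x) = 0) {D : ℝ}
    (hD : ∀ k k' : M.activeCells, ∀ x ∈ M.cutSegment k, ∀ y ∈ M.cutSegment k', |f x - f y| ≤ D)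
    {k : M.activeCells} {x : Plane} (hx : x ∈ M.cutSegment k) : |f x| ≤ D := by
  choose ℓ hℓ0 hℓ hint using hM.exists_length hch
  have hpos : 0 < ∑ j, ℓ j := by
    refine lt_of_le_of_ne (Finset.sum_nonneg fun j _ => hℓ0 j) fun h => ?_
    have hz := (Finset.sum_eq_zero_iff_of_nonneg fun j _ => hℓ0 j).mp h.symm
    refine M.infinite_curve ((Set.finite_iUnion fun j => hℓ j (hz j (Finset.mem_univ _))).subset
      fun z hz => ?_)
    obtain ⟨j, hj⟩ := exists_mem_cell M.h_pos z
    exact Set.mem_iUnion.mpr ⟨⟨j, z, hz, hj⟩, hz, hj⟩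
  have hb : ∀ j : M.activeCells, ∀ y ∈ M.cutSegment j, f x - D ≤ f y ∧ f y ≤ f x + D := by
    intro j y hy
    have := abs_le.mp (hD k j x hx y hy)
    constructor <;> linarith [this.1, this.2]
  have h1 : (f x - D) * ∑ j, ℓ j ≤ 0 := by
    rw [← hmean, curveIntegral, Finset.mul_sum]
    exact Finset.sum_le_sum fun j _ => (hint j f hf _ _ (hb j)).1
  have h2 : 0 ≤ (f x + D) * ∑ j, ℓ j := by
    rw [← hmean, curveIntegral, Finset.mul_sum]
    exact Finset.sum_le_sum fun j _ => (hint j f hf _ _ (hb j)).2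
  rw [abs_le]
  constructor
  · have := nonneg_of_mul_nonneg_left h2 hpos; linarith
  · have := nonpos_of_mul_nonpos_left h1 hpos; linarith

/-- Discrete Poincaré inequality: the maximum norm on the discrete curve of a finite element
function with vanishing mean is controlled by its energy. -/
lemma NondegenerateCut.sq_feFun_le (hM : M.NondegenerateCut) (hch : M.HasCharts)
    (U : ℤ × ℤ → ℝ)
    (hmean : M.curveIntegral (fun _ x => M.feFun (U ∘ M.site) x) = 0)
    {k : M.activeCells} {x : Plane} (hx : x ∈ M.cutSegment k) :
    M.feFun (U ∘ M.site) x ^ 2 ≤ 24 * (M.h * Fintype.card M.activeCells) *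
      ((U ∘ M.site) ⬝ᵥ M.stiffness *ᵥ (U ∘ M.site)) := by
  have hest := fun j : M.activeCells => (hM.cellEnergy_estimates hch j.2 U).1
  set f := M.feFun (U ∘ M.site)
  have h1 := hM.abs_le_of_mean_zero hch (continuous_feFun _) hmean
    (fun k k' x hx y hy => abs_sub_le_sum_of_oscillation
      (o := fun j => √(24 * M.h * M.cellEnergy (U ∘ M.site) j))
      (fun j x hx y hy => Real.abs_le_sqrt (hest j x hx y hy)) (fun _ => Real.sqrt_nonneg _)
      hx hy) hx
  have hE : ∀ j : M.activeCells, 0 ≤ 24 * M.h * M.cellEnergy (U ∘ M.site) j := fun j => by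
    obtain ⟨a, b, hcr, -⟩ := hM.exists_crossings hch j.2
    have ha : a ∈ M.cutSegment j := subset_convexHull ℝ _ (by simp [hcr])
    exact (sq_nonneg _).trans (hest j a ha a ha)
  calc f x ^ 2 ≤ (∑ j, √(24 * M.h * M.cellEnergy (U ∘ M.site) (j : M.activeCells))) ^ 2 := by
        rw [← sq_abs]
        exact pow_le_pow_left₀ (abs_nonneg _) h1 2
    _ ≤ Fintype.card M.activeCells *
        ∑ j, √(24 * M.h * M.cellEnergy (U ∘ M.site) (j : M.activeCells)) ^ 2 :=
        sq_sum_le_card_mul_sum_sq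
    _ = _ := by
        rw [dotProduct_stiffness_mulVec]
        simp only [Real.sq_sqrt (hE _)]
        rw [← Finset.mul_sum]
        ring

/-! ### The number of active cells -/

/-- A Lipschitz parametrization maps each of about `1/h` parameter intervals to a set of diameter at
most `K h`, which meets boundedly many cells. -/
lemma exists_card_activeCells_le (Γ : LevelSetCurve) : ∃ C > (0 : ℝ), ∀ M : CutMesh Γ, M.h ≤ 1 →
    M.h * Fintype.card M.activeCells ≤ C := by
  classical
  obtain ⟨c, hc, hper, -, -, hr⟩ := Γ.simple_closed
  obtain ⟨K, hK⟩ := (hc.contDiffOn (s := Set.Icc (0 : ℝ) 1)).exists_lipschitzOnWith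
    (by norm_num) (convex_Icc 0 1) isCompact_Icc
  -- The points move by at most `K` lattice units, and the position inside a cell costs one more.
  set m : ℤ := ⌈(K : ℝ)⌉ + 1 with hm
  refine ⟨2 * ((2 * m + 1 : ℤ).toNat : ℝ) ^ 2 + 1, by positivity, fun M hM => ?_⟩
  have hh := M.h_pos
  have hpt : ∀ k : M.activeCells, ∃ z ∈ cell M.h k, ∃ t ∈ Set.Ico (0 : ℝ) 1, M.pos z = c t := by
    rintro ⟨k, z, hz, hzk⟩
    have : M.pos z ∈ Set.range c := by rw [hr]; exact hz
    obtain ⟨s, hs⟩ := this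
    obtain ⟨t, ht, hst⟩ := hper.exists_mem_Ico₀ one_pos s
    exact ⟨z, hzk, t, ht, by rw [← hst, hs]⟩
  choose z hzk t ht hzt using hpt
  set n := ⌈1 / M.h⌉₊ with hn
  have hn1 : 1 / M.h ≤ n := Nat.le_ceil _
  have hn2 : (n : ℝ) < 1 / M.h + 1 := Nat.ceil_lt_add_one (by positivity)
  have hnpos : (0 : ℝ) < n := lt_of_lt_of_le (by positivity) hn1
  have hfib : ∀ i ∈ Finset.range n,
      (Finset.univ.filter fun k : M.activeCells => ⌊t k * n⌋₊ = i).card ≤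
        (2 * m + 1 : ℤ).toNat ^ 2 := by
    intro i _
    rcases (Finset.univ.filter fun k : M.activeCells => ⌊t k * n⌋₊ = i).eq_empty_or_nonempty with
      hemp | ⟨k₀, hk₀⟩
    · rw [hemp]; simp
    have hcard : (Finset.Icc (k₀.1.1 - m) (k₀.1.1 + m) ×ˢ
        Finset.Icc (k₀.1.2 - m) (k₀.1.2 + m)).card = (2 * m + 1 : ℤ).toNat ^ 2 := by
      rw [Finset.card_product, Int.card_Icc, Int.card_Icc, sq]
      congr 2 <;> ring
    rw [← hcard]
    refine Finset.card_le_card_of_injOn (fun k => (k : ℤ × ℤ)) ?_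
      (fun _ _ _ _ h => Subtype.ext h)
    intro k hk
    simp only [Finset.coe_filter, Finset.mem_univ, true_and, Set.mem_ofPred_eq,
      Finset.mem_filter] at hk hk₀
    have htt : |t k - t k₀| ≤ M.h := by
      have a1 := Nat.floor_le (mul_nonneg (ht k).1 hnpos.le)
      have a2 := Nat.lt_floor_add_one (t k * n)
      have a3 := Nat.floor_le (mul_nonneg (ht k₀).1 hnpos.le)
      have a4 := Nat.lt_floor_add_one (t k₀ * n)
      rw [hk] at a1 a2
      rw [hk₀] at a3 a4
      have a5 : |t k - t k₀| * n ≤ 1 := by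
        rw [← abs_of_pos hnpos, ← abs_mul]
        exact abs_le.mpr ⟨by linarith, by linarith⟩
      have a6 : |t k - t k₀| ≤ 1 / n := by rwa [le_div_iff₀ hnpos]
      refine a6.trans ?_
      rw [div_le_iff₀ hnpos]
      rw [div_le_iff₀ hh] at hn1
      linarith
    have hdist : ‖z k - z k₀‖ ≤ K * M.h := by
      rw [← dist_eq_norm, ← M.pos.dist_map, hzt, hzt]
      refine (hK.dist_le_mul _ ⟨(ht k).1, (ht k).2.le⟩ _ ⟨(ht k₀).1, (ht k₀).2.le⟩).trans ?_
      rw [Real.dist_eq]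
      gcongr
    have key : ∀ (a b : ℤ) (s r : ℝ), M.h * a ≤ s → s ≤ M.h * (a + 1) → M.h * b ≤ r →
        r ≤ M.h * (b + 1) → |s - r| ≤ K * M.h → a ∈ Finset.Icc (b - m) (b + m) := by
      intro a b s r h1 h2 h3 h4 h5
      obtain ⟨h6, h7⟩ := abs_le.mp h5
      have h8 : (K : ℝ) ≤ ⌈(K : ℝ)⌉ := Int.le_ceil _
      have h9 : (a : ℝ) ≤ b + m := by
        rw [hm]; push_cast
        by_contra hcon
        push Not at hcon
        nlinarith
      have h10 : (b : ℝ) - m ≤ a := by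
        rw [hm]; push_cast
        by_contra hcon
        push Not at hcon
        nlinarith
      rw [Finset.mem_Icc]
      exact ⟨by exact_mod_cast h10, by exact_mod_cast h9⟩
    have hcoord : ∀ i : Fin 2, |z k i - z k₀ i| ≤ K * M.h := fun i =>
      (PiLp.norm_apply_le (z k - z k₀) i).trans hdist
    have hb := hzk k
    have hb₀ := hzk k₀
    simp only [Finset.coe_product, Set.mem_prod, Finset.mem_coe]
    exact ⟨key _ _ _ _ hb.1.1 hb.1.2 hb₀.1.1 hb₀.1.2 (hcoord 0),
      key _ _ _ _ hb.2.1 hb.2.2 hb₀.2.1 hb₀.2.2 (hcoord 1)⟩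
  have hcount := Finset.card_le_mul_card_image_of_maps_to
    (s := (Finset.univ : Finset M.activeCells)) (t := Finset.range n)
    (f := fun k => ⌊t k * n⌋₊) (fun k _ => by
      rw [Finset.mem_range, Nat.floor_lt (mul_nonneg (ht k).1 hnpos.le)]
      nlinarith [(ht k).2]) _ hfib
  rw [Finset.card_range, Finset.card_univ] at hcount
  have hcount' : (Fintype.card M.activeCells : ℝ) ≤ ((2 * m + 1 : ℤ).toNat : ℝ) ^ 2 * n := by
    exact_mod_cast hcount
  have h1 : M.h * n ≤ 2 := by
    have := mul_le_mul_of_nonneg_left hn2.le hh.le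
    have e : M.h * (1 / M.h + 1) = 1 + M.h := by field_simp
    linarith
  calc M.h * Fintype.card M.activeCells
      ≤ M.h * (((2 * m + 1 : ℤ).toNat : ℝ) ^ 2 * n) := by gcongr
    _ = ((2 * m + 1 : ℤ).toNat : ℝ) ^ 2 * (M.h * n) := by ring
    _ ≤ ((2 * m + 1 : ℤ).toNat : ℝ) ^ 2 * 2 := by gcongr
    _ ≤ _ := by linarith

end CutMesh

namespace CutMesh

variable {Γ : LevelSetCurve} {M : CutMesh Γ}

/-! ### The interior lattice points -/

lemma finite_setOf_nonpos (M : CutMesh Γ) : {p | M.φ (vertex M.h p) ≤ 0}.Finite := by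
  have hh := M.h_pos
  have hb : Bornology.IsBounded {x | M.φ x ≤ 0} := by
    have h1 : {x | M.φ x ≤ 0} = M.pos ⁻¹' closure {x | Γ.ψ x < 0} := by
      rw [Γ.closure_interior]; rfl
    rw [h1]
    exact M.pos.isometry.antilipschitz.isBounded_preimage Γ.isBounded_interior.closure
  obtain ⟨R, hR⟩ := hb.exists_norm_le
  have key : ∀ a : ℤ, |M.h * a| ≤ R → a ∈ Set.Icc (-⌈R / M.h⌉) ⌈R / M.h⌉ := by
    intro a ha
    rw [abs_mul, abs_of_pos hh] at ha
    have h1 : |(a : ℝ)| ≤ R / M.h := by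
      rw [le_div_iff₀ hh]; linarith
    have h2 := abs_le.mp (h1.trans (Int.le_ceil _))
    exact ⟨by exact_mod_cast h2.1, by exact_mod_cast h2.2⟩
  refine ((Set.finite_Icc (-⌈R / M.h⌉) ⌈R / M.h⌉).prod
    (Set.finite_Icc (-⌈R / M.h⌉) ⌈R / M.h⌉)).subset fun p hp => ⟨key _ ?_, key _ ?_⟩
  · exact (PiLp.norm_apply_le (vertex M.h p) 0).trans (hR _ hp)
  · exact (PiLp.norm_apply_le (vertex M.h p) 1).trans (hR _ hp)

variable (M) in
/-- The mesh vertices at which the level-set function is nonpositive. -/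
noncomputable def innerSites : Finset (ℤ × ℤ) := M.finite_setOf_nonpos.toFinset

@[simp]
lemma mem_innerSites {p : ℤ × ℤ} : p ∈ M.innerSites ↔ M.φ (vertex M.h p) ≤ 0 := by
  simp [innerSites]

lemma notMem_innerSites {p : ℤ × ℤ} : p ∉ M.innerSites ↔ 0 < M.φ (vertex M.h p) := by
  simp

lemma exists_isFrame {e : ℤ × ℤ} (he : e ∈ directions) : ∃ d, IsFrame e d := by
  simp only [directions, Finset.mem_insert, Finset.mem_singleton] at he
  rcases he with rfl | rfl | rfl | rfl
  · exact ⟨(0, 1), by unfold IsFrame; decide⟩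
  · exact ⟨(0, 1), by unfold IsFrame; decide⟩
  · exact ⟨(1, 0), by unfold IsFrame; decide⟩
  · exact ⟨(1, 0), by unfold IsFrame; decide⟩

/-- The point with parameter `t` on the lattice line from `q` in the direction `e`. -/
def edgePt (h : ℝ) (q e : ℤ × ℤ) (t : ℝ) : Plane := !₂[h * (q.1 + t * e.1), h * (q.2 + t * e.2)]

lemma framePt_fst_zero (h : ℝ) (q e d : ℤ × ℤ) (t : ℝ) :
    framePt h q e d t 0 = edgePt h q e t := by
  simp [framePt, edgePt]

lemma framePt_zero_snd (h : ℝ) (q e d : ℤ × ℤ) (t : ℝ) :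
    framePt h q e d 0 t = edgePt h q d t := by
  simp [framePt, edgePt]

lemma framePt_snd_one (h : ℝ) (q e d : ℤ × ℤ) (t : ℝ) :
    framePt h q e d t 1 = edgePt h (q + d) e t := by
  rw [← framePt_fst_zero h (q + d) e d, framePt_shift_snd, zero_add]

lemma framePt_fst_one (h : ℝ) (q e d : ℤ × ℤ) (t : ℝ) :
    framePt h q e d 1 t = edgePt h (q + e) d t := by
  have := framePt_shift h q e d 1 0 0 t
  simp only [one_smul, zero_smul, add_zero, Int.cast_one, Int.cast_zero, zero_add] at this
  rw [← framePt_zero_snd h (q + e) e d, this]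

lemma edgePt_one (h : ℝ) (q e : ℤ × ℤ) : edgePt h q e 1 = vertex h (q + e) := by
  simp [edgePt, vertex]

lemma edgePt_zero (h : ℝ) (q e : ℤ × ℤ) : edgePt h q e 0 = vertex h q := by
  simp [edgePt, vertex]

lemma exists_crossing_parameter {q e : ℤ × ℤ} (he : e ∈ directions) (hq : q ∈ M.innerSites)
    (hqe : q + e ∉ M.innerSites) :
    ∃ t, 0 ≤ t ∧ t < 1 ∧ M.φ (edgePt M.h q e t) = 0 := by
  obtain ⟨d, hf⟩ := exists_isFrame he
  rw [notMem_innerSites, ← edgePt_one] at hqe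
  obtain ⟨t, h0, h1, ht⟩ := M.exists_zero_framePt_fst q e d zero_le_one
    (y := 0) (by rw [framePt_fst_zero, edgePt_zero]; exact mem_innerSites.mp hq)
    (by rwa [framePt_fst_zero])
  rw [framePt_fst_zero] at ht
  refine ⟨t, h0, lt_of_le_of_ne h1 fun h => ?_, ht⟩
  rw [h] at ht
  exact hqe.ne' ht

/-- An edge that leaves the inner set is crossed by the curve, so its end points are active. Hence
the stencil of an inner vertex never reaches an inactive exterior vertex or `γ₃`. -/
lemma boundary_edge_active {q e : ℤ × ℤ} (he : e ∈ directions) (hq : q ∈ M.innerSites)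
    (hqe : q + e ∉ M.innerSites) : q ∈ M.γ₁ ∧ q + e ∈ M.γ₂ := by
  obtain ⟨d, hf⟩ := exists_isFrame he
  obtain ⟨t, h0, h1, ht⟩ := exists_crossing_parameter he hq hqe
  have hk : frameCell q e d ∈ M.activeCells := by
    refine ⟨_, ht, ?_⟩
    rw [← framePt_fst_zero M.h q e d]
    exact (hf.framePt_mem_cell M.h_pos q t 0).mpr ⟨⟨h0, h1.le⟩, le_rfl, zero_le_one⟩
  have hq1 : q ∈ M.γ₁ :=
    ⟨⟨_, hk, by rw [hf.corners_frameCell]; simp⟩, mem_innerSites.mp hq⟩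
  refine ⟨hq1, ⟨_, hk, by rw [hf.corners_frameCell]; simp⟩, notMem_innerSites.mp hqe, q, ?_, hq1⟩
  exact Finset.mem_image.mpr ⟨-e, neg_mem_directions he, by simp⟩

/-! ### The finite element function in a frame -/

lemma hat_framePt {h : ℝ} (hh : 0 < h) {e d : ℤ × ℤ} (hf : IsFrame e d) (q : ℤ × ℤ) (a b : ℤ)
    (x y : ℝ) : hat h (q + a • e + b • d) (framePt h q e d x y) =
      max 0 (1 - |x - a|) * max 0 (1 - |y - b|) := by
  have key : ∀ s t : ℝ, |h * s - h * t| / h = |s - t| := by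
    intro s t
    rw [← mul_sub, abs_mul, abs_of_pos hh, mul_div_cancel_left₀ _ hh.ne']
  simp only [hat, framePt_zero_apply, framePt_one_apply, key]
  rcases hf.cases with ⟨rfl | rfl, rfl | rfl⟩ | ⟨rfl | rfl, rfl | rfl⟩ <;>
    simp <;> ring_nf <;> simp [abs_sub_comm, neg_add_eq_sub] <;> exact mul_comm _ _

lemma feFun_framePt {e d : ℤ × ℤ} (hf : IsFrame e d) {q : ℤ × ℤ}
    (hk : frameCell q e d ∈ M.activeCells) (U : ℤ × ℤ → ℝ) {x y : ℝ} (hx : 0 ≤ x ∧ x ≤ 1)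
    (hy : 0 ≤ y ∧ y ≤ 1) : M.feFun (U ∘ M.site) (framePt M.h q e d x y) =
      (1 - x) * (1 - y) * U q + x * (1 - y) * U (q + e) + (1 - x) * y * U (q + d) +
        x * y * U (q + e + d) := by
  have hh := M.h_pos
  have h00 := hat_framePt hh hf q 0 0 x y
  have h10 := hat_framePt hh hf q 1 0 x y
  have h01 := hat_framePt hh hf q 0 1 x y
  have h11 := hat_framePt hh hf q 1 1 x y
  have m0 : ∀ t : ℝ, 0 ≤ t ∧ t ≤ 1 → max 0 (1 - |t|) = 1 - t := fun t ht => by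
    rw [abs_of_nonneg ht.1, max_eq_right (by linarith [ht.2])]
  have m1 : ∀ t : ℝ, 0 ≤ t ∧ t ≤ 1 → max 0 (1 - |t - 1|) = t := fun t ht => by
    rw [abs_of_nonpos (by linarith [ht.2]), max_eq_right (by linarith [ht.1])]; ring
  simp only [zero_smul, one_smul, add_zero, Int.cast_zero, Int.cast_one, sub_zero, m0 x hx,
    m0 y hy, m1 x hx, m1 y hy] at h00 h10 h01 h11
  rw [feFun_eq_of_mem_cell hk U ((hf.framePt_mem_cell hh q x y).mpr ⟨hx, hy⟩),
    hf.corners_frameCell]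
  rw [Finset.sum_insert, Finset.sum_insert, Finset.sum_insert, Finset.sum_singleton, h00, h10,
    h01, h11]
  · ring
  all_goals
    rcases hf.cases with ⟨rfl | rfl, rfl | rfl⟩ | ⟨rfl | rfl, rfl | rfl⟩ <;>
      simp [Prod.ext_iff]

/-- The mixed second difference of the nodal values in a cell is controlled by the values on the
segment of the discrete curve in that cell. -/
lemma abs_mixed_difference_le {e d : ℤ × ℤ} (hf : IsFrame e d) {q : ℤ × ℤ} (U : ℤ × ℤ → ℝ) {m : ℝ}
    (hm : ∀ k ∈ M.activeCells, ∀ x ∈ M.cutSegment k, |M.feFun (U ∘ M.site) x| ≤ m)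
    {x₁ y₁ x₂ y₂ : ℝ} (hx₁ : 0 ≤ x₁ ∧ x₁ ≤ 1) (hy₁ : 0 ≤ y₁ ∧ y₁ ≤ 1) (hx₂ : 0 ≤ x₂ ∧ x₂ ≤ 1)
    (hy₂ : 0 ≤ y₂ ∧ y₂ ≤ 1) (hb₁ : x₁ = 0 ∨ x₁ = 1 ∨ y₁ = 0 ∨ y₁ = 1)
    (hb₂ : x₂ = 0 ∨ x₂ = 1 ∨ y₂ = 0 ∨ y₂ = 1) (h₁ : M.φ (framePt M.h q e d x₁ y₁) = 0)
    (h₂ : M.φ (framePt M.h q e d x₂ y₂) = 0) :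
    |U q + U (q + e + d) - U (q + e) - U (q + d)| * (|x₁ - x₂| * |y₁ - y₂|) ≤ 8 * m := by
  have hh := M.h_pos
  set k := frameCell q e d
  have c₁ : framePt M.h q e d x₁ y₁ ∈ M.crossings k :=
    ⟨(hf.framePt_mem_cellBoundary hh q _ _).mpr ⟨⟨hx₁, hy₁⟩, hb₁⟩, h₁⟩
  have c₂ : framePt M.h q e d x₂ y₂ ∈ M.crossings k :=
    ⟨(hf.framePt_mem_cellBoundary hh q _ _).mpr ⟨⟨hx₂, hy₂⟩, hb₂⟩, h₂⟩
  have hk : k ∈ M.activeCells := ⟨_, h₁, crossings_subset_cell k c₁⟩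
  have s₁ := subset_convexHull ℝ _ c₁
  have s₂ := subset_convexHull ℝ _ c₂
  have s₃ := (convex_convexHull ℝ (M.crossings k)).add_smul_sub_mem s₁ s₂
    (t := 1 / 2) ⟨by norm_num, by norm_num⟩
  rw [framePt_lineMap] at s₃
  have b₁ := hm k hk _ s₁
  have b₂ := hm k hk _ s₂
  have b₃ := hm k hk _ s₃
  rw [feFun_framePt hf hk U hx₁ hy₁] at b₁
  rw [feFun_framePt hf hk U hx₂ hy₂] at b₂
  rw [feFun_framePt hf hk U ⟨by linarith [hx₁.1, hx₂.1], by linarith [hx₁.2, hx₂.2]⟩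
    ⟨by linarith [hy₁.1, hy₂.1], by linarith [hy₁.2, hy₂.2]⟩] at b₃
  rw [← abs_mul, ← abs_mul]
  rw [abs_le] at b₁ b₂ b₃ ⊢
  -- The trace is quadratic along the chord: the sum of its end values minus twice its midpoint
  -- value equals, up to sign, half the mixed difference times the product of the coordinate
  -- increments. Three values bounded by `m` give `8 m`.
  constructor <;> nlinarith [b₁.1, b₁.2, b₂.1, b₂.2, b₃.1, b₃.2]

/-- The trace of the finite element function at a crossing of the curve with a mesh edge. -/
lemma abs_trace_le {q e : ℤ × ℤ} (he : e ∈ directions) (U : ℤ × ℤ → ℝ) {m : ℝ}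
    (hm : ∀ k ∈ M.activeCells, ∀ x ∈ M.cutSegment k, |M.feFun (U ∘ M.site) x| ≤ m) {t : ℝ}
    (ht0 : 0 ≤ t) (ht1 : t ≤ 1) (ht : M.φ (edgePt M.h q e t) = 0) :
    |(1 - t) * U q + t * U (q + e)| ≤ m := by
  obtain ⟨d, hf⟩ := exists_isFrame he
  have hh := M.h_pos
  rw [← framePt_fst_zero M.h q e d] at ht
  have c : framePt M.h q e d t 0 ∈ M.crossings (frameCell q e d) :=
    ⟨(hf.framePt_mem_cellBoundary hh q _ _).mpr ⟨⟨⟨ht0, ht1⟩, le_rfl, zero_le_one⟩, by simp⟩, ht⟩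
  have hk : frameCell q e d ∈ M.activeCells := ⟨_, ht, crossings_subset_cell _ c⟩
  have := hm _ hk _ (subset_convexHull ℝ _ c)
  rw [feFun_framePt hf hk U ⟨ht0, ht1⟩ ⟨le_rfl, zero_le_one⟩] at this
  simpa using this

end CutMesh

namespace CutMesh

variable {Γ : LevelSetCurve} {M : CutMesh Γ}

/-! ### Local control of the boundary differences -/

/-- Bounds, at the lattice points of `P`, for the differences of `U` along interior mesh edges and
for the differences along boundary edges, the latter weighted by the crossing parameters `θ`,
together with a bound for the trace of `U` on the discrete curve. -/
structure LocalBounds (M : CutMesh Γ) (U : ℤ × ℤ → ℝ) (θ : ℤ × ℤ → ℤ × ℤ → ℝ) (B m : ℝ)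
    (P : Set (ℤ × ℤ)) : Prop where
  B_nonneg : 0 ≤ B
  m_nonneg : 0 ≤ m
  trace : ∀ k ∈ M.activeCells, ∀ x ∈ M.cutSegment k, |M.feFun (U ∘ M.site) x| ≤ m
  crossing : ∀ x ∈ M.innerSites, ∀ a ∈ directions, x + a ∉ M.innerSites →
    0 ≤ θ x a ∧ θ x a < 1 ∧ M.φ (edgePt M.h x a (θ x a)) = 0
  interior : ∀ x ∈ P, x ∈ M.innerSites → ∀ a ∈ directions, x + a ∈ M.innerSites →
    |U (x + a) - U x| ≤ B
  boundary : ∀ x ∈ P, x ∈ M.innerSites → ∀ a ∈ directions, x + a ∉ M.innerSites →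
    θ x a * (U (x + a) - U x) ^ 2 ≤ B ^ 2

lemma framePt_zero_one (h : ℝ) (p e d : ℤ × ℤ) : framePt h p e d 0 1 = vertex h (p + d) := by
  rw [framePt_zero_snd, edgePt_one]

lemma framePt_one_zero (h : ℝ) (p e d : ℤ × ℤ) : framePt h p e d 1 0 = vertex h (p + e) := by
  rw [framePt_fst_zero, edgePt_one]

lemma framePt_zero_two (h : ℝ) (p e d : ℤ × ℤ) : framePt h p e d 0 2 = vertex h (p + d + d) := by
  rw [← framePt_zero_one h (p + d) e d, framePt_shift_snd, one_add_one_eq_two]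

lemma framePt_zero_add_one (h : ℝ) (p e d : ℤ × ℤ) (t : ℝ) :
    framePt h p e d 0 (1 + t) = edgePt h (p + d) d t := by
  rw [← framePt_zero_snd h (p + d) e d, framePt_shift_snd, add_comm]

namespace LocalBounds

variable {U : ℤ × ℤ → ℝ} {θ : ℤ × ℤ → ℤ × ℤ → ℝ} {B m : ℝ} {P : Set (ℤ × ℤ)}

lemma abs_sub_le_of_half_le (hL : M.LocalBounds U θ B m P) {x a : ℤ × ℤ} (hxP : x ∈ P)
    (hx : x ∈ M.innerSites) (ha : a ∈ directions) (hxa : x + a ∉ M.innerSites)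
    (hθ : 1 / 2 ≤ θ x a) : |U (x + a) - U x| ≤ 2 * B := by
  have h1 := hL.boundary x hxP hx a ha hxa
  have h2 := mul_le_mul_of_nonneg_right hθ (sq_nonneg (U (x + a) - U x))
  refine abs_le_of_sq_le_sq ?_ (by linarith [hL.B_nonneg])
  nlinarith [sq_nonneg B]

variable {e d p : ℤ × ℤ} {c σ : ℝ}

/-- Next to a vertical boundary edge with a small crossing parameter, horizontal boundary
differences are controlled. -/
lemma abs_horizontal_le_of_lt_half (hL : M.LocalBounds U θ B m P) (hf : IsFrame e d) (hc : 0 < c)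
    (hG : IsChart (fun x y => c * M.φ (framePt M.h p e d x y)) σ) (hpP : p ∈ P)
    (hsP : p + e ∈ P) (hp : p ∈ M.innerSites)
    (hq : p + d ∈ M.innerSites) (hqd : p + d + d ∉ M.innerSites) (hθ : θ (p + d) d < 1 / 2)
    (hqe : p + e + d ∉ M.innerSites) : |U (p + e + d) - U (p + d)| ≤ 4 * B + 40 * m := by
  have hB := hL.B_nonneg
  have hm := hL.m_nonneg
  obtain ⟨t0, -, tz⟩ := hL.crossing _ hq d hf.2.1 hqd
  set t := θ (p + d) d
  rw [← framePt_zero_add_one M.h p e d] at tz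
  have hqe' : p + d + e ∉ M.innerSites := by rwa [add_right_comm]
  obtain ⟨r0, r1, rz⟩ := hL.crossing _ hq e hf.1 hqe'
  set r := θ (p + d) e
  rw [← framePt_snd_one M.h p e d] at rz
  have hσ := abs_le.mp hG.slope
  have hpq := abs_le.mp (hL.interior p hpP hp d hf.2.1 hq)
  have b1 := hG.bounds (x := r) (y := 1) (x' := 0) (y' := 1 + t)
    (abs_le.mpr ⟨by linarith, by linarith⟩) (abs_le.mpr ⟨by linarith, by linarith⟩)
    (abs_le.mpr ⟨by linarith, by linarith⟩) (abs_le.mpr ⟨by linarith, by linarith⟩)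
  simp only [rz, tz, mul_zero, sub_zero, abs_of_nonneg r0] at b1
  have e1 : |1 - (1 + t)| = t := by rw [abs_of_nonpos (by linarith)]; ring
  rw [e1] at b1
  by_cases hs : p + e ∈ M.innerSites
  · have hps := abs_le.mp (hL.interior p hpP hp e hf.1 hs)
    obtain ⟨t'0, t'1, t'z⟩ := hL.crossing _ hs d hf.2.1 hqe
    by_cases ht' : 1 / 2 ≤ θ (p + e) d
    -- With a large parameter on the opposite vertical edge, the difference is reached by going
    -- around the other three sides of the cell.
    · have h1 := abs_le.mp (hL.abs_sub_le_of_half_le hsP hs hf.2.1 hqe ht')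
      exact abs_le.mpr ⟨by linarith, by linarith⟩
    push Not at ht'
    set t' := θ (p + e) d
    rw [← framePt_fst_one M.h p e d] at t'z
    have b2 := hG.bounds (x := 1) (y := t') (x' := 0) (y' := 1 + t)
      (abs_le.mpr ⟨by linarith, by linarith⟩) (abs_le.mpr ⟨by linarith, by linarith⟩)
      (abs_le.mpr ⟨by linarith, by linarith⟩) (abs_le.mpr ⟨by linarith, by linarith⟩)
    simp only [t'z, tz, mul_zero, sub_zero, abs_one, mul_one] at b2
    have e2 : |t' - (1 + t)| = 1 + t - t' := by rw [abs_of_nonpos (by linarith)]; ring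
    rw [e2] at b2
    -- The curve falls from height `1 + t` to `t' < 1/2` across the cell, so its slope forces it
    -- through the upper side well before the right corner. The chord then has both increments
    -- bounded below, and the mixed difference is at most `8 m / (1/5) = 40 m`.
    have hr : r ≤ 3 / 5 := by
      by_contra! hcon
      have hσ' : 0.475 + t ≤ σ := by linarith
      have : (0.475 + t) * (3 / 5) ≤ σ * r := mul_le_mul hσ' hcon.le (by norm_num) (by linarith)
      linarith
    have hmix := abs_mixed_difference_le hf U hL.trace ⟨r0, r1.le⟩ ⟨zero_le_one, le_rfl⟩
      ⟨zero_le_one, le_rfl⟩ ⟨t'0, t'1.le⟩ (by simp) (by simp) rz t'z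
    rw [abs_of_nonpos (by linarith : r - 1 ≤ 0), abs_of_nonneg (by linarith : 0 ≤ 1 - t')] at hmix
    have hprod : 1 / 5 ≤ -(r - 1) * (1 - t') := by
      calc (1 : ℝ) / 5 = 2 / 5 * (1 / 2) := by norm_num
        _ ≤ -(r - 1) * (1 - t') := mul_le_mul (by linarith) (by linarith) (by norm_num)
            (by linarith)
    have h3 := (mul_le_mul_of_nonneg_left hprod (abs_nonneg _)).trans hmix
    have h4 := abs_le.mp (show |U p + U (p + e + d) - U (p + e) - U (p + d)| ≤ 40 * m by linarith)
    exact abs_le.mpr ⟨by linarith, by linarith⟩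
  -- Here the curve crosses both horizontal sides. Since `|σ| ≤ 1`, it descends by `1 + t` only if
  -- `t` is nearly zero and it spans almost the whole width: the upper crossing is near the left
  -- end, the lower one near the right end.
  · obtain ⟨w0, w1, wz⟩ := hL.crossing _ hp e hf.1 hs
    rw [← framePt_fst_zero M.h p e d] at wz
    have hs' := mul_pos hc (notMem_innerSites.mp hs)
    rw [← framePt_one_zero M.h p e d] at hs'
    have b2 := hG.bounds (x := 1) (y := 0) (x' := 0) (y' := 1 + t)
      (abs_le.mpr ⟨by linarith, by linarith⟩) (abs_le.mpr ⟨by linarith, by linarith⟩)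
      (abs_le.mpr ⟨by linarith, by linarith⟩) (abs_le.mpr ⟨by linarith, by linarith⟩)
    have b3 := hG.bounds (x := θ p e) (y := 0) (x' := 0) (y' := 1 + t)
      (abs_le.mpr ⟨by linarith, by linarith⟩) (abs_le.mpr ⟨by linarith, by linarith⟩)
      (abs_le.mpr ⟨by linarith, by linarith⟩) (abs_le.mpr ⟨by linarith, by linarith⟩)
    have e2 : |0 - (1 + t)| = 1 + t := by rw [abs_of_nonpos (by linarith)]; ring
    simp only [tz, mul_zero, sub_zero, abs_one, mul_one, e2] at b2
    simp only [wz, tz, mul_zero, sub_zero, abs_of_nonneg w0, e2] at b3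
    have hw : 1 / 2 ≤ θ p e := by
      have : σ * θ p e ≤ θ p e := by
        simpa using mul_le_mul_of_nonneg_right hσ.2 w0
      linarith [b3.1, b3.2]
    have hw' : 0.9 ≤ θ p e := by
      have : σ * θ p e ≤ θ p e := by
        simpa using mul_le_mul_of_nonneg_right hσ.2 w0
      linarith [b3.1, b3.2]
    have hg := abs_le.mp (hL.abs_sub_le_of_half_le hpP hp hf.1 hs hw)
    have hr : r ≤ 1 / 10 := by
      by_contra! hcon
      have : 0.9 * r ≤ σ * r := mul_le_mul_of_nonneg_right (by linarith) r0
      linarith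
    have hmix := abs_mixed_difference_le hf U hL.trace ⟨r0, r1.le⟩ ⟨zero_le_one, le_rfl⟩
      ⟨w0, w1.le⟩ ⟨le_rfl, zero_le_one⟩ (by simp) (by simp) rz wz
    rw [abs_of_nonpos (by linarith : r - θ p e ≤ 0), sub_zero, abs_one, mul_one] at hmix
    have h3 := (mul_le_mul_of_nonneg_left (show 1 / 5 ≤ -(r - θ p e) by linarith)
      (abs_nonneg _)).trans hmix
    have h4 := abs_le.mp (show |U p + U (p + e + d) - U (p + e) - U (p + d)| ≤ 40 * m by linarith)
    exact abs_le.mpr ⟨by linarith, by linarith⟩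

/-- The level-set function increases along `d`, so a step against `d` cannot leave the inner set. -/
lemma mem_innerSites_of_add (hc : 0 < c)
    (hG : IsChart (fun x y => c * M.φ (framePt M.h p e d x y)) σ)
    (hq : p + d ∈ M.innerSites) : p ∈ M.innerSites := by
  have h1 := hG.mono (x := 0) (y := 0) (y' := 1) (by norm_num) (by norm_num) (by norm_num)
    zero_le_one
  rw [framePt_zero_one, framePt_zero_zero] at h1
  exact mem_innerSites.mpr ((le_of_mul_le_mul_left h1 hc).trans (mem_innerSites.mp hq))

lemma abs_horizontal_le (hL : M.LocalBounds U θ B m P) (hf : IsFrame e d) (hc : 0 < c)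
    (hG : IsChart (fun x y => c * M.φ (framePt M.h p e d x y)) σ) (hpP : p ∈ P) (hqP : p + d ∈ P)
    (hsP : p + e ∈ P)
    (hq : p + d ∈ M.innerSites) (hqd : p + d + d ∉ M.innerSites) (hθ : θ (p + d) d < 1 / 2) :
    |U (p + d + e) - U (p + d)| ≤ 4 * B + 40 * m := by
  by_cases hqe : p + d + e ∈ M.innerSites
  · have := hL.interior _ hqP hq e hf.1 hqe
    linarith [hL.B_nonneg, hL.m_nonneg]
  · rw [add_right_comm] at hqe ⊢
    exact hL.abs_horizontal_le_of_lt_half hf hc hG hpP hsP (mem_innerSites_of_add hc hG hq) hq hqd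
      hθ hqe

/-- Control of the difference along a vertical boundary edge. -/
lemma abs_vertical_le (hL : M.LocalBounds U θ B m P) (hf : IsFrame e d) (hc : 0 < c)
    (hU : DiscreteHarmonicOn M.innerSites U)
    (hG : IsChart (fun x y => c * M.φ (framePt M.h p e d x y)) σ) (hpP : p ∈ P) (hqP : p + d ∈ P)
    (hsP : p + e ∈ P) (hsP' : p + -e ∈ P)
    (hq : p + d ∈ M.innerSites) (hqd : p + d + d ∉ M.innerSites) :
    |U (p + d + d) - U (p + d)| ≤ 9 * B + 80 * m := by
  have hB := hL.B_nonneg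
  have hm := hL.m_nonneg
  by_cases hθ : 1 / 2 ≤ θ (p + d) d
  · have := hL.abs_sub_le_of_half_le hqP hq hf.2.1 hqd hθ
    linarith
  push Not at hθ
  have hp := mem_innerSites_of_add hc hG hq
  have h1 := abs_le.mp (hL.abs_horizontal_le hf hc hG hpP hqP hsP hq hqd hθ)
  have hG' := hG.neg_left
  simp only [← framePt_neg_left] at hG'
  have h2 := abs_le.mp (hL.abs_horizontal_le hf.neg_left hc hG' hpP hqP hsP' hq hqd hθ)
  have h3 := abs_le.mp (hL.interior p hpP hp d hf.2.1 hq)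
  -- A small parameter makes the weighted bound useless. Harmonicity expresses the difference by the
  -- two horizontal ones, at most `4 B + 40 m` each, and the interior one, at most `B`.
  have h4 := hU _ hq
  rw [hf.sum_eq, add_neg_cancel_right] at h4
  exact abs_le.mpr ⟨by linarith, by linarith⟩

/-- Control of the difference along a horizontal boundary edge. -/
lemma abs_horizontal_le' (hL : M.LocalBounds U θ B m P) (hf : IsFrame e d) (hc : 0 < c)
    (hU : DiscreteHarmonicOn M.innerSites U)
    (hG : IsChart (fun x y => c * M.φ (framePt M.h p e d x y)) σ)
    (hG₁ : IsChart (fun x y => c * M.φ (framePt M.h (p + e - d) e d x y)) σ) (hpP : p ∈ P)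
    (hsP : p + e ∈ P) (h1P : p + e - d ∈ P)
    (h2P : p + e - d + e ∈ P) (h3P : p + e - d + -e ∈ P)
    (hq : p + d ∈ M.innerSites) (hqe : p + d + e ∉ M.innerSites) :
    |U (p + d + e) - U (p + d)| ≤ 11 * B + 80 * m := by
  have hB := hL.B_nonneg
  have hm := hL.m_nonneg
  have hp := mem_innerSites_of_add hc hG hq
  have hpq := abs_le.mp (hL.interior p hpP hp d hf.2.1 hq)
  rw [add_right_comm] at hqe ⊢
  -- If the vertex below the outer end point is inner, the edge between these two is a vertical
  -- boundary edge, bounded by `9 B + 80 m`; two interior differences close the square.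
  by_cases hs : p + e ∈ M.innerSites
  · have hps := abs_le.mp (hL.interior p hpP hp e hf.1 hs)
    have e1 : p + e - d + d = p + e := sub_add_cancel _ _
    have h1 := hL.abs_vertical_le (p := p + e - d) hf hc hU hG₁ h1P (by rwa [e1]) h2P h3P
      (by rwa [e1]) (by rwa [e1])
    rw [e1] at h1
    have h1' := abs_le.mp h1
    exact abs_le.mpr ⟨by linarith, by linarith⟩
  · obtain ⟨w0, w1, wz⟩ := hL.crossing _ hp e hf.1 hs
    rw [← framePt_fst_zero M.h p e d] at wz
    have hσ := abs_le.mp hG.slope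
    have six : ∀ {t : ℝ}, 0 ≤ t → t ≤ 2 → |t| ≤ 6 := fun h1 h2 =>
      abs_le.mpr ⟨by linarith, by linarith⟩
    have hq' := mul_nonpos_of_nonneg_of_nonpos hc.le (mem_innerSites.mp hq)
    rw [← framePt_zero_one M.h p e d] at hq'
    have b1 := (hG.bounds (x := 0) (y := 1) (x' := θ p e) (y' := 0) (six le_rfl (by norm_num))
      (six (by norm_num) (by norm_num)) (six w0 (by linarith)) (six le_rfl (by norm_num))).1
    have b2 := (hG.bounds (x := 0) (y := 2) (x' := θ p e) (y' := 0) (six le_rfl (by norm_num))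
      (six (by norm_num) (by norm_num)) (six w0 (by linarith)) (six le_rfl (by norm_num))).1
    simp only [wz, mul_zero, sub_zero, zero_sub, abs_neg, abs_of_nonneg w0, abs_one, mul_neg,
      abs_two] at b1 b2
    have hσw : σ * θ p e ≤ θ p e := by simpa using mul_le_mul_of_nonneg_right hσ.2 w0
    -- The crossing at height zero and the inner vertex at height one make the slope nearly
    -- extremal, so the curve passes just above `p + d`: its vertical parameter is small and the
    -- preceding estimate applies.
    have hqd : p + d + d ∉ M.innerSites := by
      rw [notMem_innerSites, ← framePt_zero_two M.h p e d]
      exact pos_of_mul_pos_right (by linarith) hc.le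
    obtain ⟨t0, t1, tz⟩ := hL.crossing _ hq d hf.2.1 hqd
    have tz' := tz
    rw [← framePt_zero_add_one M.h p e d] at tz'
    have b3 := (hG.bounds (x := 0) (y := 1 + θ (p + d) d) (x' := θ p e) (y' := 0)
      (six le_rfl (by norm_num)) (six (by linarith) (by linarith)) (six w0 (by linarith))
      (six le_rfl (by norm_num))).1
    have e2 : |1 + θ (p + d) d| = 1 + θ (p + d) d := abs_of_nonneg (by linarith)
    simp only [wz, tz', mul_zero, sub_zero, zero_sub, abs_neg, abs_of_nonneg w0, mul_neg,
      e2] at b3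
    have := hL.abs_horizontal_le_of_lt_half hf hc hG hpP hsP hp hq hqd (by linarith) hqe
    linarith

end LocalBounds

/-- The lattice points within distance `r` of `q` in the maximum norm. -/
def latticeBall (q : ℤ × ℤ) (r : ℤ) : Set (ℤ × ℤ) := {x | |x.1 - q.1| ≤ r ∧ |x.2 - q.2| ≤ r}

lemma add_mem_latticeBall {q x a : ℤ × ℤ} {r : ℤ} (hx : x ∈ latticeBall q r)
    (ha : a ∈ directions) : x + a ∈ latticeBall q (r + 1) := by
  obtain ⟨h1, h2⟩ := hx
  rw [abs_le] at h1 h2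
  simp only [directions, Finset.mem_insert, Finset.mem_singleton] at ha
  rcases ha with rfl | rfl | rfl | rfl <;>
    refine ⟨abs_le.mpr ⟨?_, ?_⟩, abs_le.mpr ⟨?_, ?_⟩⟩ <;> simp <;> omega

lemma latticeBall_mono {q : ℤ × ℤ} {r s : ℤ} (h : r ≤ s) : latticeBall q r ⊆ latticeBall q s :=
  fun _ hx => ⟨hx.1.trans h, hx.2.trans h⟩

lemma norm_vertex_add_sub_le {h : ℝ} (hh : 0 < h) (x : ℤ × ℤ) {a : ℤ × ℤ} (ha : a ∈ directions)
    (z : Plane) : ‖vertex h (x + a) - z‖ ≤ ‖vertex h x - z‖ + h := by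
  obtain ⟨b, hf⟩ := exists_isFrame ha
  have h1 := hf.norm_framePt_sub_le hh x 1 0 0 0
  rw [framePt_one_zero, framePt_zero_zero] at h1
  simp only [sub_zero, abs_one, abs_zero, add_zero, mul_one] at h1
  have := norm_add_le (vertex h (x + a) - vertex h x) (vertex h x - z)
  rw [sub_add_sub_cancel] at this
  linarith

/-- Control of the difference along an arbitrary boundary edge. -/
lemma LocalBounds.abs_sub_le (hch : M.HasCharts) {U : ℤ × ℤ → ℝ} {θ : ℤ × ℤ → ℤ × ℤ → ℝ}
    {B m : ℝ} {q : ℤ × ℤ} (hL : M.LocalBounds U θ B m (latticeBall q 4))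
    (hU : DiscreteHarmonicOn M.innerSites U) (hq : q ∈ M.innerSites) {a : ℤ × ℤ}
    (ha : a ∈ directions) (hqa : q + a ∉ M.innerSites) :
    |U (q + a) - U q| ≤ 11 * B + 80 * m := by
  have hh := M.h_pos
  obtain ⟨t0, t1, tz⟩ := hL.crossing q hq a ha hqa
  obtain ⟨e, d, hf, c, hc, σ, hchart⟩ := hch _ tz
  set z := edgePt M.h q a (θ q a)
  have hz0 : ‖vertex M.h q - z‖ ≤ M.h := by
    obtain ⟨b, hf'⟩ := exists_isFrame ha
    have := hf'.norm_framePt_sub_le hh q 0 0 (θ q a) 0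
    rw [framePt_zero_zero, framePt_fst_zero] at this
    refine this.trans ?_
    simp only [zero_sub, abs_neg, abs_of_nonneg t0, abs_zero, add_zero, neg_zero]
    nlinarith
  have hd := hf.2.1
  have hnd := neg_mem_directions hd
  have m0 : q ∈ latticeBall q 0 := by simp [latticeBall]
  have m1 := add_mem_latticeBall m0 hnd
  have hz1 := norm_vertex_add_sub_le hh q hnd z
  have eq : q + -d + d = q := neg_add_cancel_right _ _
  have up : ∀ {r : ℤ} {x}, x ∈ latticeBall q r → r ≤ 4 → x ∈ latticeBall q 4 :=
    fun hx hr => latticeBall_mono hr hx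
  have hG := hchart (q + -d) (by linarith)
  have hB := hL.B_nonneg
  have hm := hL.m_nonneg
  have hqP : q + -d + d ∈ latticeBall q 4 := by rw [eq]; exact up m0 (by norm_num)
  have key : ∀ e' σ', IsFrame e' d →
      (∀ q, ‖vertex M.h q - z‖ ≤ 4 * M.h →
        IsChart (fun x y => c * M.φ (framePt M.h q e' d x y)) σ') →
      q + e' ∉ M.innerSites → |U (q + e') - U q| ≤ 11 * B + 80 * m := by
    intro e' σ' hf' hchart' hqe
    have m2 := add_mem_latticeBall m1 hf'.1
    have m3 := add_mem_latticeBall m2 hnd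
    have hz2 := norm_vertex_add_sub_le hh (q + -d) hf'.1 z
    have hz3 := norm_vertex_add_sub_le hh (q + -d + e') hnd z
    have := hL.abs_horizontal_le' (p := q + -d) hf' hc hU (hchart' _ (by linarith))
      (hchart' _ (by rw [sub_eq_add_neg (q + -d + e')]; linarith)) (up m1 (by norm_num)) (up m2 (by norm_num))
      (by rw [sub_eq_add_neg]; exact up m3 (by norm_num))
      (by rw [sub_eq_add_neg]; exact up (add_mem_latticeBall m3 hf'.1) (by norm_num))
      (by
        rw [sub_eq_add_neg]
        exact up (add_mem_latticeBall m3 (neg_mem_directions hf'.1)) (by norm_num))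
      (by rwa [eq]) (by rwa [eq])
    rwa [eq] at this
  rcases (hf.mem_directions_iff a).mp ha with rfl | rfl | rfl | rfl
  · exact key _ σ hf hchart hqa
  · refine key _ (-σ) hf.neg_left (fun q' hq' => ?_) hqa
    have := (hchart q' hq').neg_left
    simpa only [← framePt_neg_left] using this
  · have := hL.abs_vertical_le (p := q + -a) hf hc hU hG (up m1 (by norm_num)) hqP
      (up (add_mem_latticeBall m1 hf.1) (by norm_num))
      (up (add_mem_latticeBall m1 (neg_mem_directions hf.1)) (by norm_num))
      (by rwa [eq]) (by rwa [eq])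
    rw [eq] at this
    linarith
  -- A boundary edge cannot point against `d`.
  · exact absurd (mem_innerSites_of_add hc hG (by rwa [eq])) hqa

end CutMesh

namespace CutMesh

variable {Γ : LevelSetCurve} {M : CutMesh Γ}

/-! ### Sums over lattice points -/

/-- Reindexing of a nonnegative sum along an injection, where terms that miss `t` vanish. -/
lemma sum_comp_le {ι κ : Type*} [DecidableEq κ] {s : Finset ι} {t : Finset κ} {f : ι → κ}
    (hf : Set.InjOn f s) {g : κ → ℝ} (hg : ∀ y, 0 ≤ g y) (h : ∀ x ∈ s, f x ∉ t → g (f x) = 0) :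
    ∑ x ∈ s, g (f x) ≤ ∑ y ∈ t, g y := by
  rw [← Finset.sum_image (f := g) (s := s) (g := f) fun x hx y hy hxy => hf hx hy hxy]
  have h1 : ∑ y ∈ s.image f, g y = ∑ y ∈ (s.image f).filter (· ∈ t), g y := by
    symm
    refine Finset.sum_filter_of_ne fun y hy hne => ?_
    obtain ⟨x, hx, rfl⟩ := Finset.mem_image.mp hy
    by_contra hcon
    exact hne (h x hx hcon)
  rw [h1]
  exact Finset.sum_le_sum_of_subset_of_nonneg (fun y hy => (Finset.mem_filter.mp hy).2)
    fun y _ _ => hg y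

lemma sum_boundary_le (U : ℤ × ℤ → ℝ) :
    ∑ x ∈ M.innerSites, ∑ a ∈ directions, (if x + a ∈ M.innerSites then 0 else U (x + a) ^ 2) ≤
      4 * ∑ y ∈ M.γ₂.toFinset, U y ^ 2 := by
  rw [Finset.sum_comm]
  have h1 : ∀ a ∈ directions, ∑ x ∈ M.innerSites,
      (if x + a ∈ M.innerSites then 0 else U (x + a) ^ 2) ≤ ∑ y ∈ M.γ₂.toFinset, U y ^ 2 := by
    intro a ha
    have h2 := sum_comp_le (s := M.innerSites) (t := M.γ₂.toFinset) (f := fun x => x + a)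
      (g := fun y => if y ∈ M.innerSites then 0 else U y ^ 2)
      (fun x _ y _ hxy => add_right_cancel hxy) (fun y => by split_ifs <;> positivity)
      (fun x hx hxt => by
        by_cases hxa : x + a ∈ M.innerSites
        · simp only [hxa, if_true]
        · exact absurd (Set.mem_toFinset.mpr (boundary_edge_active ha hx hxa).2) hxt)
    refine h2.trans (Finset.sum_le_sum fun y _ => ?_)
    split_ifs
    · positivity
    · exact le_rfl
  refine (Finset.sum_le_sum h1).trans (le_of_eq ?_)
  rw [sum_directions]
  ring

/-- Every vertex of `γ₂` has an inner neighbour, so it occurs at least once as the outer end point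
of a boundary edge. -/
lemma sum_γ₂_le (U : ℤ × ℤ → ℝ) : ∑ y ∈ M.γ₂.toFinset, U y ^ 2 ≤
    ∑ x ∈ M.innerSites, ∑ a ∈ directions,
      (if x + a ∈ M.innerSites then 0 else U (x + a) ^ 2) := by
  have h1 : ∀ y ∈ M.γ₂.toFinset, U y ^ 2 ≤
      ∑ a ∈ directions, if y - a ∈ M.innerSites then U y ^ 2 else 0 := by
    intro y hy
    obtain ⟨-, -, q, hq, hq1⟩ := Set.mem_toFinset.mp hy
    obtain ⟨a, ha, rfl⟩ := Finset.mem_image.mp hq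
    have hmem : y - -a ∈ M.innerSites := by
      rw [sub_neg_eq_add]; exact mem_innerSites.mpr hq1.2
    calc U y ^ 2 = if y - -a ∈ M.innerSites then U y ^ 2 else 0 := by rw [if_pos hmem]
      _ ≤ _ := Finset.single_le_sum (f := fun a => if y - a ∈ M.innerSites then U y ^ 2 else 0)
          (fun a _ => by positivity) (neg_mem_directions ha)
  refine (Finset.sum_le_sum h1).trans ?_
  rw [Finset.sum_comm, Finset.sum_comm (s := M.innerSites)]
  refine Finset.sum_le_sum fun a _ => ?_
  have h2 := sum_comp_le (s := M.γ₂.toFinset) (t := M.innerSites) (f := fun y => y - a)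
    (g := fun x => if x ∈ M.innerSites ∧ x + a ∉ M.innerSites then U (x + a) ^ 2 else 0)
    (fun x _ y _ hxy => sub_left_injective hxy) (fun y => by positivity)
    (fun x _ hxt => by simp only [hxt, false_and, if_false])
  refine (le_of_eq (Finset.sum_congr rfl fun y hy => ?_)).trans (h2.trans
    (le_of_eq (Finset.sum_congr rfl fun x hx => ?_)))
  · have hy' : y ∉ M.innerSites := notMem_innerSites.mpr (Set.mem_toFinset.mp hy).2.1
    simp only [sub_add_cancel, hy', not_false_eq_true, and_true]
  · simp only [hx, true_and]
    split_ifs <;> simp_all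

/-! ### The lower bound -/

open Classical in
variable (M) in
/-- A parameter at which the curve crosses the mesh edge from `x` in the direction `a`. -/
noncomputable def crossingParam (x a : ℤ × ℤ) : ℝ :=
  if h : ∃ t, 0 ≤ t ∧ t < 1 ∧ M.φ (edgePt M.h x a t) = 0 then h.choose else 0

lemma crossingParam_spec {x a : ℤ × ℤ} (hx : x ∈ M.innerSites) (ha : a ∈ directions)
    (hxa : x + a ∉ M.innerSites) : 0 ≤ M.crossingParam x a ∧ M.crossingParam x a < 1 ∧
      M.φ (edgePt M.h x a (M.crossingParam x a)) = 0 := by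
  have h := exists_crossing_parameter ha hx hxa
  rw [crossingParam, dif_pos h]
  exact h.choose_spec

lemma card_γ₁_le : (M.γ₁.toFinset.card : ℝ) ≤ 4 * Fintype.card M.activeCells := by
  classical
  have h1 : M.γ₁.toFinset ⊆ M.activeCells.toFinset.biUnion corners := by
    intro p hp
    obtain ⟨⟨k, hk, hpk⟩, -⟩ := Set.mem_toFinset.mp hp
    exact Finset.mem_biUnion.mpr ⟨k, Set.mem_toFinset.mpr hk, hpk⟩
  have h2 := (Finset.card_le_card h1).trans
    (Finset.card_biUnion_le_card_mul _ _ 4 fun k _ => Finset.card_le_four)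
  rw [Set.toFinset_card M.activeCells] at h2
  have : (M.γ₁.toFinset.card : ℝ) ≤ Fintype.card M.activeCells * 4 := by exact_mod_cast h2
  linarith

-- Each lattice point lies in at most `9² = 81` of the balls, so localized sums cost only a
-- constant.
open Classical in
lemma sum_latticeBall_le (S : Finset (ℤ × ℤ)) {T : ℤ × ℤ → ℝ} (hT : ∀ x, 0 ≤ T x) :
    ∑ q ∈ S, ∑ x ∈ S.filter (· ∈ latticeBall q 4), T x ≤ 81 * ∑ x ∈ S, T x := by
  simp only [Finset.sum_filter]
  rw [Finset.sum_comm, Finset.mul_sum]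
  refine Finset.sum_le_sum fun x _ => ?_
  rw [← Finset.sum_filter, Finset.sum_const, nsmul_eq_mul]
  refine mul_le_mul_of_nonneg_right ?_ (hT x)
  have h1 : S.filter (fun q => x ∈ latticeBall q 4) ⊆
      Finset.Icc (x.1 - 4) (x.1 + 4) ×ˢ Finset.Icc (x.2 - 4) (x.2 + 4) := by
    intro q hq
    obtain ⟨h1, h2⟩ := (Finset.mem_filter.mp hq).2
    rw [abs_le] at h1 h2
    simp only [Finset.mem_product, Finset.mem_Icc]
    omega
  have h2 := Finset.card_le_card h1
  rw [Finset.card_product, Int.card_Icc, Int.card_Icc] at h2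
  have e1 : (x.1 + 4 + 1 - (x.1 - 4)).toNat = 9 := by
    have : x.1 + 4 + 1 - (x.1 - 4) = 9 := by ring
    rw [this]; rfl
  have e2 : (x.2 + 4 + 1 - (x.2 - 4)).toNat = 9 := by
    have : x.2 + 4 + 1 - (x.2 - 4) = 9 := by ring
    rw [this]; rfl
  rw [e1, e2] at h2
  exact_mod_cast h2

/-- A discrete harmonic function is controlled, at the boundary, by its trace on the discrete
curve. -/
lemma sum_γ₂_le_trace (hch : M.HasCharts) {U : ℤ × ℤ → ℝ}
    (hU : DiscreteHarmonicOn M.innerSites U) {m : ℝ} (hm0 : 0 ≤ m)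
    (hm : ∀ k ∈ M.activeCells, ∀ x ∈ M.cutSegment k, |M.feFun (U ∘ M.site) x| ≤ m) :
    ∑ y ∈ M.γ₂.toFinset, U y ^ 2 ≤ 10 ^ 12 * (M.γ₁.toFinset.card * m ^ 2) := by
  classical
  set S := M.innerSites with hS
  set θ := M.crossingParam with hθ
  set δ : ℤ × ℤ → ℤ × ℤ → ℝ := fun x a => U (x + a) - U x with hδ
  have hspec : ∀ x ∈ S, ∀ a ∈ directions, x + a ∉ S →
      0 ≤ θ x a ∧ θ x a < 1 ∧ M.φ (edgePt M.h x a (θ x a)) = 0 :=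
    fun x hx a ha hxa => crossingParam_spec hx ha hxa
  have hθ0 : ∀ x a, 0 ≤ θ x a := by
    intro x a
    simp only [hθ, crossingParam]
    split_ifs with h
    · exact h.choose_spec.1
    · exact le_rfl
  -- Energy density with the natural weight `θ` on boundary edges, so that `A = ∑ T` is what Green's
  -- identity controls.
  set T : ℤ × ℤ → ℝ := fun x =>
    ∑ a ∈ directions, (if x + a ∈ S then δ x a ^ 2 else θ x a * δ x a ^ 2) with hT
  have hterm : ∀ x a, 0 ≤ (if x + a ∈ S then δ x a ^ 2 else θ x a * δ x a ^ 2) := by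
    intro x a
    have := hθ0 x a
    split_ifs <;> positivity
  have hT0 : ∀ x, 0 ≤ T x := fun x => Finset.sum_nonneg fun a _ => hterm x a
  set n := (M.γ₁.toFinset.card : ℝ) with hn
  have hloc : ∀ q ∈ S, ∀ a ∈ directions, q + a ∉ S → δ q a ^ 2 ≤
      242 * (∑ x ∈ S.filter (· ∈ latticeBall q 4), T x) + 12800 * m ^ 2 := by
    intro q hq a ha hqa
    set B2 := ∑ x ∈ S.filter (· ∈ latticeBall q 4), T x
    have hB2 : 0 ≤ B2 := Finset.sum_nonneg fun x _ => hT0 x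
    have hle : ∀ x ∈ latticeBall q 4, x ∈ S → ∀ a ∈ directions,
        (if x + a ∈ S then δ x a ^ 2 else θ x a * δ x a ^ 2) ≤ B2 := by
      intro x hxP hx a ha
      refine (Finset.single_le_sum (f := fun a =>
        if x + a ∈ S then δ x a ^ 2 else θ x a * δ x a ^ 2) (fun a _ => hterm x a) ha).trans ?_
      exact Finset.single_le_sum (f := T) (fun x _ => hT0 x) (Finset.mem_filter.mpr ⟨hx, hxP⟩)
    have hL : M.LocalBounds U θ (√B2) m (latticeBall q 4) :=
      { B_nonneg := Real.sqrt_nonneg _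
        m_nonneg := hm0
        trace := hm
        crossing := hspec
        interior := fun x hxP hx a ha hxa => by
          have := hle x hxP hx a ha
          rw [if_pos hxa] at this
          exact Real.abs_le_sqrt this
        boundary := fun x hxP hx a ha hxa => by
          have := hle x hxP hx a ha
          rw [if_neg hxa] at this
          rwa [Real.sq_sqrt hB2] }
    have h1 := hL.abs_sub_le hch hU hq ha hqa
    have h2 : δ q a ^ 2 ≤ (11 * √B2 + 80 * m) ^ 2 := by
      rw [← sq_abs]
      exact pow_le_pow_left₀ (abs_nonneg _) h1 2
    have h3 := Real.sq_sqrt hB2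
    nlinarith [sq_nonneg (11 * √B2 - 80 * m)]
  have hcount : ∀ c : ℝ, 0 ≤ c →
      ∑ x ∈ S, ∑ a ∈ directions, (if x + a ∈ S then 0 else c) ≤ 4 * (n * c) := by
    intro c hc
    have h1 : ∀ x ∈ S, ∑ a ∈ directions, (if x + a ∈ S then 0 else c) ≤
        if x ∈ M.γ₁.toFinset then 4 * c else 0 := by
      intro x hx
      split_ifs with hx1
      · refine (Finset.sum_le_sum (g := fun _ => c) fun a _ => ?_).trans (le_of_eq ?_)
        · split_ifs
          · exact hc
          · exact le_rfl
        · rw [sum_directions]; ring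
      · refine (Finset.sum_eq_zero fun a ha => ?_).le
        rw [if_pos]
        by_contra hxa
        exact hx1 (Set.mem_toFinset.mpr (boundary_edge_active ha hx hxa).1)
    refine (Finset.sum_le_sum h1).trans ?_
    rw [← Finset.sum_filter, Finset.sum_const, nsmul_eq_mul]
    have h2 : ((S.filter (· ∈ M.γ₁.toFinset)).card : ℝ) ≤ n := by
      have h3 : (S.filter (· ∈ M.γ₁.toFinset)).card ≤ M.γ₁.toFinset.card :=
        Finset.card_le_card fun x hx => (Finset.mem_filter.mp hx).2
      rw [hn]; exact_mod_cast h3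
    have := mul_le_mul_of_nonneg_right h2 (by linarith : 0 ≤ 4 * c)
    linarith
  set D := ∑ x ∈ S, ∑ a ∈ directions, (if x + a ∈ S then 0 else δ x a ^ 2) with hD
  set A := ∑ x ∈ S, T x with hA
  -- Local control summed over all boundary edges: `78408 = 242 · 4 · 81` and `51200 = 12800 · 4`.
  have hDA : D ≤ 78408 * A + 51200 * (n * m ^ 2) := by
    have h1 : D ≤ ∑ x ∈ S, 968 * (∑ y ∈ S.filter (· ∈ latticeBall x 4), T y) +
        ∑ x ∈ S, ∑ a ∈ directions, (if x + a ∈ S then 0 else 12800 * m ^ 2) := by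
      rw [hD, ← Finset.sum_add_distrib]
      refine Finset.sum_le_sum fun x hx => ?_
      have hB2 : 0 ≤ ∑ y ∈ S.filter (· ∈ latticeBall x 4), T y :=
        Finset.sum_nonneg fun x _ => hT0 x
      have e : 968 * (∑ y ∈ S.filter (· ∈ latticeBall x 4), T y) =
          ∑ a ∈ directions, 242 * (∑ y ∈ S.filter (· ∈ latticeBall x 4), T y) := by
        rw [sum_directions]; ring
      rw [e, ← Finset.sum_add_distrib]
      refine Finset.sum_le_sum fun a ha => ?_
      split_ifs with hxa
      · positivity
      · exact hloc x hx a ha hxa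
    have h2 := hcount (12800 * m ^ 2) (by positivity)
    have h3 := sum_latticeBall_le S hT0
    rw [← Finset.mul_sum] at h1
    linarith
  -- Green's identity and Young's inequality. The factor `1/156816 = 1/(2 · 78408)` makes the two
  -- estimates combine to `D ≤ D/2 + C n m²`.
  have hAD : A ≤ D / 156816 + 627264 * (n * m ^ 2) := by
    have h1 : A = ∑ x ∈ S, ∑ a ∈ directions, (if x + a ∈ S then δ x a ^ 2 else 0) +
        ∑ x ∈ S, ∑ a ∈ directions, (if x + a ∈ S then 0 else θ x a * δ x a ^ 2) := by
      rw [hA, ← Finset.sum_add_distrib]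
      refine Finset.sum_congr rfl fun x _ => ?_
      rw [hT, ← Finset.sum_add_distrib]
      refine Finset.sum_congr rfl fun a _ => ?_
      split_ifs <;> simp
    have h2 := hU.energy
    have h3 : A ≤ ∑ x ∈ S, ∑ a ∈ directions, (if x + a ∈ S then 0 else δ x a ^ 2) / 156816 +
        ∑ x ∈ S, ∑ a ∈ directions, (if x + a ∈ S then 0 else 156816 * m ^ 2) := by
      rw [h1, h2, Finset.mul_sum, ← Finset.sum_add_distrib, ← Finset.sum_add_distrib]
      refine Finset.sum_le_sum fun x hx => ?_
      rw [Finset.mul_sum, ← Finset.sum_add_distrib, ← Finset.sum_add_distrib]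
      refine Finset.sum_le_sum fun a ha => ?_
      split_ifs with hxa
      · simp
      · obtain ⟨t0, t1, tz⟩ := hspec x hx a ha hxa
        have htr := abs_le.mp (abs_trace_le ha U hm t0 t1.le tz)
        have e : (1 - θ x a) * U x + θ x a * U (x + a) = U x + θ x a * δ x a := by
          simp only [hδ]; ring
        rw [e] at htr
        set w := U x + θ x a * δ x a with hw
        -- Replacing `U x` by the trace `w` turns the weighted square from `+θ δ²` into `-θ δ²`,
        -- which can be dropped.
        have e2 : 2 * (U x * (U (x + a) - U x)) + θ x a * δ x a ^ 2 =
            2 * w * δ x a - θ x a * δ x a ^ 2 := by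
          simp only [hw, hδ]; ring
        rw [e2]
        have h4 : 0 ≤ θ x a * δ x a ^ 2 := by positivity
        have h5 : w ^ 2 ≤ m ^ 2 := sq_le_sq' htr.1 htr.2
        nlinarith [sq_nonneg (δ x a - 156816 * w)]
    have h4 := hcount (156816 * m ^ 2) (by positivity)
    simp only [← Finset.sum_div] at h3
    linarith
  have hnm : 0 ≤ n * m ^ 2 := by positivity
  have hDm : D ≤ 10 ^ 11 * (n * m ^ 2) := by linarith
  refine (sum_γ₂_le U).trans ?_
  have h1 : ∑ x ∈ S, ∑ a ∈ directions, (if x + a ∈ S then 0 else U (x + a) ^ 2) ≤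
      2 * D + ∑ x ∈ S, ∑ a ∈ directions, (if x + a ∈ S then 0 else 2 * m ^ 2) := by
    rw [hD, Finset.mul_sum, ← Finset.sum_add_distrib]
    refine Finset.sum_le_sum fun x hx => ?_
    rw [Finset.mul_sum, ← Finset.sum_add_distrib]
    refine Finset.sum_le_sum fun a ha => ?_
    split_ifs with hxa
    · simp
    · obtain ⟨t0, t1, tz⟩ := hspec x hx a ha hxa
      have htr := abs_le.mp (abs_trace_le ha U hm t0 t1.le tz)
      set w := (1 - θ x a) * U x + θ x a * U (x + a) with hw
      -- The outer value is the trace plus a part of the jump, both now under control.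
      have e : U (x + a) = w + (1 - θ x a) * δ x a := by
        simp only [hw, hδ]; ring
      have h5 : w ^ 2 ≤ m ^ 2 := sq_le_sq' htr.1 htr.2
      have h6 : ((1 - θ x a) * δ x a) ^ 2 ≤ δ x a ^ 2 := by
        rw [mul_pow]
        have : (1 - θ x a) ^ 2 ≤ 1 := by nlinarith
        nlinarith [sq_nonneg (δ x a)]
      rw [e]
      nlinarith [sq_nonneg (w - (1 - θ x a) * δ x a)]
  have h2 := hcount (2 * m ^ 2) (by positivity)
  linarith

end CutMesh

namespace CutMesh

variable {Γ : LevelSetCurve} {M : CutMesh Γ}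

/-! ### The upper bound -/

/-- An active vertex is within one lattice unit, in each coordinate, of a point of the curve. Three
steps along the dominant direction gain at least two units of height, more than the slope can take
back. -/
lemma exists_exit_direction (hch : M.HasCharts) {x : ℤ × ℤ} (hx : x ∈ M.activeVertices) :
    ∃ d ∈ directions, x + d + d + d ∉ M.innerSites := by
  have hh := M.h_pos
  obtain ⟨k, ⟨z, hz, hzk⟩, hxk⟩ := hx
  obtain ⟨e, d, hf, c, hc, σ, hchart⟩ := hch z hz
  obtain ⟨a, b, rfl⟩ := hf.exists_framePt hh x z
  have h0 : |x.1 + a * e.1 + b * d.1 - x.1| ≤ 1 ∧ |x.2 + a * e.2 + b * d.2 - x.2| ≤ 1 := by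
    obtain ⟨⟨h1, h2⟩, h3, h4⟩ := hzk
    simp only [framePt_zero_apply, framePt_one_apply, mul_le_mul_iff_right₀ hh] at h1 h2 h3 h4
    simp only [corners, Finset.mem_insert, Finset.mem_singleton] at hxk
    rcases hxk with rfl | rfl | rfl | rfl <;>
      refine ⟨abs_le.mpr ⟨?_, ?_⟩, abs_le.mpr ⟨?_, ?_⟩⟩ <;>
      push_cast [Prod.fst_add, Prod.snd_add] at h1 h2 h3 h4 ⊢ <;>
      linarith
  have hab : |a| ≤ 1 ∧ |b| ≤ 1 := by
    rw [add_assoc, add_sub_cancel_left, add_assoc, add_sub_cancel_left] at h0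
    rcases hf.cases with ⟨rfl | rfl, rfl | rfl⟩ | ⟨rfl | rfl, rfl | rfl⟩ <;>
      simpa [and_comm] using h0
  have ha := abs_le.mp hab.1
  have hb := abs_le.mp hab.2
  have hG := hchart x (by
    rw [← framePt_zero_zero M.h x e d]
    refine (hf.norm_framePt_sub_le hh x 0 0 a b).trans ?_
    rw [zero_sub, zero_sub, abs_neg, abs_neg]
    nlinarith [hab.1, hab.2])
  have hσ := abs_le.mp hG.slope
  refine ⟨d, hf.2.1, ?_⟩
  have hz' : M.φ (framePt M.h x e d a b) = 0 := hz
  have h1 := (hG.bounds (x := 0) (y := 3) (x' := a) (y' := b) (by norm_num)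
    (by rw [abs_of_nonneg] <;> norm_num) (by linarith [hab.1]) (by linarith [hab.2])).1
  simp only [hz', mul_zero, sub_zero, zero_sub, abs_neg] at h1
  rw [abs_of_nonneg (by linarith : (0 : ℝ) ≤ 3 - b)] at h1
  have h2 : |σ * -a| ≤ 1 := by
    rw [abs_mul, abs_neg]
    exact mul_le_one₀ hG.slope (abs_nonneg _) hab.1
  have h3 := abs_le.mp h2
  have e3 : framePt M.h x e d 0 3 = vertex M.h (x + d + d + d) := by
    rw [← framePt_zero_two M.h (x + d) e d, framePt_shift_snd]
    norm_num
  rw [notMem_innerSites, ← e3]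
  exact pos_of_mul_pos_right (by linarith [hab.1]) hc.le

/-- The factor is `21` from the bounded potential times `4`, the largest number of boundary edges
ending at one vertex. -/
lemma sum_γ₁_le (hch : M.HasCharts) {U : ℤ × ℤ → ℝ} (hU : DiscreteHarmonicOn M.innerSites U) :
    ∑ x ∈ M.γ₁.toFinset, U x ^ 2 ≤ 84 * ∑ y ∈ M.γ₂.toFinset, U y ^ 2 := by
  have h1 := hU.sum_sq_le (T := M.γ₁.toFinset)
    (fun x hx => mem_innerSites.mpr (Set.mem_toFinset.mp hx).2)
    (fun x hx => exists_exit_direction hch (Set.mem_toFinset.mp hx).1)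
  have h2 := sum_boundary_le (M := M) U
  linarith

lemma sum_corners (k : ℤ × ℤ) (f : ℤ × ℤ → ℝ) : ∑ p ∈ corners k, f p =
    f k + f (k + (1, 0)) + f (k + (0, 1)) + f (k + (1, 1)) := by
  rw [corners, Finset.sum_insert, Finset.sum_insert, Finset.sum_insert, Finset.sum_singleton]
  · ring
  all_goals simp [Prod.ext_iff]

/-- Each vertex is a corner of at most four active cells: `128 = 4 · 32`. -/
lemma dotProduct_stiffness_le (hM : M.NondegenerateCut) (hch : M.HasCharts) (U : ℤ × ℤ → ℝ) :
    (U ∘ M.site) ⬝ᵥ M.stiffness *ᵥ (U ∘ M.site) ≤ 128 / M.h * ∑ i, U (M.site i) ^ 2 := by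
  classical
  have hh := M.h_pos
  have h1 : ∀ c : ℤ × ℤ, (∀ k, k + c ∈ corners k) →
      ∑ k : M.activeCells, U (k + c) ^ 2 ≤ ∑ i, U (M.site i) ^ 2 := by
    intro c hc
    rw [← Finset.sum_image (s := Finset.univ) (g := M.site) (f := fun p => U p ^ 2)
      (fun x _ y _ hxy => site_injective hxy)]
    refine sum_comp_le (f := fun k : M.activeCells => (k : ℤ × ℤ) + c) (g := fun p => U p ^ 2)
      (fun x _ y _ hxy => Subtype.ext (add_right_cancel hxy)) (fun _ => sq_nonneg _)
      fun k _ hk => ?_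
    obtain ⟨i, hi⟩ := exists_site_eq (M := M) ⟨k, k.2, hc k⟩
    exact absurd (Finset.mem_image.mpr ⟨i, Finset.mem_univ _, hi⟩) hk
  have c0 := h1 0 (fun k => by simp [corners])
  have c1 := h1 (1, 0) (fun k => by simp [corners])
  have c2 := h1 (0, 1) (fun k => by simp [corners])
  have c3 := h1 (1, 1) (fun k => by simp [corners])
  simp only [add_zero] at c0
  rw [dotProduct_stiffness_mulVec]
  calc ∑ k : M.activeCells, M.cellEnergy (U ∘ M.site) k
      ≤ ∑ k : M.activeCells, 32 / M.h * ∑ p ∈ corners k, U p ^ 2 :=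
        Finset.sum_le_sum fun k _ => (hM.cellEnergy_estimates hch k.2 U).2
    _ = 32 / M.h * (∑ k : M.activeCells, U k ^ 2 +
          ∑ k : M.activeCells, U ((k : ℤ × ℤ) + (1, 0)) ^ 2 +
          ∑ k : M.activeCells, U ((k : ℤ × ℤ) + (0, 1)) ^ 2 +
          ∑ k : M.activeCells, U ((k : ℤ × ℤ) + (1, 1)) ^ 2) := by
        simp only [sum_corners, ← Finset.mul_sum, Finset.sum_add_distrib]
    _ ≤ 32 / M.h * (4 * ∑ i, U (M.site i) ^ 2) := by
        gcongr
        linarith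
    _ = _ := by ring

lemma dotProduct_stiffness_nonneg (hM : M.NondegenerateCut) (hch : M.HasCharts)
    (U : ℤ × ℤ → ℝ) : 0 ≤ (U ∘ M.site) ⬝ᵥ M.stiffness *ᵥ (U ∘ M.site) := by
  have hh := M.h_pos
  rw [dotProduct_stiffness_mulVec]
  refine Finset.sum_nonneg fun k _ => ?_
  obtain ⟨a, b, hcr, -⟩ := hM.exists_crossings hch k.2
  have ha : a ∈ M.cutSegment k := subset_convexHull ℝ _ (by simp [hcr])
  have h1 := (sq_nonneg _).trans ((hM.cellEnergy_estimates hch k.2 U).1 a ha a ha)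
  exact nonneg_of_mul_nonneg_right h1 (by positivity)

/-! ### The extrapolation in `ℓ²` -/

open Classical in
lemma sum_ite_eq_subtype (A : Set (ℤ × ℤ)) [Fintype A] (U : ℤ × ℤ → ℝ) (ω : ℤ × ℤ) (c : ℝ) :
    ∑ ξ : A, (if (ξ : ℤ × ℤ) = ω then c else 0) * U ξ = c * if ω ∈ A then U ω else 0 := by
  by_cases h : ω ∈ A
  · rw [if_pos h, Finset.sum_eq_single ⟨ω, h⟩ (fun ξ _ hξ => ?_) (by simp)]
    · simp
    · rw [if_neg fun h' => hξ (Subtype.ext h'), zero_mul]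
  · rw [if_neg h, mul_zero]
    refine Finset.sum_eq_zero fun ξ _ => ?_
    rw [if_neg (by rintro rfl; exact h ξ.2), zero_mul]

open Classical in
lemma extrapCoeff_sum (A : Set (ℤ × ℤ)) [Fintype A] (U : ℤ × ℤ → ℝ) (η : ℤ × ℤ)
    (d : (ℤ × ℤ) × (ℤ × ℤ)) : ∑ ξ : A, extrapCoeff η d ξ * U ξ =
      -(if η - d.1 ∈ A then U (η - d.1) else 0)
        + (1 / 2) * (if η - 2 • d.1 ∈ A then U (η - 2 • d.1) else 0)
        - (if η - d.2 ∈ A then U (η - d.2) else 0)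
        + (1 / 2) * (if η - 2 • d.2 ∈ A then U (η - 2 • d.2) else 0) := by
  have h1 := sum_ite_eq_subtype A U (η - d.1) 2
  have h2 := sum_ite_eq_subtype A U (η - 2 • d.1) 1
  have h3 := sum_ite_eq_subtype A U (η - d.2) 2
  have h4 := sum_ite_eq_subtype A U (η - 2 • d.2) 1
  have e : ∀ ξ : A, extrapCoeff η d ξ * U ξ =
      -(1 / 2) * ((if (ξ : ℤ × ℤ) = η - d.1 then (2 : ℝ) else 0) * U ξ) +
      (1 / 2) * ((if (ξ : ℤ × ℤ) = η - 2 • d.1 then (1 : ℝ) else 0) * U ξ) -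
      (1 / 2) * ((if (ξ : ℤ × ℤ) = η - d.2 then (2 : ℝ) else 0) * U ξ) +
      (1 / 2) * ((if (ξ : ℤ × ℤ) = η - 2 • d.2 then (1 : ℝ) else 0) * U ξ) := by
    intro ξ
    unfold extrapCoeff
    ring
  simp only [e, Finset.sum_add_distrib, Finset.sum_sub_distrib, ← Finset.mul_sum]
  rw [h1, h2, h3, h4]
  ring

open Classical in
lemma sq_extrapCoeff_sum_le (A : Set (ℤ × ℤ)) [Fintype A] (U : ℤ × ℤ → ℝ) (η : ℤ × ℤ)
    {d : (ℤ × ℤ) × (ℤ × ℤ)} (h1 : d.1 ∈ directions) (h2 : d.2 ∈ directions) :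
    (∑ ξ : A, extrapCoeff η d ξ * U ξ) ^ 2 ≤ 8 * ∑ a ∈ directions,
      ((if η - a ∈ A then U (η - a) ^ 2 else 0) +
        (if η - 2 • a ∈ A then U (η - 2 • a) ^ 2 else 0)) := by
  rw [extrapCoeff_sum]
  have hle : ∀ a ∈ directions, (if η - a ∈ A then U (η - a) else 0) ^ 2 +
      (if η - 2 • a ∈ A then U (η - 2 • a) else 0) ^ 2 ≤ ∑ a ∈ directions,
      ((if η - a ∈ A then U (η - a) ^ 2 else 0) +
        (if η - 2 • a ∈ A then U (η - 2 • a) ^ 2 else 0)) := by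
    intro a ha
    refine le_trans (le_of_eq ?_) (Finset.single_le_sum (f := fun a =>
      ((if η - a ∈ A then U (η - a) ^ 2 else 0) +
        (if η - 2 • a ∈ A then U (η - 2 • a) ^ 2 else 0))) (fun a _ => by positivity) ha)
    simp only [ite_pow, zero_pow two_ne_zero]
  have k1 := hle _ h1
  have k2 := hle _ h2
  set x := if η - d.1 ∈ A then U (η - d.1) else 0
  set y := if η - 2 • d.1 ∈ A then U (η - 2 • d.1) else 0
  set z := if η - d.2 ∈ A then U (η - d.2) else 0
  set w := if η - 2 • d.2 ∈ A then U (η - 2 • d.2) else 0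
  -- The weights `1, 1/2, 1, 1/2` have square sum `5/2`, and either pair of squares is bounded by
  -- the full sum.
  nlinarith [sq_nonneg (x + y), sq_nonneg (x - z), sq_nonneg (x + w), sq_nonneg (y + z),
    sq_nonneg (y - w), sq_nonneg (z + w), sq_nonneg x, sq_nonneg y, sq_nonneg z, sq_nonneg w]

lemma sum_sq_extrapCoeff_sum_le (A : Set (ℤ × ℤ)) [Fintype A] (U : ℤ × ℤ → ℝ)
    {d : M.γ₃ → (ℤ × ℤ) × (ℤ × ℤ)} (h1 : ∀ η, (d η).1 ∈ directions)
    (h2 : ∀ η, (d η).2 ∈ directions) :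
    ∑ η : M.γ₃, (∑ ξ : A, extrapCoeff η (d η) ξ * U ξ) ^ 2 ≤ 64 * ∑ ξ ∈ A.toFinset, U ξ ^ 2 := by
  classical
  have key : ∀ a : ℤ × ℤ, ∑ η : M.γ₃, (if (η : ℤ × ℤ) - a ∈ A then U (η - a) ^ 2 else 0) ≤
      ∑ ξ ∈ A.toFinset, U ξ ^ 2 := by
    intro a
    have h3 := sum_comp_le (s := (Finset.univ : Finset M.γ₃)) (t := A.toFinset)
      (f := fun η => (η : ℤ × ℤ) - a) (g := fun ξ => if ξ ∈ A then U ξ ^ 2 else 0)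
      (fun x _ y _ hxy => Subtype.ext (sub_left_injective hxy)) (fun y => by positivity)
      (fun x _ hx => by simp only [Set.mem_toFinset] at hx; rw [if_neg hx])
    refine h3.trans (le_of_eq (Finset.sum_congr rfl fun ξ hξ => ?_))
    rw [if_pos (Set.mem_toFinset.mp hξ)]
  refine (Finset.sum_le_sum fun (η : M.γ₃) _ =>
    sq_extrapCoeff_sum_le A U η (h1 η) (h2 η)).trans ?_
  rw [← Finset.mul_sum, Finset.sum_comm]
  have h4 : ∀ a ∈ directions, ∑ η : M.γ₃,
      ((if (η : ℤ × ℤ) - a ∈ A then U (η - a) ^ 2 else 0) +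
        (if (η : ℤ × ℤ) - 2 • a ∈ A then U (η - 2 • a) ^ 2 else 0)) ≤
      2 * ∑ ξ ∈ A.toFinset, U ξ ^ 2 := by
    intro a _
    rw [Finset.sum_add_distrib]
    have := key a
    have := key (2 • a)
    linarith
  have h5 := Finset.sum_le_sum h4
  rw [sum_directions (fun _ => 2 * ∑ ξ ∈ A.toFinset, U ξ ^ 2)] at h5
  linarith

/-! ### The reduced trial space -/

/-- The coefficient vectors in the range of the reconstruction are the nodal values of functions
that are discrete harmonic in the interior and extrapolated to `γ₃`. -/
lemma exists_harmonic_representative {κ : ℝ} {l : LayerKind}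
    (d : M.γ₃ → (ℤ × ℤ) × (ℤ × ℤ)) (hP : IsUnit (M.P₂ κ l)) (v : M.γ₂ → ℝ) :
    ∃ U : ℤ × ℤ → ℝ, DiscreteHarmonicOn M.innerSites U ∧ U ∘ M.site = M.E κ l d *ᵥ v ∧
      (∀ y : M.γ₂, U y = v y) ∧ ∀ η : M.γ₃, U η =
        -(∑ ξ : M.γ₁, extrapCoeff η (d η) ξ * U ξ + ∑ ξ : M.γ₂, extrapCoeff η (d η) ξ * U ξ) := by
  classical
  set μ := (M.P₂ κ l)⁻¹ *ᵥ v with hμ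
  -- The layer potential with density `P₂⁻¹ v`, evaluated on the whole lattice and not only on the
  -- active vertices.
  set U₀ : ℤ × ℤ → ℝ := fun x => ∑ y : M.γ₂, M.layerKernel κ l x y * μ y with hU₀
  have hharm₀ : DiscreteHarmonicOn M.innerSites U₀ := by
    intro x hx
    simp only [hU₀]
    rw [Finset.sum_comm, Finset.mul_sum]
    refine Finset.sum_congr rfl fun y _ => ?_
    have hy : (y : ℤ × ℤ) ∉ M.innerSites := notMem_innerSites.mpr y.2.2.1
    have h1 := M.sum_layerKernel κ l (x := x) (y := y) (fun h => hy (h ▸ hx)) (fun z hz hza h => by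
      -- A dipole site `z` is inactive, whereas an inner vertex adjacent to an exterior one is
      -- active, so the double layer has no singularity at inner vertices.
      subst h
      obtain ⟨a, ha, hax⟩ := Finset.mem_image.mp hz
      have hxa : x + -a = y := by rw [← hax]; exact add_neg_cancel_right _ _
      exact hza (boundary_edge_active (neg_mem_directions ha) hx (by rwa [hxa])).1.1)
    rw [← Finset.sum_mul]
    simp only [h1]
    ring
  have hv₀ : ∀ y : M.γ₂, U₀ y = v y := by
    intro y
    have h1 : M.P₂ κ l *ᵥ μ = v := by
      rw [hμ, Matrix.mulVec_mulVec, Matrix.mul_nonsing_inv _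
        ((Matrix.isUnit_iff_isUnit_det _).mp hP), Matrix.one_mulVec]
    exact congrFun h1 y
  have hH₀ : ∀ x : M.γ₁, U₀ x = (M.harmExt κ l *ᵥ v) x := by
    intro x
    rw [harmExt, ← Matrix.mulVec_mulVec]
    rfl
  -- Overwriting the values on `γ₃` keeps harmonicity, since no stencil of an inner vertex meets
  -- `γ₃`.
  set U : ℤ × ℤ → ℝ := fun p => if p ∈ M.γ₃ then
    (if h : p ∈ M.γ₃ then -(M.J κ l d *ᵥ v) ⟨p, h⟩ else 0) else U₀ p with hU
  have hU1 : ∀ p, p ∉ M.γ₃ → U p = U₀ p := fun p hp => by simp only [hU, if_neg hp]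
  have hU3 : ∀ η : M.γ₃, U η = -(M.J κ l d *ᵥ v) η := fun η => by
    simp only [hU, η.2, if_true, dif_pos]
  have hn1 : ∀ p, p ∈ M.γ₁ → p ∉ M.γ₃ := fun p hp hp3 => absurd hp.2 (not_le.mpr hp3.2.1)
  have hn2 : ∀ p, p ∈ M.γ₂ → p ∉ M.γ₃ := fun p hp hp3 => hp3.2.2 hp
  have hn0 : ∀ p, p ∈ M.innerSites → p ∉ M.γ₃ := fun p hp hp3 =>
    absurd (mem_innerSites.mp hp) (not_le.mpr hp3.2.1)
  refine ⟨U, ?_, ?_, fun y => by rw [hU1 _ (hn2 _ y.2), hv₀], fun η => ?_⟩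
  · intro x hx
    rw [hU1 x (hn0 x hx), ← hharm₀ x hx]
    refine Finset.sum_congr rfl fun a ha => hU1 _ ?_
    by_cases hxa : x + a ∈ M.innerSites
    · exact hn0 _ hxa
    · exact hn2 _ (boundary_edge_active ha hx hxa).2
  · funext i
    rw [E, Matrix.fromRows_mulVec, Matrix.fromRows_mulVec]
    rcases i with x | y | η
    · simp only [Function.comp_apply, site, Sum.elim_inl]
      rw [hU1 _ (hn1 _ x.2), hH₀]
    · simp only [Function.comp_apply, site, Sum.elim_inl, Sum.elim_inr, Matrix.one_mulVec]
      rw [hU1 _ (hn2 _ y.2), hv₀]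
    · simp only [Function.comp_apply, site, Sum.elim_inr, Matrix.neg_mulVec, Pi.neg_apply]
      exact hU3 η
  · rw [hU3 η, J, Matrix.add_mulVec, ← Matrix.mulVec_mulVec, Pi.add_apply]
    congr 2
    · refine Finset.sum_congr rfl fun ξ _ => ?_
      rw [hU1 _ (hn1 _ ξ.2), hH₀]
      rfl
    · refine Finset.sum_congr rfl fun ξ _ => ?_
      rw [hU1 _ (hn2 _ ξ.2), hv₀]
      rfl

lemma sum_toFinset_eq (A : Set (ℤ × ℤ)) [Fintype A] (f : ℤ × ℤ → ℝ) :
    ∑ x ∈ A.toFinset, f x = ∑ x : A, f x := by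
  rw [Finset.sum_set_coe]

lemma dotProduct_Kred (κ : ℝ) (l : LayerKind) (d : M.γ₃ → (ℤ × ℤ) × (ℤ × ℤ)) (v : M.γ₂ → ℝ) :
    v ⬝ᵥ M.Kred κ l d *ᵥ v = (M.E κ l d *ᵥ v) ⬝ᵥ M.stiffness *ᵥ (M.E κ l d *ᵥ v) := by
  rw [Kred, ← Matrix.mulVec_mulVec, ← Matrix.mulVec_mulVec, Matrix.dotProduct_mulVec,
    Matrix.vecMul_transpose]

/-- Two-sided bounds for the reduced stiffness form. -/
lemma NondegenerateCut.Kred_bounds (hM : M.NondegenerateCut) (hch : M.HasCharts) {C₀ : ℝ}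
    (hC₀ : M.h * Fintype.card M.activeCells ≤ C₀) {κ : ℝ} {l : LayerKind}
    {d : M.γ₃ → (ℤ × ℤ) × (ℤ × ℤ)} (hP : IsUnit (M.P₂ κ l)) (hd : M.IsExtrapolation d)
    (v : M.γ₂ → ℝ) :
    v ⬝ᵥ M.Kred κ l d *ᵥ v ≤ 10 ^ 7 / M.h * (v ⬝ᵥ v) ∧
      (v ∈ M.meanZero κ l d →
        M.h * (v ⬝ᵥ v) ≤ 10 ^ 14 * C₀ ^ 2 * (v ⬝ᵥ M.Kred κ l d *ᵥ v)) := by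
  have hh := M.h_pos
  obtain ⟨U, hU, hUE, hU2, hU3⟩ := exists_harmonic_representative d hP v
  have hvv : v ⬝ᵥ v = ∑ y ∈ M.γ₂.toFinset, U y ^ 2 := by
    rw [sum_toFinset_eq, dotProduct]
    refine Finset.sum_congr rfl fun y _ => ?_
    rw [hU2 y]; ring
  rw [dotProduct_Kred, ← hUE]
  constructor
  · have h1 := dotProduct_stiffness_le hM hch U
    have h2 := sum_γ₁_le hch hU
    have h3 : ∑ η : M.γ₃, U η ^ 2 ≤
        128 * (∑ ξ ∈ M.γ₁.toFinset, U ξ ^ 2 + ∑ ξ ∈ M.γ₂.toFinset, U ξ ^ 2) := by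
      have k1 := sum_sq_extrapCoeff_sum_le (M := M) M.γ₁ U (d := d) (fun η => (hd η).1.1)
        (fun η => (hd η).2.1.1)
      have k2 := sum_sq_extrapCoeff_sum_le (M := M) M.γ₂ U (d := d) (fun η => (hd η).1.1)
        (fun η => (hd η).2.1.1)
      have k3 : ∑ η : M.γ₃, U η ^ 2 ≤
          ∑ η : M.γ₃, 2 * (∑ ξ : M.γ₁, extrapCoeff η (d η) ξ * U ξ) ^ 2 +
          ∑ η : M.γ₃, 2 * (∑ ξ : M.γ₂, extrapCoeff η (d η) ξ * U ξ) ^ 2 := by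
        rw [← Finset.sum_add_distrib]
        refine Finset.sum_le_sum fun η _ => ?_
        rw [hU3 η]
        nlinarith [sq_nonneg (∑ ξ : M.γ₁, extrapCoeff η (d η) ξ * U ξ -
          ∑ ξ : M.γ₂, extrapCoeff η (d η) ξ * U ξ)]
      simp only [← Finset.mul_sum] at k3
      linarith
    have h4 : ∑ i, U (M.site i) ^ 2 = ∑ ξ ∈ M.γ₁.toFinset, U ξ ^ 2 +
        (∑ ξ ∈ M.γ₂.toFinset, U ξ ^ 2 + ∑ η : M.γ₃, U η ^ 2) := by
      rw [Fintype.sum_sum_type, Fintype.sum_sum_type, sum_toFinset_eq, sum_toFinset_eq]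
      rfl
    -- The three blocks contribute `84`, `1` and `128 · 85` times `v ⬝ᵥ v`.
    have h5 : ∑ i, U (M.site i) ^ 2 ≤ 11000 * (v ⬝ᵥ v) := by
      have h0 : 0 ≤ ∑ y ∈ M.γ₂.toFinset, U y ^ 2 := by positivity
      rw [h4, hvv]; linarith
    have h0 : 0 ≤ v ⬝ᵥ v := by rw [hvv]; positivity
    calc _ ≤ 128 / M.h * ∑ i, U (M.site i) ^ 2 := h1
      _ ≤ 128 / M.h * (11000 * (v ⬝ᵥ v)) := by gcongr
      _ = 1408000 * (1 / M.h) * (v ⬝ᵥ v) := by ring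
      _ ≤ 10 ^ 7 * (1 / M.h) * (v ⬝ᵥ v) := by gcongr; norm_num
      _ = _ := by ring
  · intro hmean
    rw [meanZero, Set.mem_ofPred_eq, ← hUE] at hmean
    set N := (Fintype.card M.activeCells : ℝ) with hN
    set 𝓔 := (U ∘ M.site) ⬝ᵥ M.stiffness *ᵥ (U ∘ M.site)
    have hsq : ∀ k ∈ M.activeCells, ∀ x ∈ M.cutSegment k,
        M.feFun (U ∘ M.site) x ^ 2 ≤ 24 * (M.h * N) * 𝓔 := fun k hk x hx =>
      hM.sq_feFun_le hch U hmean (k := ⟨k, hk⟩) hx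
    have hN0 : 0 ≤ N := Nat.cast_nonneg _
    have hNC : 0 ≤ M.h * N := mul_nonneg hh.le hN0
    have h𝓔 : 0 ≤ 𝓔 := dotProduct_stiffness_nonneg hM hch U
    have hE : 0 ≤ 24 * (M.h * N) * 𝓔 := by positivity
    have h1 := sum_γ₂_le_trace hch hU (Real.sqrt_nonneg (24 * (M.h * N) * 𝓔))
      fun k hk x hx => Real.abs_le_sqrt (hsq k hk x hx)
    rw [Real.sq_sqrt hE, ← hvv] at h1
    have h2 := card_γ₁_le (M := M)
    -- One factor `N` counts the boundary vertices, the other comes from Cauchy–Schwarz along the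
    -- discrete curve; a further `h` makes both harmless.
    have h3 : v ⬝ᵥ v ≤ 10 ^ 12 * (4 * N * (24 * (M.h * N) * 𝓔)) := by
      refine h1.trans ?_
      gcongr
    calc M.h * (v ⬝ᵥ v) ≤ M.h * (10 ^ 12 * (4 * N * (24 * (M.h * N) * 𝓔))) := by gcongr
      _ = 96 * 10 ^ 12 * (M.h * N) ^ 2 * 𝓔 := by ring
      _ ≤ 10 ^ 14 * C₀ ^ 2 * 𝓔 := by gcongr; norm_num

end CutMesh

/-! ### The condition number -/

/-- Two-sided bounds of a quadratic form on `W` bound its condition number there. -/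
lemma condNumberOn_le {n : Type*} [Fintype n] {A : Matrix n n ℝ} {W : Set (n → ℝ)} {a b : ℝ}
    (ha : 0 < a) (hb : 0 < b) (hlow : ∀ v ∈ W, a * (v ⬝ᵥ v) ≤ v ⬝ᵥ A *ᵥ v)
    (hup : ∀ v ∈ W, v ⬝ᵥ A *ᵥ v ≤ b * (v ⬝ᵥ v)) : condNumberOn A W ≤ b / a := by
  rw [condNumberOn]
  have hpos : ∀ v : n → ℝ, v ≠ 0 → 0 < v ⬝ᵥ v := fun v hv =>
    lt_of_le_of_ne (Finset.sum_nonneg fun i _ => mul_self_nonneg (v i))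
      (Ne.symm (mt dotProduct_self_eq_zero.mp hv))
  have hsup : sSup (rayleighValues A W) ≤ b := Real.sSup_le (by
    rintro _ ⟨v, hv, hv0, rfl⟩
    exact (div_le_iff₀ (hpos v hv0)).mpr (hup v hv)) hb.le
  rcases (rayleighValues A W).eq_empty_or_nonempty with he | hne
  -- On a trivial space the supremum takes the default value zero, and the quotient vanishes.
  · rw [he, Real.sSup_empty, zero_div]
    positivity
  · have hinf : a ≤ sInf (rayleighValues A W) := le_csInf hne (by
      rintro _ ⟨v, hv, hv0, rfl⟩
      exact (le_div_iff₀ (hpos v hv0)).mpr (hlow v hv))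
    exact div_le_div₀ hb.le hsup ha hinf

theorem mainTheorem3 (Γ : LevelSetCurve) :
    ∃ C > (0 : ℝ), ∃ h₀ > (0 : ℝ), ∀ M : CutMesh Γ, M.h ≤ h₀ → M.NondegenerateCut →
      ∀ (κ : ℝ) (l : LayerKind) (d : M.γ₃ → (ℤ × ℤ) × (ℤ × ℤ)),
        IsUnit (M.P₂ κ l) → M.IsExtrapolation d →
          (∀ v ∈ M.meanZero κ l d, v ≠ 0 → 0 < v ⬝ᵥ M.Kred κ l d *ᵥ v) ∧
            condNumberOn (M.Kred κ l d) (M.meanZero κ l d) ≤ C * (M.h ^ 2)⁻¹ := by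
  obtain ⟨h₁, hh₁, hchart⟩ := exists_chart Γ
  obtain ⟨C₀, hC₀, hcard⟩ := CutMesh.exists_card_activeCells_le Γ
  -- The quotient of the upper bound `10⁷ / h` by the lower bound `h / (10¹⁴ C₀²)`.
  refine ⟨10 ^ 7 * (10 ^ 14 * C₀ ^ 2), by positivity, min h₁ 1, lt_min hh₁ one_pos, ?_⟩
  intro M hM hcut κ l d hP hd
  have hh := M.h_pos
  have key := hcut.Kred_bounds (hchart M (hM.trans (min_le_left _ _)))
    (hcard M (hM.trans (min_le_right _ _))) hP hd
  have hlow : ∀ v ∈ M.meanZero κ l d,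
      M.h / (10 ^ 14 * C₀ ^ 2) * (v ⬝ᵥ v) ≤ v ⬝ᵥ M.Kred κ l d *ᵥ v := by
    intro v hv
    rw [div_mul_eq_mul_div, div_le_iff₀ (by positivity), mul_comm (v ⬝ᵥ _)]
    exact (key v).2 hv
  refine ⟨fun v hv hv0 => lt_of_lt_of_le (mul_pos (by positivity) ?_) (hlow v hv), ?_⟩
  · exact lt_of_le_of_ne (Finset.sum_nonneg fun i _ => mul_self_nonneg (v i))
      (Ne.symm (mt dotProduct_self_eq_zero.mp hv0))
  · refine (condNumberOn_le (by positivity) (by positivity) hlow fun v _ => (key v).1).trans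
      (le_of_eq ?_)
    field_simp
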